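/- **Setting.** Everything is $C^\infty$. A hyperbolic Monge–Ampère system on a 5-manifold $M$ is an ideal $\mathcal I$ of differential forms that is locally generated by a contact form $\theta$ (so $\theta\wedge d\theta\wedge d\theta\ne0$), by $\Theta=d\theta$ and by a 2-form $\Psi$, such that at each point the equation $(\lambda\Theta+\mu\Psi)\wedge(\lambda\Theta+\mu\Psi)\equiv0 \bmod\theta$ has two distinct real roots $[\lambda:\mu]$. A Bäcklund transformation between two such systems $(M_1,\mathcal I_1)$, $(M_2,\mathcal I_2)$ is an embedded 6-dimensional submanifold $\mathcal B\subset M_1\times M_2$ whose projections $\pi_i:\mathcal B\to M_i$ are submersions and such that, for suitable local generators $\theta_i,\Theta_i,\Psi_i$ of $\mathcal I_i$ pulled back to $\mathcal B$, one has $\{\Psi_1,\Psi_2\}\equiv\{\Theta_1,\Theta_2\}$ and $\{\Theta_1,\Psi_1\}\equiv\{\Theta_2,\Psi_2\}$ (equality of spans) modulo $\{\theta_1,\theta_2\}$, with $\Theta_1,\Theta_2$ linearly independent modulo $\{\theta_1,\theta_2\}$ at each point. A local coframing $(\theta_1,\theta_2,\omega^1,\omega^2,\omega^3,\omega^4)$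 of $\mathcal B$ is 0-adapted if $\theta_i$ is a multiple of the pulled-back contact form of $M_i$, the ideal generated by $\pi_1^*\mathcal I_1$ and $\pi_2^*\mathcal I_2$ is $\{\theta_1,\theta_2,\omega^1\wedge\omega^2,\omega^3\wedge\omega^4\}$, and $$d\theta_1\equiv A_1\,\omega^1\wedge\omega^2+\omega^3\wedge\omega^4 \bmod\theta_1,\qquad d\theta_2\equiv \omega^1\wedge\omega^2+A_2\,\omega^3\wedge\omega^4 \bmod\theta_2$$ with $A_1,A_2$ nowhere zero and $A_1A_2\ne1$. For such a coframing let $C_1,C_2$ be the coefficients of $\omega^3\wedge\omega^4$ in $d\omega^1,d\omega^2$, and $C_3,C_4$ the coefficients of $\omega^1\wedge\omega^2$ in $d\omega^3,d\omega^4$. On $\mathbb R^5$ with coordinates $(x,y,z,p,q)$ the wave equation $z_{xy}=0$ is the Monge–Ampère system $\mathcal W=\{dz-p\,dx-q\,dy,\ dp\wedge dx,\ dq\wedge dy\}$. Its solutions are its 2-dimensional (immersed) integral manifolds. **Theorem.** Let $\mathcal B\subset M_1\times M_2$ be a Bäcklund transformation such that near each point of $\mathcal B$ some 0-adapted coframing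 has $C_1=C_2=C_3=C_4=0$ (homogeneity is not assumed), and let $b_0\in\mathcal B$. Then there are diffeomorphisms $f,g$ between open subsets of $\mathbb R^2$, with $$0\neq\det Df(v)\neq\det Dg(w)\neq0\quad\text{for all }v,w\text{ in their respective domains,}$$ such that near $b_0$ the transformation $\mathcal B$ is contact equivalent to the transformation $\mathcal B'\subset\mathbb R^5\times\mathbb R^5$ between solutions of $z_{xy}=0$ given by $$(x_2,p_2)=f(x_1,p_1),\qquad (y_2,q_2)=g(y_1,q_1).$$ That is, there are diffeomorphisms $\varphi_i$ from open neighbourhoods $U_i$ of $\pi_i(b_0)$ onto open subsets $V_i$ of $\mathbb R^5$ with $\varphi_i^*\mathcal W=\mathcal I_i$ on $U_i$ and $(\varphi_1\times\varphi_2)(\mathcal B\cap(U_1\times U_2))=\mathcal B'\cap(V_1\times V_2)$. Moreover, under $\mathcal B'$ new solutions are obtained from given ones by quadrature. Let $s:\Omega\to\mathbb R^5$, with $\Omega\subset\mathbb R^2$ open and convex and $u_0\in\Omega$, be any parametrized solution of $\mathcal W$ along which $(x_1,p_1)$ and $(y_1,q_1)$ stay in the domains of $f$ and $g$. Then the parametrized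 solutions $\sigma:\Omega\to\mathbb R^5$ of $\mathcal W$ with $(s(u),\sigma(u))\in\mathcal B'$ for all $u\in\Omega$ are exactly the maps $(x_2,y_2,z_2,p_2,q_2)$ with $(x_2,p_2)=f(x_1,p_1)$, $(y_2,q_2)=g(y_1,q_1)$ along $s$, and $$z_2(u)=c+\int_{u_0}^{u}\bigl(p_2\,dx_2+q_2\,dy_2\bigr)\quad\text{(along the segment)},\qquad c\in\mathbb R .$$ The same holds in the opposite direction, with $f^{-1},g^{-1}$ in place of $f,g$. -/

import Mathlib

open scoped Manifold ContDiff Topology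

namespace Backlund

/-! ### Exterior algebra at a point -/

section Pointwise

variable {V W : Type*} [AddCommGroup V] [Module ℝ V] [TopologicalSpace V]
  [AddCommGroup W] [Module ℝ W] [TopologicalSpace W]

/-- The wedge product of two covectors, `(α ∧ β)(v, w) = α(v) β(w) - α(w) β(v)`. -/
def wedge (α β : V [⋀^Fin 1]→L[ℝ] ℝ) : V [⋀^Fin 2]→L[ℝ] ℝ where
  toFun v := α ![v 0] * β ![v 1] - α ![v 1] * β ![v 0]
  map_update_add' := by
    intro _ m i x y
    have upd : ∀ z : V, Function.update ![(0 : V)] 0 z = ![z] := fun z => by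
      ext j; fin_cases j; simp
    have hα : ∀ x y : V, α ![x + y] = α ![x] + α ![y] := fun x y => by
      simpa only [upd, smul_eq_mul] using α.map_update_add ![0] 0 x y
    have hβ : ∀ x y : V, β ![x + y] = β ![x] + β ![y] := fun x y => by
      simpa only [upd, smul_eq_mul] using β.map_update_add ![0] 0 x y
    fin_cases i <;> simp [Function.update, hα, hβ] <;> ring
  map_update_smul' := by
    intro _ m i c x
    have upd : ∀ z : V, Function.update ![(0 : V)] 0 z = ![z] := fun z => by
      ext j; fin_cases j; simp
    have hα : ∀ x : V, α ![c • x] = c * α ![x] := fun x => by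
      simpa only [upd, smul_eq_mul] using α.map_update_smul ![0] 0 c x
    have hβ : ∀ x : V, β ![c • x] = c * β ![x] := fun x => by
      simpa only [upd, smul_eq_mul] using β.map_update_smul ![0] 0 c x
    fin_cases i <;> simp [Function.update, hα, hβ] <;> ring
  cont := by
    have h : ∀ i : Fin 2, Continuous fun v : Fin 2 → V => ![v i] := fun i =>
      continuous_pi fun j => by fin_cases j; exact continuous_apply i
    exact ((α.cont.comp (h 0)).mul (β.cont.comp (h 1))).sub
      ((α.cont.comp (h 1)).mul (β.cont.comp (h 0)))
  map_eq_zero_of_eq' := by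
    intro v i j h hij
    fin_cases i <;> fin_cases j <;> simp_all

theorem wedge_apply (α β : V [⋀^Fin 1]→L[ℝ] ℝ) (v : Fin 2 → V) :
    wedge α β v = α ![v 0] * β ![v 1] - α ![v 1] * β ![v 0] := rfl

/-- The value on four vectors of the wedge product of two 2-covectors. -/
def wedge₂ (Φ Ψ : V [⋀^Fin 2]→L[ℝ] ℝ) (v : Fin 4 → V) : ℝ :=
  Φ ![v 0, v 1] * Ψ ![v 2, v 3] - Φ ![v 0, v 2] * Ψ ![v 1, v 3]
    + Φ ![v 0, v 3] * Ψ ![v 1, v 2] + Φ ![v 1, v 2] * Ψ ![v 0, v 3]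
    - Φ ![v 1, v 3] * Ψ ![v 0, v 2] + Φ ![v 2, v 3] * Ψ ![v 0, v 1]

/-- `Φ ∧ Φ ≡ 0 mod θ`: the 4-covector `Φ ∧ Φ` vanishes on the kernel of the covector `θ`. -/
def SqZeroMod (θ : V [⋀^Fin 1]→L[ℝ] ℝ) (Φ : V [⋀^Fin 2]→L[ℝ] ℝ) : Prop :=
  ∀ v : Fin 4 → V, (∀ i, θ ![v i] = 0) → wedge₂ Φ Φ v = 0

/-- The degree-2 part of the algebraic ideal generated by a set of covectors. -/
def idealTwo (S : Set (V [⋀^Fin 1]→L[ℝ] ℝ)) : Submodule ℝ (V [⋀^Fin 2]→L[ℝ] ℝ) :=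
  Submodule.span ℝ {Φ | ∃ σ ∈ S, ∃ τ : V [⋀^Fin 1]→L[ℝ] ℝ, Φ = wedge σ τ}

/-- Pullback of `k`-covectors along a continuous linear map. -/
abbrev pull {k : ℕ} (L : V →L[ℝ] W) : (W [⋀^Fin k]→L[ℝ] ℝ) →ₗ[ℝ] (V [⋀^Fin k]→L[ℝ] ℝ) :=
  ContinuousAlternatingMap.compContinuousLinearMapₗ L

end Pointwise

/-! ### Differential forms on manifolds -/

/-- The model space `ℝⁿ`. -/
abbrev E (n : ℕ) : Type := EuclideanSpace ℝ (Fin n)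

/-- Not necessarily smooth differential `k`-forms on an `n`-manifold. -/
abbrev Form (n k : ℕ) (M : Type*) [TopologicalSpace M] [ChartedSpace (E n) M] : Type _ :=
  (x : M) → TangentSpace (𝓡 n) x [⋀^Fin k]→L[ℝ] ℝ

section Forms

variable {n k : ℕ} {M : Type*} [TopologicalSpace M] [ChartedSpace (E n) M]

/-- The expression of `φ` in the preferred chart at `x₀`, as a form on `ℝⁿ`. -/
noncomputable def chartRep (φ : Form n k M) (x₀ : M) : E n → E n [⋀^Fin k]→L[ℝ] ℝ :=
  fun y => (φ ((extChartAt (𝓡 n) x₀).symm y)).compContinuousLinearMap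
    (mfderiv 𝓘(ℝ, E n) (𝓡 n) (extChartAt (𝓡 n) x₀).symm y)

/-- `φ` is a smooth form on the open set `U`. -/
def SmoothFormOn (φ : Form n k M) (U : Set M) : Prop :=
  ∀ x ∈ U, ContDiffAt ℝ ∞ (chartRep φ x) (extChartAt (𝓡 n) x x)

/-- The exterior derivative, computed in charts. -/
noncomputable def d (φ : Form n k M) : Form n (k + 1) M :=
  fun x => (extDeriv (chartRep φ x) (extChartAt (𝓡 n) x x)).compContinuousLinearMap
    (mfderiv (𝓡 n) 𝓘(ℝ, E n) (extChartAt (𝓡 n) x) x)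

end Forms

/-! ### Monge-Ampère systems -/

/-- The pointwise degree-1 and degree-2 parts of an ideal of differential forms.
They determine a Monge-Ampère ideal on a 5-manifold: its degree-0 part is zero, and, since `dθ` is
nondegenerate on the 4-dimensional kernel of `θ`, it contains all forms of degree at least 3
(in particular it is differentially closed). -/
structure FormIdeal (n : ℕ) (M : Type*) [TopologicalSpace M] [ChartedSpace (E n) M] where
  deg1 : (x : M) → Submodule ℝ (TangentSpace (𝓡 n) x [⋀^Fin 1]→L[ℝ] ℝ)
  deg2 : (x : M) → Submodule ℝ (TangentSpace (𝓡 n) x [⋀^Fin 2]→L[ℝ] ℝ)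

section MongeAmpere

variable {M : Type*} [TopologicalSpace M] [ChartedSpace (E 5) M]

/-- On the open set `U`, `I` is the ideal generated by a contact form `θ`, by `Θ = dθ`, and by a
2-form `Ψ`, and it is hyperbolic there. The contact condition `θ ∧ dθ ∧ dθ ≠ 0` is written as
`θ ≠ 0` and `dθ ∧ dθ ≢ 0 mod θ`; hyperbolicity says that the (nonzero) quadratic equation
`(λ Θ + μ Ψ) ∧ (λ Θ + μ Ψ) ≡ 0 mod θ` has two distinct real roots `[λ : μ]`. -/
structure IsHyperbolicGenerator (I : FormIdeal 5 M) (U : Set M)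
    (θ : Form 5 1 M) (Ψ : Form 5 2 M) : Prop where
  smooth_θ : SmoothFormOn θ U
  smooth_Ψ : SmoothFormOn Ψ U
  ne_zero : ∀ x ∈ U, θ x ≠ 0
  contact : ∀ x ∈ U, ¬ SqZeroMod (θ x) (d θ x)
  deg1_eq : ∀ x ∈ U, I.deg1 x = Submodule.span ℝ {θ x}
  deg2_eq : ∀ x ∈ U, I.deg2 x = Submodule.span ℝ {d θ x, Ψ x} ⊔ idealTwo {θ x}
  hyperbolic : ∀ x ∈ U, ∃ l₁ m₁ l₂ m₂ : ℝ, l₁ * m₂ - l₂ * m₁ ≠ 0 ∧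
    SqZeroMod (θ x) (l₁ • d θ x + m₁ • Ψ x) ∧ SqZeroMod (θ x) (l₂ • d θ x + m₂ • Ψ x)

/-- A hyperbolic Monge-Ampère system on a 5-manifold. -/
def IsHyperbolicMongeAmpere (I : FormIdeal 5 M) : Prop :=
  ∀ x₀ : M, ∃ U : Set M, IsOpen U ∧ x₀ ∈ U ∧
    ∃ (θ : Form 5 1 M) (Ψ : Form 5 2 M), IsHyperbolicGenerator I U θ Ψ

end MongeAmpere

/-! ### Bäcklund transformations -/

section Transformation

variable {M₁ M₂ B : Type*} [TopologicalSpace M₁] [ChartedSpace (E 5) M₁]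
  [TopologicalSpace M₂] [ChartedSpace (E 5) M₂] [TopologicalSpace B] [ChartedSpace (E 6) B]

/-- The pullback to the cotangent space of `B` at `b` along the projection `π`. -/
noncomputable abbrev pullAt {M : Type*} [TopologicalSpace M] [ChartedSpace (E 5) M]
    (π : B → M) (b : B) {k : ℕ} :
    (TangentSpace (𝓡 5) (π b) [⋀^Fin k]→L[ℝ] ℝ) →ₗ[ℝ] (TangentSpace (𝓡 6) b [⋀^Fin k]→L[ℝ] ℝ) :=
  pull (mfderiv (𝓡 6) (𝓡 5) π b)

/-- The 6-manifold `B`, embedded in `M₁ × M₂` by `(π₁, π₂)`, is a Bäcklund transformation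
between the Monge-Ampère systems `(M₁, I₁)` and `(M₂, I₂)`. -/
structure IsBacklund (I₁ : FormIdeal 5 M₁) (I₂ : FormIdeal 5 M₂) (π₁ : B → M₁) (π₂ : B → M₂) :
    Prop where
  smooth₁ : ContMDiff (𝓡 6) (𝓡 5) ∞ π₁
  smooth₂ : ContMDiff (𝓡 6) (𝓡 5) ∞ π₂
  embedding : Topology.IsEmbedding fun b => (π₁ b, π₂ b)
  immersion : ∀ (b : B) (v : TangentSpace (𝓡 6) b),
    mfderiv (𝓡 6) (𝓡 5) π₁ b v = 0 → mfderiv (𝓡 6) (𝓡 5) π₂ b v = 0 → v = 0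
  submersion₁ : ∀ b, Function.Surjective (mfderiv (𝓡 6) (𝓡 5) π₁ b)
  submersion₂ : ∀ b, Function.Surjective (mfderiv (𝓡 6) (𝓡 5) π₂ b)
  /-- For suitable local generators, modulo `{θ₁, θ₂}`: `{Ψ₁, Ψ₂} ≡ {Θ₁, Θ₂}`,
  `{Θ₁, Ψ₁} ≡ {Θ₂, Ψ₂}`, and `Θ₁, Θ₂` are linearly independent. -/
  pencil : ∀ b : B, ∃ (U₁ : Set M₁) (U₂ : Set M₂) (θ₁ : Form 5 1 M₁) (Ψ₁ : Form 5 2 M₁)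
    (θ₂ : Form 5 1 M₂) (Ψ₂ : Form 5 2 M₂),
    IsOpen U₁ ∧ π₁ b ∈ U₁ ∧ IsHyperbolicGenerator I₁ U₁ θ₁ Ψ₁ ∧
    IsOpen U₂ ∧ π₂ b ∈ U₂ ∧ IsHyperbolicGenerator I₂ U₂ θ₂ Ψ₂ ∧
    Submodule.span ℝ {pullAt π₁ b (Ψ₁ (π₁ b)), pullAt π₂ b (Ψ₂ (π₂ b))}
        ⊔ idealTwo {pullAt π₁ b (θ₁ (π₁ b)), pullAt π₂ b (θ₂ (π₂ b))}
      = Submodule.span ℝ {pullAt π₁ b (d θ₁ (π₁ b)), pullAt π₂ b (d θ₂ (π₂ b))}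
        ⊔ idealTwo {pullAt π₁ b (θ₁ (π₁ b)), pullAt π₂ b (θ₂ (π₂ b))} ∧
    Submodule.span ℝ {pullAt π₁ b (d θ₁ (π₁ b)), pullAt π₁ b (Ψ₁ (π₁ b))}
        ⊔ idealTwo {pullAt π₁ b (θ₁ (π₁ b)), pullAt π₂ b (θ₂ (π₂ b))}
      = Submodule.span ℝ {pullAt π₂ b (d θ₂ (π₂ b)), pullAt π₂ b (Ψ₂ (π₂ b))}
        ⊔ idealTwo {pullAt π₁ b (θ₁ (π₁ b)), pullAt π₂ b (θ₂ (π₂ b))} ∧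
    ∀ s t : ℝ, s • pullAt π₁ b (d θ₁ (π₁ b)) + t • pullAt π₂ b (d θ₂ (π₂ b))
        ∈ idealTwo {pullAt π₁ b (θ₁ (π₁ b)), pullAt π₂ b (θ₂ (π₂ b))} → s = 0 ∧ t = 0

/-- `η = (θ₁, θ₂, ω¹, ω², ω³, ω⁴)` is a 0-adapted coframing on the open set `W ⊆ B`:
`θᵢ` spans the pullback of the contact line of `Mᵢ`,
the ideal generated by the pullbacks of `I₁, I₂` is `{θ₁, θ₂, ω¹ ∧ ω², ω³ ∧ ω⁴}`, and
`dθ₁ ≡ A₁ ω¹ ∧ ω² + ω³ ∧ ω⁴ mod θ₁`, `dθ₂ ≡ ω¹ ∧ ω² + A₂ ω³ ∧ ω⁴ mod θ₂`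
with `A₁, A₂` nonvanishing and `A₁ A₂ ≠ 1`. -/
structure IsZeroAdapted (I₁ : FormIdeal 5 M₁) (I₂ : FormIdeal 5 M₂) (π₁ : B → M₁) (π₂ : B → M₂)
    (W : Set B) (η : Fin 6 → Form 6 1 B) : Prop where
  smooth : ∀ i, SmoothFormOn (η i) W
  coframing : ∀ b ∈ W, LinearIndependent ℝ fun i => η i b
  contact₁ : ∀ b ∈ W, Submodule.span ℝ {η 0 b} = (I₁.deg1 (π₁ b)).map (pullAt π₁ b)
  contact₂ : ∀ b ∈ W, Submodule.span ℝ {η 1 b} = (I₂.deg1 (π₂ b)).map (pullAt π₂ b)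
  ideal : ∀ b ∈ W,
    (I₁.deg2 (π₁ b)).map (pullAt π₁ b) ⊔ (I₂.deg2 (π₂ b)).map (pullAt π₂ b)
        ⊔ idealTwo {η 0 b, η 1 b}
      = Submodule.span ℝ {wedge (η 2 b) (η 3 b), wedge (η 4 b) (η 5 b)}
        ⊔ idealTwo {η 0 b, η 1 b}
  torsion : ∀ b ∈ W, ∃ A₁ A₂ : ℝ, A₁ ≠ 0 ∧ A₂ ≠ 0 ∧ A₁ * A₂ ≠ 1 ∧
    d (η 0) b - (A₁ • wedge (η 2 b) (η 3 b) + wedge (η 4 b) (η 5 b)) ∈ idealTwo {η 0 b} ∧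
    d (η 1) b - (wedge (η 2 b) (η 3 b) + A₂ • wedge (η 4 b) (η 5 b)) ∈ idealTwo {η 1 b}

/-- `e` is the basis of the tangent space at `b` dual to the coframing `η`. -/
def IsDualFrame (η : Fin 6 → Form 6 1 B) (b : B) (e : Fin 6 → TangentSpace (𝓡 6) b) : Prop :=
  ∀ i j, η i b ![e j] = if i = j then 1 else 0

/-- The torsion coefficients `C₁, C₂, C₃, C₄` of the coframing `η = (θ₁, θ₂, ω¹, ω², ω³, ω⁴)`
with dual frame `e`: `C₁, C₂` are the coefficients of `ω³ ∧ ω⁴` in `dω¹, dω²`, and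
`C₃, C₄` are the coefficients of `ω¹ ∧ ω²` in `dω³, dω⁴`. -/
noncomputable def torsionC (η : Fin 6 → Form 6 1 B) (b : B)
    (e : Fin 6 → TangentSpace (𝓡 6) b) : Fin 4 → ℝ :=
  ![d (η 2) b ![e 4, e 5], d (η 3) b ![e 4, e 5], d (η 4) b ![e 2, e 3], d (η 5) b ![e 2, e 3]]

/-- `C₁ = C₂ = C₃ = C₄ = 0` on all of `B`, in some 0-adapted coframing near each point
(the condition does not depend on the choice of the 0-adapted coframing). -/
def TorsionCVanishes (I₁ : FormIdeal 5 M₁) (I₂ : FormIdeal 5 M₂) (π₁ : B → M₁) (π₂ : B → M₂) :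
    Prop :=
  ∀ b₀ : B, ∃ W : Set B, IsOpen W ∧ b₀ ∈ W ∧ ∃ η : Fin 6 → Form 6 1 B,
    IsZeroAdapted I₁ I₂ π₁ π₂ W η ∧
    ∀ b ∈ W, ∀ e, IsDualFrame η b e → ∀ i, torsionC η b e i = 0

/-- Near the point `b₀`, the Bäcklund transformation `B ⊆ M₁ × M₂` is contact equivalent to
`B' ⊆ N₁ × N₂`: there are diffeomorphisms `φᵢ` from open neighbourhoods of `πᵢ(b₀)` onto open
subsets of `Nᵢ` that pull the ideal of `Nᵢ` back to the ideal of `Mᵢ` and whose product carries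
`B` to `B'`. -/
def ContactEquivalentNear {N₁ N₂ : Type*} [TopologicalSpace N₁] [ChartedSpace (E 5) N₁]
    [TopologicalSpace N₂] [ChartedSpace (E 5) N₂]
    (I₁ : FormIdeal 5 M₁) (I₂ : FormIdeal 5 M₂) (π₁ : B → M₁) (π₂ : B → M₂) (b₀ : B)
    (J₁ : FormIdeal 5 N₁) (J₂ : FormIdeal 5 N₂) (B' : Set (N₁ × N₂)) : Prop :=
  ∃ (φ₁ : OpenPartialHomeomorph M₁ N₁) (φ₂ : OpenPartialHomeomorph M₂ N₂),
    π₁ b₀ ∈ φ₁.source ∧ π₂ b₀ ∈ φ₂.source ∧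
    ContMDiffOn (𝓡 5) (𝓡 5) ∞ φ₁ φ₁.source ∧ ContMDiffOn (𝓡 5) (𝓡 5) ∞ φ₁.symm φ₁.target ∧
    ContMDiffOn (𝓡 5) (𝓡 5) ∞ φ₂ φ₂.source ∧ ContMDiffOn (𝓡 5) (𝓡 5) ∞ φ₂.symm φ₂.target ∧
    (∀ m ∈ φ₁.source,
      I₁.deg1 m = (J₁.deg1 (φ₁ m)).map (pull (mfderiv (𝓡 5) (𝓡 5) φ₁ m)) ∧
      I₁.deg2 m = (J₁.deg2 (φ₁ m)).map (pull (mfderiv (𝓡 5) (𝓡 5) φ₁ m))) ∧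
    (∀ m ∈ φ₂.source,
      I₂.deg1 m = (J₂.deg1 (φ₂ m)).map (pull (mfderiv (𝓡 5) (𝓡 5) φ₂ m)) ∧
      I₂.deg2 m = (J₂.deg2 (φ₂ m)).map (pull (mfderiv (𝓡 5) (𝓡 5) φ₂ m))) ∧
    ∀ m₁ ∈ φ₁.source, ∀ m₂ ∈ φ₂.source,
      (∃ b : B, π₁ b = m₁ ∧ π₂ b = m₂) ↔ (φ₁ m₁, φ₂ m₂) ∈ B'

end Transformation

/-! ### The wave equation and its transformations -/

/-- The coordinate 1-form `dxᵢ` on `ℝ⁵`, at any point. -/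
noncomputable def dcoord (i : Fin 5) : E 5 [⋀^Fin 1]→L[ℝ] ℝ :=
  ContinuousAlternatingMap.ofSubsingleton ℝ (E 5) ℝ 0 (EuclideanSpace.proj i)

/-- The contact form `dz - p dx - q dy` on `ℝ⁵` with coordinates `(x, y, z, p, q)`. -/
noncomputable def waveContact (m : E 5) : E 5 [⋀^Fin 1]→L[ℝ] ℝ :=
  dcoord 2 - m 3 • dcoord 0 - m 4 • dcoord 1

/-- The Monge-Ampère ideal `{dz - p dx - q dy, dp ∧ dx, dq ∧ dy}` of the wave equation
`z_xy = 0` on `ℝ⁵` with coordinates `(x, y, z, p, q)`. -/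
noncomputable def waveIdeal : FormIdeal 5 (E 5) where
  deg1 m := Submodule.span ℝ {waveContact m}
  deg2 m := Submodule.span ℝ {wedge (dcoord 3) (dcoord 0), wedge (dcoord 4) (dcoord 1)}
    ⊔ idealTwo {waveContact m}

/-- The coordinates `(x, p)` of a point `(x, y, z, p, q)`. -/
def xp (m : E 5) : ℝ × ℝ := (m 0, m 3)

/-- The coordinates `(y, q)` of a point `(x, y, z, p, q)`. -/
def yq (m : E 5) : ℝ × ℝ := (m 1, m 4)

/-- The subset of `ℝ⁵ × ℝ⁵` given by `(x₂, p₂) = f(x₁, p₁)`, `(y₂, q₂) = g(y₁, q₁)`, where `f` and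
`g` are defined on open subsets of the plane. -/
def waveTransformation (f g : OpenPartialHomeomorph (ℝ × ℝ) (ℝ × ℝ)) : Set (E 5 × E 5) :=
  {m | xp m.1 ∈ f.source ∧ yq m.1 ∈ g.source ∧ xp m.2 = f (xp m.1) ∧ yq m.2 = g (yq m.1)}

/-- `s : Ω → M` is a parametrized 2-dimensional integral manifold of the ideal `I`: a smooth
immersion along which all forms of `I` vanish. -/
structure IsIntegralSurface {M : Type*} [TopologicalSpace M] [ChartedSpace (E 5) M]
    (I : FormIdeal 5 M) (Ω : Set (E 2)) (s : E 2 → M) : Prop where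
  smooth : ContMDiffOn (𝓡 2) (𝓡 5) ∞ s Ω
  immersion : ∀ u ∈ Ω, Function.Injective (mfderiv (𝓡 2) (𝓡 5) s u)
  deg1 : ∀ u ∈ Ω, ∀ α ∈ I.deg1 (s u), pull (mfderiv (𝓡 2) (𝓡 5) s u) α = 0
  deg2 : ∀ u ∈ Ω, ∀ Φ ∈ I.deg2 (s u), pull (mfderiv (𝓡 2) (𝓡 5) s u) Φ = 0

/-- The 1-form `p₂ dx₂ + q₂ dy₂` along the surface `s`, where `(x₂, p₂) = f(x₁, p₁)` and
`(y₂, q₂) = g(y₁, q₁)`. -/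
noncomputable def quadratureForm (f g : ℝ × ℝ → ℝ × ℝ) (s : E 2 → E 5) (u : E 2) : E 2 →L[ℝ] ℝ :=
  (f (xp (s u))).2 • fderiv ℝ (fun w => (f (xp (s w))).1) u
    + (g (yq (s u))).2 • fderiv ℝ (fun w => (g (yq (s w))).1) u

/-- The surface `(x₂, y₂, z₂, p₂, q₂)` obtained from `s` by substitution and one quadrature,
`z₂ = c + ∫ (p₂ dx₂ + q₂ dy₂)`, the integral being taken along the segment from `u₀`. -/
noncomputable def quadratureSurface (f g : ℝ × ℝ → ℝ × ℝ) (s : E 2 → E 5) (u₀ : E 2) (c : ℝ)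
    (u : E 2) : E 5 :=
  !₂[(f (xp (s u))).1, (g (yq (s u))).1,
    c + curveIntegral (quadratureForm f g s) (Path.segment u₀ u),
    (f (xp (s u))).2, (g (yq (s u))).2]

/-- Given any solution `s` of the wave equation (in the domain of the transformation, parametrized
by a convex open set), the surfaces corresponding to it under the transformation that are again
solutions are exactly the surfaces obtained by quadrature, one for each constant `c`. -/
def SolvedByQuadrature (f g : OpenPartialHomeomorph (ℝ × ℝ) (ℝ × ℝ)) : Prop :=
  ∀ (Ω : Set (E 2)) (s : E 2 → E 5) (u₀ : E 2), IsOpen Ω → Convex ℝ Ω → u₀ ∈ Ω →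
    IsIntegralSurface waveIdeal Ω s → (∀ u ∈ Ω, xp (s u) ∈ f.source ∧ yq (s u) ∈ g.source) →
    ∀ σ : E 2 → E 5,
      (IsIntegralSurface waveIdeal Ω σ ∧ ∀ u ∈ Ω, (s u, σ u) ∈ waveTransformation f g) ↔
        ∃ c : ℝ, ∀ u ∈ Ω, σ u = quadratureSurface f g s u₀ c u

end Backlund

/-! Write ω¹, ω² and ω³, ω⁴ for the two pairs of a 0-adapted coframing. Both systems have the same
characteristic pairs on `B`, and the fibre of each projection is a line dual to the contact form of
the other side. The forms `dθᵢ` and `Ψᵢ` come from `Mᵢ`, so their Lie derivatives along the fibre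
vanish. By hyperbolicity they are independent combinations of ω¹∧ω² and ω³∧ω⁴, and therefore the
fibre direction is a Cauchy characteristic of each characteristic system (`ed_vertical`).

In the frame `e 0, …, e 5` dual to (θ₁, θ₂, ω¹, …, ω⁴), the only possible obstructions to
integrability of {ω¹, ω²} are then the values of dω¹, dω² on (e₄, e₅) and on (e₀, e₁). The former
are C₁, C₂. If they vanish, the Jacobi identity for e₁, e₄, e₅ removes the latter, because [e₄, e₅]
has a nonzero θ₁-component (`ed_eq_zero`). The same holds for {ω³, ω⁴}. Frobenius' theorem then
gives first integrals u, v : B → ℝ². They are constant on the fibres of both projections, hence are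
functions on `M₁` and also on `M₂`.

On each `Mᵢ` this leaves a contact form with dθ ≡ a du₁∧du₂ + c dv₁∧dv₂ mod θ. The Jacobi identities
of the frame dual to (du, dv, θ) show that log|c/a| is a function of u plus a function of v
(`along_log_ratio`). So θ can be rescaled until d(ρθ) is an area form in u plus an area form in v.
Choosing plane maps F, G with these Jacobians up to sign gives ρθ = dz - p dx - q dy with (x, p) =
F(u) and (y, q) = G(v) (`exists_normalForm`), which are wave coordinates.

Since u and v are common to both sides, (x₂, p₂) = F₂(F₁⁻¹(x₁, p₁)), and likewise for (y, q) with G.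
The two Jacobians are ratios of the coefficients of the ρᵢdθᵢ. They differ because dθ₁, dθ₂ are
independent modulo {θ₁, θ₂}, which is A₁A₂ ≠ 1. As (u, v, z₁, z₂) are coordinates on `B`, no further
relation links the two points (`exists_waveTransformation`). Along a solution dx∧dp = dy∧dq = 0;
plane maps preserve this, so p₂dx₂ + q₂dy₂ is closed and z₂ is found by quadrature
(`solvedByQuadrature`).

Frobenius' theorem itself is derived from the inverse function theorem in a Banach space of
continuous paths (`frobenius_normalized`), where smooth dependence on parameters comes with the
theorem. -/

namespace Backlund

open Set Filter

/-! ### Smooth local inverses and cut-off extensions -/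

section LocalDiffeo

variable {X Y : Type*} [NormedAddCommGroup X] [NormedSpace ℝ X] [CompleteSpace X]
  [NormedAddCommGroup Y] [NormedSpace ℝ Y]

/-- Inverse function theorem, with smoothness of the inverse on a whole neighbourhood. -/
theorem exists_localDiffeo {Φ : X → Y} {N : Set X} {x₀ : X} (hN : IsOpen N) (hx₀ : x₀ ∈ N)
    (hΦ : ContDiffOn ℝ ∞ Φ N) {L : X ≃L[ℝ] Y} (hL : fderiv ℝ Φ x₀ = L) :
    ∃ e : OpenPartialHomeomorph X Y, x₀ ∈ e.source ∧ e.source ⊆ N ∧ (∀ x, e x = Φ x) ∧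
      ContDiffOn ℝ ∞ e.symm e.target ∧
      ∀ x ∈ e.source, ∃ L' : X ≃L[ℝ] Y, HasFDerivAt Φ (L' : X →L[ℝ] Y) x := by
  have hat : ∀ x ∈ N, ContDiffAt ℝ ∞ Φ x := fun x hx => hΦ.contDiffAt (hN.mem_nhds hx)
  have hd : ∀ x ∈ N, HasFDerivAt Φ (fderiv ℝ Φ x) x := fun x hx =>
    ((hat x hx).differentiableAt (by simp)).hasFDerivAt
  have h0 : HasFDerivAt Φ (L : X →L[ℝ] Y) x₀ := hL ▸ hd x₀ hx₀
  set e₀ := (hat x₀ hx₀).toOpenPartialHomeomorph Φ h0 (by simp)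
  have hc : ContinuousOn (fderiv ℝ Φ) N := hΦ.continuousOn_fderiv_of_isOpen hN (by simp)
  -- Invertibility of the derivative is an open condition. Restricting to it makes the inverse
  -- smooth on the whole target and not only at the image of `x₀`.
  have hO : IsOpen (N ∩ fderiv ℝ Φ ⁻¹' range ((↑) : (X ≃L[ℝ] Y) → X →L[ℝ] Y)) :=
    hc.isOpen_inter_preimage hN ContinuousLinearEquiv.isOpen
  refine ⟨e₀.restrOpen _ hO, ?_, ?_, fun x => rfl, ?_, ?_⟩
  · exact ⟨(hat x₀ hx₀).mem_toOpenPartialHomeomorph_source h0 (by simp), hx₀, L, hL.symm⟩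
  · exact fun x hx => hx.2.1
  · intro y hy
    have hy' := (e₀.restrOpen _ hO).map_target hy
    obtain ⟨-, hyN, L', hL'⟩ := hy'
    refine ((e₀.restrOpen _ hO).contDiffAt_symm hy (f₀' := L') ?_ ?_).contDiffWithinAt
    · rw [hL']; exact hd _ hyN
    · exact hat _ hyN
  · rintro x ⟨-, hxN, L', hL'⟩
    exact ⟨L', hL' ▸ hd x hxN⟩

end LocalDiffeo

/-- A function smooth near a point agrees near this point with a globally smooth function. -/
theorem exists_contDiff_eventuallyEq {X Y : Type*} [NormedAddCommGroup X] [NormedSpace ℝ X]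
    [FiniteDimensional ℝ X] [NormedAddCommGroup Y] [NormedSpace ℝ Y] {f : X → Y} {N : Set X}
    {x₀ : X} (hN : IsOpen N) (hx₀ : x₀ ∈ N) (hf : ContDiffOn ℝ ∞ f N) :
    ∃ g : X → Y, ContDiff ℝ ∞ g ∧ g =ᶠ[𝓝 x₀] f := by
  obtain ⟨r, hr, hrN⟩ := Metric.isOpen_iff.1 hN x₀ hx₀
  -- The support has radius `r / 2 < r`, so near a point outside the ball of radius `r` the product
  -- with `f` is identically zero.
  let χ : ContDiffBump x₀ := ⟨r / 4, r / 2, by positivity, by linarith⟩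
  refine ⟨fun x => χ x • f x, ?_, ?_⟩
  · rw [contDiff_iff_contDiffAt]
    intro x
    by_cases hx : x ∈ Metric.ball x₀ r
    · exact χ.contDiff.contDiffAt.smul (hf.contDiffAt (hN.mem_nhds (hrN hx)))
    · have hx' : x ∉ tsupport χ := by
        rw [χ.tsupport_eq]
        simp only [Metric.mem_ball, not_lt] at hx
        simp only [Metric.mem_closedBall, not_le]
        show r / 2 < _
        linarith
      have : (fun x => χ x • f x) =ᶠ[𝓝 x] fun _ => 0 := by
        filter_upwards [(notMem_tsupport_iff_eventuallyEq.1 hx')] with z hz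
        simp [hz]
      exact contDiffAt_const.congr_of_eventuallyEq this
  · filter_upwards [χ.eventuallyEq_one] with x hx
    simp [hx]

/-! ### Smooth calculus on spaces of continuous maps -/

/-- Continuous maps into a normed space, with the topology of the norm. -/
abbrev NormedPath (K X : Type*) [TopologicalSpace K] [NormedAddCommGroup X] : Type _ := C(K, X)

section Composition

variable {K : Type*} [TopologicalSpace K] [CompactSpace K]

section

variable (K) (X Y : Type*) [NormedAddCommGroup X] [NormedSpace ℝ X]
  [NormedAddCommGroup Y] [NormedSpace ℝ Y]

/-- Pointwise application of a family of operators to a family of vectors. -/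
noncomputable def applyL : NormedPath K (X →L[ℝ] Y) →L[ℝ] NormedPath K X →L[ℝ] NormedPath K Y :=
  LinearMap.mkContinuous₂
    (LinearMap.mk₂ ℝ (fun (A : NormedPath K (X →L[ℝ] Y)) (c : NormedPath K X) =>
      (⟨fun s => A s (c s), by fun_prop⟩ : NormedPath K Y))
      (by intros; ext; simp) (by intros; ext; simp) (by intros; ext; simp) (by intros; ext; simp))
    1 (by
      intro A c
      rw [one_mul, ContinuousMap.norm_le _ (by positivity)]
      intro s
      exact ((A s).le_opNorm _).trans (mul_le_mul (A.norm_coe_le_norm s) (c.norm_coe_le_norm s)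
        (norm_nonneg _) (by positivity)))

end

universe u

/-- The derivative of the composition operator `c ↦ f ∘ c`. -/
theorem hasFDerivAt_comp {X Y : Type*} [NormedAddCommGroup X] [NormedSpace ℝ X]
    [NormedAddCommGroup Y] [NormedSpace ℝ Y] {f : X → Y} {f' : X → X →L[ℝ] Y} (hc : Continuous f)
    (hf : ∀ x, HasFDerivAt f (f' x) x) (hf' : Continuous f') (c : NormedPath K X) :
    HasFDerivAt (fun c : NormedPath K X => (⟨f, hc⟩ : C(X, Y)).comp c)
      (applyL K X Y ((⟨f', hf'⟩ : C(X, X →L[ℝ] Y)).comp c)) c := by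
  rw [hasFDerivAt_iff_isLittleO, Asymptotics.isLittleO_iff]
  intro ε hε
  have hcont : Continuous fun c : NormedPath K X => (⟨f', hf'⟩ : C(X, X →L[ℝ] Y)).comp c :=
    ContinuousMap.continuous_postcomp _
  set F : NormedPath K X → NormedPath K (X →L[ℝ] Y) := fun c => (⟨f', hf'⟩ : C(X, X →L[ℝ] Y)).comp c with hF
  -- Continuity of `c ↦ f' ∘ c` in the sup norm gives one `δ` that serves all points of `K`; the
  -- mean value inequality is then applied pointwise, with the uniform constant `ε`.
  have hb : Metric.ball (F c) ε ∈ 𝓝 (F c) := Metric.ball_mem_nhds (F c) hε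
  obtain ⟨δ, hδ, hball⟩ := Metric.mem_nhds_iff.1 (hcont.continuousAt hb)
  filter_upwards [Metric.ball_mem_nhds c hδ] with c' hc'
  rw [ContinuousMap.norm_le _ (by positivity)]
  intro s
  have key := (convex_segment (𝕜 := ℝ) (c s) (c' s)).norm_image_sub_le_of_norm_hasFDerivWithin_le'
    (f := f) (f' := f') (φ := f' (c s)) (C := ε) (fun x _ => (hf x).hasFDerivWithinAt) ?_
    (left_mem_segment _ _ _) (right_mem_segment _ _ _)
  · refine key.trans (mul_le_mul_of_nonneg_left ?_ hε.le)
    exact (c' - c).norm_coe_le_norm s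
  · rintro x hx
    rw [segment_eq_image_lineMap] at hx
    obtain ⟨t, ht, rfl⟩ := hx
    have h1 : dist (AffineMap.lineMap c c' t : NormedPath K X) c < δ := by
      rw [dist_lineMap_left]
      refine lt_of_le_of_lt (mul_le_of_le_one_left dist_nonneg ?_) (by rwa [dist_comm])
      rw [Real.norm_eq_abs, abs_of_nonneg ht.1]; exact ht.2
    have h2 := (ContinuousMap.dist_apply_le_dist s).trans_lt (show dist (F _) (F c) < ε from hball h1)
    rw [dist_eq_norm] at h2
    have h3 : (AffineMap.lineMap c c' t : NormedPath K X) s = AffineMap.lineMap (c s) (c' s) t := by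
      simp [AffineMap.lineMap_apply]
    have h4 : F (AffineMap.lineMap c c' t) s = f' (AffineMap.lineMap (c s) (c' s) t) := by
      rw [← h3]; rfl
    rw [h4] at h2
    exact h2.le

/-- The composition operator `c ↦ f ∘ c` on continuous maps is smooth if `f` is. -/
theorem contDiff_comp {X Y : Type u} [NormedAddCommGroup X] [NormedSpace ℝ X]
    [NormedAddCommGroup Y] [NormedSpace ℝ Y] {f : X → Y} (hf : ContDiff ℝ ∞ f) :
    ContDiff ℝ ∞ fun c : NormedPath K X => (⟨f, hf.continuous⟩ : C(X, Y)).comp c := by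
  rw [contDiff_infty]
  intro n
  -- The derivative of composition with `f` is governed by composition with `fderiv ℝ f`, whose
  -- values lie in `X →L[ℝ] Y`. So the target must vary in the induction, and `X`, `Y` share a
  -- universe.
  induction n generalizing Y with
  | zero =>
    exact contDiff_zero.2 (ContinuousMap.continuous_postcomp _)
  | succ n ih =>
    have hf1 : ContDiff ℝ ∞ (fderiv ℝ f) := hf.fderiv_right (by simp)
    have hd : ∀ c : NormedPath K X, HasFDerivAt _ _ c := fun c =>
      hasFDerivAt_comp hf.continuous
        (fun x => (hf.differentiable (by simp) x).hasFDerivAt) hf1.continuous c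
    push_cast
    rw [contDiff_succ_iff_hasFDerivAt]
    refine ⟨_, ?_, hd⟩
    exact (applyL K X Y).contDiff.comp (ih hf1)

end Composition

end Backlund

/-! ### Paths, integration along them, and the normalised Frobenius theorem -/

namespace Backlund

open Set Filter

/-- Continuous paths in a normed space. -/
abbrev UPath (X : Type*) [NormedAddCommGroup X] : Type _ := NormedPath unitInterval X

section Ode

variable {H : Type*} [NormedAddCommGroup H] [NormedSpace ℝ H]

/-- Grönwall uniqueness, used forwards from 0 and, after reversing time, backwards from 1. The
equivalence is what compares the kernel of a first integral with the given distribution. -/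
theorem eq_zero_of_norm_deriv_le {f f' : ℝ → H} {C : ℝ}
    (hf : ∀ s ∈ Icc (0 : ℝ) 1, HasDerivAt f (f' s) s)
    (hC : ∀ s ∈ Icc (0 : ℝ) 1, ‖f' s‖ ≤ C * ‖f s‖) : f 0 = 0 ↔ f 1 = 0 := by
  constructor
  · intro h0
    refine eq_zero_of_abs_deriv_le_mul_abs_self_of_eq_zero_right (f' := f')
      (fun s hs => (hf s hs).continuousAt.continuousWithinAt)
      (fun s hs => (hf s (Ico_subset_Icc_self hs)).hasDerivWithinAt) h0
      (fun s hs => hC s (Ico_subset_Icc_self hs)) 1 (by simp)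
  · intro h1
    have hm : ∀ s ∈ Icc (0 : ℝ) 1, 1 - s ∈ Icc (0 : ℝ) 1 := fun s hs =>
      ⟨by linarith [hs.2], by linarith [hs.1]⟩
    have hd : ∀ s ∈ Icc (0 : ℝ) 1, HasDerivAt (fun s => f (1 - s)) (-(f' (1 - s))) s := by
      intro s hs
      have h := HasDerivAt.scomp s (hf (1 - s) (hm s hs)) ((hasDerivAt_id s).const_sub 1)
      rw [neg_one_smul] at h
      exact h
    have := eq_zero_of_abs_deriv_le_mul_abs_self_of_eq_zero_right (f := fun s => f (1 - s))
      (f' := fun s => -(f' (1 - s))) (K := C) (a := 0) (b := 1)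
      (fun s hs => (hd s hs).continuousAt.continuousWithinAt)
      (fun s hs => (hd s (Ico_subset_Icc_self hs)).hasDerivWithinAt) (by simpa using h1)
      (fun s hs => by simpa using hC _ (hm s (Ico_subset_Icc_self hs))) 1 (by simp)
    simpa using this

variable [CompleteSpace H]

/-- `s ↦ ∫_s^1 c` as a function on the line, for a continuous map `c` on the unit interval. -/
noncomputable def tailFun (c : UPath H) (s : ℝ) : H :=
  -∫ t in (1 : ℝ)..s, IccExtend zero_le_one c t

theorem hasDerivAt_tailFun (c : UPath H) (s : ℝ) :
    HasDerivAt (tailFun c) (-(IccExtend zero_le_one c s)) s := by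
  have hc : Continuous (IccExtend (zero_le_one (α := ℝ)) c) := c.continuous.Icc_extend'
  exact (intervalIntegral.integral_hasDerivAt_right (hc.intervalIntegrable _ _)
    (hc.stronglyMeasurableAtFilter _ _) hc.continuousAt).neg

omit [CompleteSpace H] in
theorem tailFun_one (c : UPath H) : tailFun c 1 = 0 := by simp [tailFun]

variable (H) in
/-- The operator `c ↦ (s ↦ ∫_s^1 c)`. -/
noncomputable def tail : UPath H →L[ℝ] UPath H :=
  LinearMap.mkContinuous
    { toFun := fun c => ⟨fun s => tailFun c s, by
        have : Continuous (tailFun c) :=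
          continuous_iff_continuousAt.2 fun s => (hasDerivAt_tailFun c s).continuousAt
        fun_prop⟩
      map_add' := fun c d => by
        ext s
        have hc : ∀ c : UPath H, Continuous (IccExtend (zero_le_one (α := ℝ)) c) :=
          fun c => c.continuous.Icc_extend'
        have : IccExtend (zero_le_one (α := ℝ)) (c + d : UPath H) =
          fun t => IccExtend zero_le_one c t + IccExtend zero_le_one d t := by
          ext t; simp [IccExtend]
        simp only [ContinuousMap.coe_mk, tailFun, ContinuousMap.add_apply]
        rw [this, intervalIntegral.integral_add ((hc c).intervalIntegrable _ _)
          ((hc d).intervalIntegrable _ _), neg_add]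
      map_smul' := fun r c => by
        ext s
        have : IccExtend (zero_le_one (α := ℝ)) (r • c : UPath H) =
          fun t => r • IccExtend zero_le_one c t := by
          ext t; simp [IccExtend]
        simp only [ContinuousMap.coe_mk, tailFun, ContinuousMap.smul_apply, RingHom.id_apply]
        rw [this, intervalIntegral.integral_smul, smul_neg] } 1 (by
    intro c
    rw [one_mul, ContinuousMap.norm_le _ (norm_nonneg _)]
    intro s
    simp only [LinearMap.coe_mk, AddHom.coe_mk, ContinuousMap.coe_mk, tailFun, norm_neg]
    refine (intervalIntegral.norm_integral_le_of_norm_le_const (C := ‖c‖) ?_).trans ?_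
    · intro t _
      exact c.norm_coe_le_norm _
    · refine mul_le_of_le_one_right (norm_nonneg _) ?_
      rw [abs_le]
      constructor <;> linarith [s.2.1, s.2.2])

end Ode

section

variable (X : Type*) [NormedAddCommGroup X] [NormedSpace ℝ X]

/-- Constant maps on the unit interval. -/
noncomputable def constPath : X →L[ℝ] UPath X :=
  LinearMap.mkContinuous
    { toFun := fun x => ContinuousMap.const _ x
      map_add' := fun _ _ => rfl
      map_smul' := fun _ _ => rfl } 1 fun x => by
    rw [one_mul, ContinuousMap.norm_le _ (norm_nonneg _)]
    intro s
    exact le_rfl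

/-- The linear paths `s ↦ s • x`. -/
noncomputable def rampPath : X →L[ℝ] UPath X :=
  LinearMap.mkContinuous
    { toFun := fun x => ⟨fun s => (s : ℝ) • x, by fun_prop⟩
      map_add' := fun _ _ => by ext; simp
      map_smul' := fun r x => by ext s; exact smul_comm (s : ℝ) r x } 1 fun x => by
    rw [one_mul, ContinuousMap.norm_le _ (norm_nonneg _)]
    intro s
    simp only [LinearMap.coe_mk, AddHom.coe_mk, ContinuousMap.coe_mk, norm_smul]
    refine mul_le_of_le_one_left (norm_nonneg _) ?_
    rw [Real.norm_eq_abs, abs_of_nonneg s.2.1]; exact s.2.2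

variable {X}

end

theorem hasFDerivAt_applyL_comp {K X Y Z : Type*} [TopologicalSpace K] [CompactSpace K]
    [NormedAddCommGroup X] [NormedSpace ℝ X] [NormedAddCommGroup Y] [NormedSpace ℝ Y]
    [NormedAddCommGroup Z] [NormedSpace ℝ Z] {M : Z → NormedPath K (X →L[ℝ] Y)}
    {M' : Z →L[ℝ] NormedPath K (X →L[ℝ] Y)} {z : Z} (hM : HasFDerivAt M M' z) :
    HasFDerivAt (fun z => applyL K X Y (M z)) ((applyL K X Y).comp M') z :=
  (applyL K X Y).hasFDerivAt.comp z hM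

theorem contDiff_applyL_comp {K X Y Z : Type*} [TopologicalSpace K] [CompactSpace K]
    [NormedAddCommGroup X] [NormedSpace ℝ X] [NormedAddCommGroup Y] [NormedSpace ℝ Y]
    [NormedAddCommGroup Z] [NormedSpace ℝ Z] {M : Z → NormedPath K (X →L[ℝ] Y)} (hM : ContDiff ℝ ∞ M) :
    ContDiff ℝ ∞ (fun z => applyL K X Y (M z)) :=
  (applyL K X Y).contDiff.comp hM

theorem continuous_norm_comp {X G : Type*} [TopologicalSpace X] [NormedAddCommGroup G]
    {f : X → G} (hf : Continuous f) : Continuous fun x => ‖f x‖ := hf.norm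

universe u

set_option maxHeartbeats 1000000 in
/-- Frobenius' theorem for a family of operators `W` normalised by a common right inverse. -/
theorem frobenius_normalized {V H : Type u} [NormedAddCommGroup V] [NormedSpace ℝ V]
    [CompleteSpace V] [NormedAddCommGroup H] [NormedSpace ℝ H] [CompleteSpace H]
    {W : V → V →L[ℝ] H} (hW : ContDiff ℝ ∞ W) {S : H →L[ℝ] V} {y₀ : V} {N : Set V}
    (hN : IsOpen N) (hy₀ : y₀ ∈ N) (hWS : ∀ y ∈ N, ∀ h, W y (S h) = h)
    (hint : ∀ y ∈ N, ∀ v w, W y v = 0 → W y w = 0 → fderiv ℝ W y v w = fderiv ℝ W y w v) :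
    ∃ (N' : Set V) (u : V → H), IsOpen N' ∧ y₀ ∈ N' ∧ ContDiffOn ℝ ∞ u N' ∧
      ∀ y ∈ N', ∀ v, fderiv ℝ u y v = 0 ↔ W y v = 0 := by
  -- `P` projects onto the kernel of `W y₀` along the range of `S`. A point `y` is joined to the
  -- transversal `y₀ + S H` by the path γ(s) = y₀ + s P(y - y₀) + S(c(s)), which is tangent to the
  -- distribution if c' = -W(γ) P(y - y₀). The condition c(1) = W(y₀)(y - y₀) makes it end at `y`,
  -- and the first integral is u(y) = c(0).
  set P : V →L[ℝ] V := ContinuousLinearMap.id ℝ V - S.comp (W y₀) with hP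
  set DW := fderiv ℝ W with hDW
  have hW' : ∀ y, HasFDerivAt W (DW y) y := fun y =>
    (hW.differentiable (by simp) y).hasFDerivAt
  have hDWc : ContDiff ℝ ∞ DW := hW.fderiv_right (by simp)
  set Wm : C(V, V →L[ℝ] H) := ⟨W, hW.continuous⟩
  set DWm : C(V, V →L[ℝ] V →L[ℝ] H) := ⟨DW, hDWc.continuous⟩
  set Sc : UPath H →L[ℝ] UPath V := S.compLeftContinuous ℝ unitInterval
  set Γ' : V × UPath H →L[ℝ] UPath V :=
    ((rampPath V).comp P).comp (.fst ℝ _ _) + Sc.comp (.snd ℝ _ _) with hΓ'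
  set Γ : V × UPath H → UPath V := fun q =>
    constPath V y₀ + Γ' (q.1 - y₀, q.2) with hΓ
  set M : V × UPath H → UPath (V →L[ℝ] H) :=
    fun q => Wm.comp (Γ q) with hM
  set A := applyL unitInterval V H
  -- Integrated form of the differential equation with its condition at s = 1: since `tail` is the
  -- integral from s to 1, the zeros of `R (y, ·)` are the wanted paths.
  set R : V × UPath H → UPath H := fun q =>
    q.2 - constPath H (W y₀ (q.1 - y₀)) - tail H (A (M q) (constPath V (P (q.1 - y₀)))) with hR
  have hΓ'ap : ∀ v d s, Γ' (v, d) s = (s : ℝ) • P v + S (d s) := fun v d s => rfl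
  have hΓap : ∀ y c s, Γ (y, c) s = y₀ + (s : ℝ) • P (y - y₀) + S (c s) := fun y c s => by
    rw [add_assoc]; rfl
  have hΓd : ∀ q, HasFDerivAt Γ Γ' q := by
    intro q
    have : Γ = fun q => constPath V y₀ + Γ' (q - (y₀, 0)) := by
      ext q s; exact congrArg (fun w => y₀ + Γ' w s) (Prod.ext rfl (sub_zero q.2).symm)
    rw [this]
    exact (Γ'.hasFDerivAt.comp q ((hasFDerivAt_id q).sub_const _)).const_add _
  have hΓs : ContDiff ℝ ∞ Γ := by
    have : ContDiff ℝ ∞ fun q : V × UPath H => Γ' (q.1 - y₀, q.2) :=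
      Γ'.contDiff.comp ((contDiff_fst.sub contDiff_const).prodMk contDiff_snd)
    exact contDiff_const.add this
  have hMs : ContDiff ℝ ∞ M := (contDiff_comp hW).comp hΓs
  set M' : V × UPath H → V × UPath H →L[ℝ]
      UPath (V →L[ℝ] H) :=
    fun q => (applyL unitInterval V (V →L[ℝ] H) (DWm.comp (Γ q))).comp Γ' with hM'
  have hMd : ∀ q, HasFDerivAt M (M' q) q := fun q =>
    (hasFDerivAt_comp hW.continuous hW' hDWc.continuous (Γ q)).comp q (hΓd q)
  have hκd : ∀ q : V × UPath H, HasFDerivAt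
      (fun q : V × UPath H => constPath V (P (q.1 - y₀)))
      (((constPath V).comp P).comp (.fst ℝ _ _)) q := fun q =>
    ((constPath V).comp P).hasFDerivAt.comp q (hasFDerivAt_fst.sub_const _)
  have hηd : ∀ q : V × UPath H, HasFDerivAt
      (fun q : V × UPath H => constPath H (W y₀ (q.1 - y₀)))
      (((constPath H).comp (W y₀)).comp (.fst ℝ _ _)) q := fun q =>
    ((constPath H).comp (W y₀)).hasFDerivAt.comp q (hasFDerivAt_fst.sub_const _)
  have hRs : ContDiff ℝ ∞ R := by
    have h1 : ContDiff ℝ ∞ fun q : V × UPath H => constPath V (P (q.1 - y₀)) :=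
      ((constPath V).comp P).contDiff.comp (contDiff_fst.sub contDiff_const)
    have h2 : ContDiff ℝ ∞ fun q : V × UPath H => constPath H (W y₀ (q.1 - y₀)) :=
      ((constPath H).comp (W y₀)).contDiff.comp (contDiff_fst.sub contDiff_const)
    have h3 : ContDiff ℝ ∞ fun q => A (M q) := contDiff_applyL_comp hMs
    have h4 : ContDiff ℝ ∞ fun q => A (M q) (constPath V (P (q.1 - y₀))) := h3.clm_apply h1
    exact (contDiff_snd.sub h2).sub ((tail H).contDiff.comp h4)
  have hRd : ∀ q, ∃ R' : V × UPath H →L[ℝ] UPath H, HasFDerivAt R R' q ∧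
      ∀ v d, R' (v, d) = d - constPath H (W y₀ v) - tail H
        (A (applyL unitInterval V (V →L[ℝ] H) (DWm.comp (Γ q)) (Γ' (v, d)))
          (constPath V (P (q.1 - y₀))) + A (M q) (constPath V (P v))) := by
    intro q
    have h0 : HasFDerivAt (fun q => A (M q)) (A.comp (M' q)) q := hasFDerivAt_applyL_comp (hMd q)
    have h1 := (tail H).hasFDerivAt.comp q (h0.clm_apply (hκd q))
    refine ⟨_, (hasFDerivAt_snd.sub (hηd q)).sub h1, fun v d => ?_⟩
    change d - constPath H (W y₀ v) - tail H (A (M q) (constPath V (P v)) +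
      A (applyL unitInterval V (V →L[ℝ] H) (DWm.comp (Γ q)) (Γ' (v, d)))
        (constPath V (P (q.1 - y₀)))) = _
    rw [add_comm (A (M q) _)]
  -- the implicit function theorem
  set q₀ : V × UPath H := (y₀, 0)
  obtain ⟨R₀, hR₀, hR₀'⟩ := hRd q₀
  set Bl : V →L[ℝ] UPath H :=
    (constPath H).comp (W y₀) + (tail H).comp ((A (M q₀)).comp ((constPath V).comp P)) with hBl
  have hΦd : HasFDerivAt (fun q => (q.1, R q))
      ((ContinuousLinearMap.fst ℝ V (UPath H)).prod R₀) q₀ :=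
    hasFDerivAt_fst.prodMk hR₀
  -- At `(y₀, 0)` the vector `P (y - y₀)` is zero, so the derivative of `R` in the path variable is
  -- the identity. No smallness of the integral operator is needed.
  have hR₀B : ∀ v d, R₀ (v, d) = d - Bl v := by
    intro v d
    rw [hR₀']
    simp [q₀, hBl]
    abel
  let Le : (V × UPath H) ≃L[ℝ] V × UPath H :=
    ContinuousLinearEquiv.equivOfInverse
      ((ContinuousLinearMap.fst ℝ V (UPath H)).prod R₀)
      ((ContinuousLinearMap.fst ℝ V (UPath H)).prod
        (.snd ℝ _ _ + Bl.comp (.fst ℝ _ _)))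
      (fun q => by obtain ⟨v, d⟩ := q; simp [hR₀B]) (fun q => by obtain ⟨v, d⟩ := q; simp [hR₀B])
  obtain ⟨e, he₀, -, heΦ, hesymm, -⟩ := exists_localDiffeo (Φ := fun q => (q.1, R q)) (x₀ := q₀)
    isOpen_univ (mem_univ _) (contDiff_fst.prodMk hRs).contDiffOn (L := Le) hΦd.fderiv
  have hRq₀ : R q₀ = 0 := by simp [hR, q₀]
  set c : V → UPath H := fun y => (e.symm (y, 0)).2 with hc
  set N₁ : Set V := (fun y => (y, (0 : UPath H))) ⁻¹' e.target
  have hN₁ : IsOpen N₁ := e.open_target.preimage (by fun_prop)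
  have hy₀N₁ : y₀ ∈ N₁ := by
    have := e.map_source he₀
    rw [heΦ, hRq₀] at this
    exact this
  have hesy : ∀ y ∈ N₁, e.symm (y, 0) = (y, c y) ∧ R (y, c y) = 0 := by
    intro y hy
    have h := e.right_inv hy
    rw [heΦ] at h
    have h1 : (e.symm (y, 0)).1 = y := congrArg Prod.fst h
    have h2 : e.symm (y, 0) = (y, c y) := Prod.ext h1 rfl
    refine ⟨h2, ?_⟩
    rw [← h2]
    exact congrArg Prod.snd h
  have hcs : ContDiffOn ℝ ∞ c N₁ := by
    have : ContDiffOn ℝ ∞ (fun y => e.symm (y, 0)) N₁ :=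
      hesymm.comp (contDiff_id.prodMk contDiff_const).contDiffOn fun y hy => hy
    exact contDiff_snd.comp_contDiffOn this
  have hcy₀ : c y₀ = 0 := by
    have h := e.left_inv he₀
    rw [heΦ, hRq₀] at h
    simp only [hc]
    rw [show (y₀, (0 : UPath H)) = (q₀.1, 0) from rfl, h]
  have hGc : ContinuousOn (fun y => Γ (y, c y)) N₁ :=
    hΓs.continuous.comp_continuousOn (continuousOn_id.prodMk hcs.continuousOn)
  -- The whole path must stay in `N`, where normalisation and integrability are available; this is
  -- open by compactness of the interval.
  set N₂ : Set V := N₁ ∩ (fun y => Γ (y, c y)) ⁻¹' {γ | MapsTo γ univ N}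
  have hN₂ : IsOpen N₂ :=
    hGc.isOpen_inter_preimage hN₁ (ContinuousMap.isOpen_setOfPred_mapsTo isCompact_univ hN)
  refine ⟨N₂, fun y => c y 0, hN₂, ⟨hy₀N₁, ?_⟩, ?_, ?_⟩
  · intro s _
    rw [hΓap, hcy₀]
    simp [hy₀]
  · exact (ContinuousMap.evalCLM ℝ (0 : unitInterval)).contDiff.comp_contDiffOn
      (hcs.mono inter_subset_left)
  intro y hy v
  have hcd : HasFDerivAt c (fderiv ℝ c y) y :=
    ((hcs.contDiffAt (hN₁.mem_nhds hy.1)).differentiableAt (by simp)).hasFDerivAt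
  have hud : fderiv ℝ (fun y => c y 0) y v = fderiv ℝ c y v 0 := by
    have := ((ContinuousMap.evalCLM ℝ (0 : unitInterval) :
      UPath H →L[ℝ] H).hasFDerivAt.comp y hcd).fderiv
    exact congrArg (fun l => l v) this
  rw [hud]
  set δ := fderiv ℝ c y v with hδ
  obtain ⟨R', hR', hR'f⟩ := hRd (y, c y)
  have hδeq : R' (v, δ) = 0 := by
    have h1 : HasFDerivAt (fun z => R (z, c z)) (R'.comp ((ContinuousLinearMap.id ℝ V).prod
      (fderiv ℝ c y))) y := hR'.comp y ((hasFDerivAt_id y).prodMk hcd)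
    have h2 : HasFDerivAt (fun z => R (z, c z)) (0 : V →L[ℝ] UPath H) y := by
      refine (hasFDerivAt_const (0 : UPath H) y).congr_of_eventuallyEq ?_
      filter_upwards [hN₁.mem_nhds hy.1] with z hz
      exact (hesy z hz).2
    have := congrArg (fun l => l v) (h1.unique h2)
    simpa using this
  rw [hR'f] at hδeq
  have hceq := (hesy y hy.1).2
  set k := P (y - y₀) with hk
  set a₁ := A (M (y, c y)) (constPath V k) with ha₁
  set a₂ := A (applyL unitInterval V (V →L[ℝ] H) (DWm.comp (Γ (y, c y))) (Γ' (v, δ)))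
          (constPath V k) + A (M (y, c y)) (constPath V (P v)) with ha₂
  set cR : ℝ → H := fun s => W y₀ (y - y₀) + tailFun a₁ s with hcR
  set δR : ℝ → H := fun s => W y₀ v + tailFun a₂ s with hδR
  have hcs' : ∀ s : unitInterval, c y s = cR s := by
    intro s
    have := congrArg (fun f => f s) hceq
    simp only [hR, ContinuousMap.sub_apply,
      ContinuousMap.zero_apply, sub_sub, sub_eq_zero] at this
    exact this
  have hδs' : ∀ s : unitInterval, δ s = δR s := by
    intro s
    have := congrArg (fun f => f s) hδeq
    simp only [ContinuousMap.sub_apply,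
      ContinuousMap.zero_apply, sub_sub, sub_eq_zero] at this
    exact this
  -- The path and its variation `J` in the direction `v` are extended to real `s`, so that two-sided
  -- derivatives make sense at 0 and 1.
  set γ : ℝ → V := fun s => y₀ + s • k + S (cR s) with hγ
  set J : ℝ → V := fun s => s • P v + S (δR s) with hJ
  have hγN : ∀ s ∈ Icc (0 : ℝ) 1, γ s ∈ N := by
    intro s hs
    have := hy.2 (mem_univ (⟨s, hs⟩ : unitInterval))
    rw [hΓap, hcs'] at this
    exact this
  have hext₁ : ∀ s ∈ Icc (0 : ℝ) 1, IccExtend zero_le_one a₁ s = W (γ s) k := by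
    intro s hs
    rw [IccExtend_of_mem _ _ hs]
    change W (Γ (y, c y) ⟨s, hs⟩) k = _
    rw [hΓap, hcs']
  have hext₂ : ∀ s ∈ Icc (0 : ℝ) 1,
      IccExtend zero_le_one a₂ s = DW (γ s) (J s) k + W (γ s) (P v) := by
    intro s hs
    rw [IccExtend_of_mem _ _ hs]
    change DW (Γ (y, c y) ⟨s, hs⟩) (Γ' (v, δ) ⟨s, hs⟩) k + W (Γ (y, c y) ⟨s, hs⟩) (P v) = _
    rw [hΓap, hΓ'ap, hcs', hδs']
  have hγd : ∀ s ∈ Icc (0 : ℝ) 1, HasDerivAt γ (k - S (W (γ s) k)) s := by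
    intro s hs
    have h1 := (hasDerivAt_tailFun a₁ s).const_add (W y₀ (y - y₀))
    rw [hext₁ s hs] at h1
    have h2 := S.hasFDerivAt.comp_hasDerivAt s h1
    have h3 : HasDerivAt γ ((1 : ℝ) • k + S (-(W (γ s) k))) s :=
      (((hasDerivAt_id s).smul_const k).const_add y₀).add h2
    rwa [one_smul, map_neg, ← sub_eq_add_neg] at h3
  have hJd : ∀ s ∈ Icc (0 : ℝ) 1,
      HasDerivAt J (P v - S (DW (γ s) (J s) k + W (γ s) (P v))) s := by
    intro s hs
    have h1 := (hasDerivAt_tailFun a₂ s).const_add (W y₀ v)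
    rw [hext₂ s hs] at h1
    have h2 := S.hasFDerivAt.comp_hasDerivAt s h1
    have h3 : HasDerivAt J ((1 : ℝ) • P v + S (-(DW (γ s) (J s) k + W (γ s) (P v)))) s :=
      ((hasDerivAt_id s).smul_const (P v)).add h2
    rwa [one_smul, map_neg, ← sub_eq_add_neg] at h3
  have hDS : ∀ z ∈ N, ∀ a h, DW z a (S h) = 0 := by
    intro z hz a h
    have h1 : HasFDerivAt (fun z => W z (S h)) ((DW z).flip (S h)) z := by
      simpa using (hW' z).clm_apply (hasFDerivAt_const (S h) z)
    have h2 : HasFDerivAt (fun z => W z (S h)) (0 : V →L[ℝ] H) z :=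
      (hasFDerivAt_const h z).congr_of_eventuallyEq (by
        filter_upwards [hN.mem_nhds hz] with z' hz'
        exact hWS z' hz' h)
    have := congrArg (fun l => l a) (h1.unique h2)
    simpa using this
  -- `j` measures how far `J` is from lying in the distribution. Integrability, together with the
  -- constancy of `W z ∘ S`, gives j' = -DW(S j)(γ'), which is linear in `j`. As j(0) = du(v) and
  -- j(1) = W(y)v, one vanishes exactly when the other does.
  set j : ℝ → H := fun s => W (γ s) (J s) with hj
  have hjd : ∀ s ∈ Icc (0 : ℝ) 1,
      HasDerivAt j (-(DW (γ s) (S (j s)) (k - S (W (γ s) k)))) s := by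
    intro s hs
    have h1 := ((hW' (γ s)).comp_hasDerivAt s (hγd s hs)).clm_apply (hJd s hs)
    convert! h1 using 1
    have hz := hγN s hs
    set z := γ s
    set g := k - S (W z k) with hg
    have hWg : W z g = 0 := by simp [hg, hWS z hz]
    have hWJ : W z (J s - S (j s)) = 0 := by simp [hWS z hz, hj, z]
    have key := hint z hz g (J s - S (j s)) hWg hWJ
    have e1 : DW z g (J s) = DW z (J s) g - DW z (S (j s)) g := by
      simpa [hDS z hz] using key
    have e2 : DW z (J s) k = DW z (J s) g := by simp [hg, hDS z hz]
    change _ = DW z g (J s) + W z (P v - S (DW z (J s) k + W z (P v)))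
    rw [map_sub (W z), hWS z hz, e1, e2]
    abel
  have hγc : ContinuousOn γ (Icc 0 1) := fun s hs => (hγd s hs).continuousAt.continuousWithinAt
  obtain ⟨C, hC⟩ := (isCompact_Icc (a := (0 : ℝ)) (b := 1)).exists_bound_of_continuousOn
    (f := fun s => ‖DW (γ s)‖ * ‖S‖ * ‖k - S (W (γ s) k)‖) (by
      have h0 : Continuous fun z => ‖DW z‖ := continuous_norm_comp hDWc.continuous
      have h1 := h0.comp_continuousOn hγc
      have h2 := hW.continuous.comp_continuousOn hγc
      have h3 : ContinuousOn (fun s => S (W (γ s) k)) (Icc 0 1) :=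
        S.continuous.comp_continuousOn (h2.clm_apply continuousOn_const)
      exact (h1.mul continuousOn_const).mul (continuousOn_const.sub h3).norm)
  have hj0 : j 0 = δ 0 := by
    have hz := hγN 0 (by simp)
    have : δ 0 = δR 0 := hδs' 0
    rw [this]
    simp only [hj, hJ, zero_smul, zero_add]
    exact hWS _ hz _
  have hj1 : j 1 = W y v := by
    have h1 : γ 1 = y := by simp [hγ, hcR, tailFun_one, hk, hP]; abel
    have h2 : J 1 = v := by simp [hJ, hδR, tailFun_one, hP]
    simp only [hj, h1, h2]
  rw [← hj0, ← hj1]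
  refine eq_zero_of_norm_deriv_le (C := C) hjd fun s hs => ?_
  rw [norm_neg]
  refine ((DW (γ s) (S (j s))).le_opNorm _).trans ?_
  refine (mul_le_mul_of_nonneg_right (((DW (γ s)).le_opNorm _).trans
    (mul_le_mul_of_nonneg_left (S.le_opNorm _) (norm_nonneg _))) (norm_nonneg _)).trans ?_
  have := (le_abs_self _).trans (hC s hs)
  calc _ = (‖DW (γ s)‖ * ‖S‖ * ‖k - S (W (γ s) k)‖) * ‖j s‖ := by ring
    _ ≤ _ := mul_le_mul_of_nonneg_right this (norm_nonneg _)

end Backlund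

/-! ### Frobenius' theorem, densities in the plane, descent along submersions -/

namespace Backlund

open Set Filter

universe u

/-- **Frobenius' theorem**: first integrals of a completely integrable Pfaffian system. -/
theorem frobenius {V H : Type u} [NormedAddCommGroup V] [NormedSpace ℝ V]
    [FiniteDimensional ℝ V] [NormedAddCommGroup H] [NormedSpace ℝ H] [FiniteDimensional ℝ H]
    {η : V → V →L[ℝ] H} {y₀ : V} {N : Set V} (hN : IsOpen N) (hy₀ : y₀ ∈ N)
    (hη : ContDiffOn ℝ ∞ η N) (hsurj : Function.Surjective (η y₀))
    (hint : ∀ y ∈ N, ∀ v w, η y v = 0 → η y w = 0 → fderiv ℝ η y v w = fderiv ℝ η y w v) :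
    ∃ (N' : Set V) (u : V → H), IsOpen N' ∧ y₀ ∈ N' ∧ N' ⊆ N ∧ ContDiffOn ℝ ∞ u N' ∧
      ∀ y ∈ N', ∀ v, fderiv ℝ u y v = 0 ↔ η y v = 0 := by
  have : CompleteSpace V := FiniteDimensional.complete ℝ V
  have : CompleteSpace H := FiniteDimensional.complete ℝ H
  obtain ⟨S₀, hS₀⟩ := (η y₀).toLinearMap.exists_rightInverse_of_surjective
    (LinearMap.range_eq_top.2 hsurj)
  set S : H →L[ℝ] V := LinearMap.toContinuousLinearMap S₀ with hS
  have hS' : (η y₀).comp S = ContinuousLinearMap.id ℝ H := by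
    ext h; exact LinearMap.congr_fun hS₀ h
  set A : V → H →L[ℝ] H := fun y => (η y).comp S with hA
  have hAs : ContDiffOn ℝ ∞ A N := hη.clm_comp contDiffOn_const
  set N₁ : Set V := N ∩ A ⁻¹' range ((↑) : (H ≃L[ℝ] H) → H →L[ℝ] H) with hN₁
  have hN₁o : IsOpen N₁ := hAs.continuousOn.isOpen_inter_preimage hN ContinuousLinearEquiv.isOpen
  have hy₀N₁ : y₀ ∈ N₁ := ⟨hy₀, ContinuousLinearEquiv.refl ℝ H, by simp only [hA, hS']; rfl⟩
  -- Dividing by the invertible operator η ∘ S keeps the kernels and normalises the family.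
  -- Integrability survives because the derivative of the factor is multiplied by a value of the
  -- form that is zero. A cut-off then makes the family smooth everywhere.
  set W₀ : V → V →L[ℝ] H := fun y => (A y).inverse.comp (η y) with hW₀
  have hW₀s : ContDiffOn ℝ ∞ W₀ N₁ := by
    intro y hy
    obtain ⟨L, hL⟩ := hy.2
    have h1 : ContDiffAt ℝ ∞ ContinuousLinearMap.inverse (A y) := hL ▸ contDiffAt_map_inverse L
    have h2 : ContDiffWithinAt ℝ ∞ (fun y => (A y).inverse) N₁ y :=
      h1.comp_contDiffWithinAt y ((hAs y hy.1).mono inter_subset_left)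
    exact h2.clm_comp ((hη y hy.1).mono inter_subset_left)
  obtain ⟨W, hW, hWW₀⟩ := exists_contDiff_eventuallyEq hN₁o hy₀N₁ hW₀s
  obtain ⟨N₂, hN₂sub, hN₂o, hy₀N₂⟩ := mem_nhds_iff.1 (hWW₀.and (hN₁o.mem_nhds hy₀N₁))
  have hAinv : ∀ y ∈ N₁, ∀ h, A y ((A y).inverse h) = h ∧ (A y).inverse (A y h) = h := by
    intro y hy h
    obtain ⟨L, hL⟩ := hy.2
    simp [← hL]
  have hAW : ∀ y ∈ N₂, η y = (A y).comp (W y) := by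
    intro y hy
    rw [(hN₂sub hy).1]
    ext v
    exact ((hAinv y (hN₂sub hy).2 (η y v)).1).symm
  have hker : ∀ y ∈ N₂, ∀ v, W y v = 0 ↔ η y v = 0 := by
    intro y hy v
    constructor
    · intro h
      rw [hAW y hy, ContinuousLinearMap.comp_apply, h, map_zero]
    · intro h
      rw [(hN₂sub hy).1]
      simp [hW₀, h]
  have hWS : ∀ y ∈ N₂, ∀ h, W y (S h) = h := by
    intro y hy h
    rw [(hN₂sub hy).1]
    exact (hAinv y (hN₂sub hy).2 h).2
  have hWint : ∀ y ∈ N₂, ∀ v w, W y v = 0 → W y w = 0 →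
      fderiv ℝ W y v w = fderiv ℝ W y w v := by
    intro y hy v w hv hw
    have hyN := (hN₂sub hy).2.1
    have hAd : HasFDerivAt A (fderiv ℝ A y) y :=
      ((hAs.contDiffAt (hN.mem_nhds hyN)).differentiableAt (by simp)).hasFDerivAt
    have hWd : HasFDerivAt W (fderiv ℝ W y) y := (hW.differentiable (by simp) y).hasFDerivAt
    have hηd : HasFDerivAt η (fderiv ℝ η y) y :=
      ((hη.contDiffAt (hN.mem_nhds hyN)).differentiableAt (by simp)).hasFDerivAt
    have key : ∀ v w, W y w = 0 → fderiv ℝ η y v w = A y (fderiv ℝ W y v w) := by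
      intro v w hw
      have h1 : HasFDerivAt (fun z => η z w) ((fderiv ℝ η y).flip w) y := by
        simpa using hηd.clm_apply (hasFDerivAt_const w y)
      have h2 : HasFDerivAt (fun z => W z w) ((fderiv ℝ W y).flip w) y := by
        simpa using hWd.clm_apply (hasFDerivAt_const w y)
      have h3 := (hAd.clm_apply h2).congr_of_eventuallyEq (f₁ := fun z => η z w) (by
        filter_upwards [hN₂o.mem_nhds hy] with z hz
        rw [hAW z hz]; rfl)
      have := congrArg (fun l => l v) (h1.unique h3)
      simpa [hw] using this
    have h := hint y hyN v w ((hker y hy v).1 hv) ((hker y hy w).1 hw)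
    rw [key v w hw, key w v hv] at h
    have := congrArg (A y).inverse h
    rwa [(hAinv y (hN₂sub hy).2 _).2, (hAinv y (hN₂sub hy).2 _).2] at this
  obtain ⟨N', u, hN', hy₀N', hu, huk⟩ := frobenius_normalized (S := S) hW hN₂o hy₀N₂ hWS hWint
  refine ⟨N' ∩ N₂, u, hN'.inter hN₂o, ⟨hy₀N', hy₀N₂⟩, fun y hy => (hN₂sub hy.2).2.1,
    hu.mono inter_subset_left, fun y hy v => ?_⟩
  rw [huk y hy.1, hker y hy.2]

/-- The standard area form of the plane. -/
def area (a b : ℝ × ℝ) : ℝ := a.1 * b.2 - a.2 * b.1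

/-- A nonvanishing density in the plane is locally the Jacobian of a map. -/
theorem exists_area_eq {μ : ℝ × ℝ → ℝ} {a₀ : ℝ × ℝ} {N : Set (ℝ × ℝ)} (hN : IsOpen N)
    (ha₀ : a₀ ∈ N) (hμ : ContDiffOn ℝ ∞ μ N) :
    ∃ (F : ℝ × ℝ → ℝ × ℝ) (N' : Set (ℝ × ℝ)), ContDiff ℝ ∞ F ∧ IsOpen N' ∧ a₀ ∈ N' ∧ N' ⊆ N ∧
      ∀ v ∈ N', ∀ a b, area (fderiv ℝ F v a) (fderiv ℝ F v b) = μ v * area a b := by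
  obtain ⟨m, hm, hmμ⟩ := exists_contDiff_eventuallyEq hN ha₀ hμ
  obtain ⟨N', hN'sub, hN'o, ha₀N'⟩ := mem_nhds_iff.1 (hmμ.and (hN.mem_nhds ha₀))
  -- The map is F(x, y) = (∫ μ(t, y) dt, y), the integral running from `a₀.1` to x. Writing the
  -- integral over the unit interval through the operators on paths gives joint smoothness without
  -- differentiating under the integral sign.
  set Γ : ℝ × ℝ → UPath (ℝ × ℝ) := fun v =>
    constPath (ℝ × ℝ) (a₀.1, v.2) + rampPath (ℝ × ℝ) (v.1 - a₀.1, 0) with hΓ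
  have hΓs : ContDiff ℝ ∞ Γ :=
    ((constPath (ℝ × ℝ)).contDiff.comp (contDiff_const.prodMk contDiff_snd)).add
      ((rampPath (ℝ × ℝ)).contDiff.comp ((contDiff_fst.sub contDiff_const).prodMk contDiff_const))
  set T : ℝ × ℝ → UPath ℝ := fun v => tail ℝ ((⟨m, hm.continuous⟩ : C(ℝ × ℝ, ℝ)).comp (Γ v))
  have hTs : ContDiff ℝ ∞ T := (tail ℝ).contDiff.comp ((contDiff_comp hm).comp hΓs)
  set X : ℝ × ℝ → ℝ := fun v => (v.1 - a₀.1) * T v 0 with hX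
  have hT0 : ContDiff ℝ ∞ fun v => T v 0 :=
    (ContinuousMap.evalCLM ℝ (0 : unitInterval) : UPath ℝ →L[ℝ] ℝ).contDiff.comp hTs
  have hXs : ContDiff ℝ ∞ X := (contDiff_fst.sub contDiff_const).mul hT0
  have hXint : ∀ v, X v = ∫ t in a₀.1..v.1, m (t, v.2) := by
    intro v
    have h1 : T v 0 = ∫ t in (0 : ℝ)..1, m (a₀.1 + (v.1 - a₀.1) * t, v.2) := by
      change tailFun _ 0 = _
      rw [tailFun, ← intervalIntegral.integral_symm]
      refine intervalIntegral.integral_congr fun t ht => ?_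
      rw [uIcc_of_le zero_le_one] at ht
      rw [IccExtend_of_mem _ _ ht]
      change m ((a₀.1, v.2) + t • (v.1 - a₀.1, (0 : ℝ))) = _
      simp [mul_comm]
    rw [hX]
    simp only
    rw [h1, intervalIntegral.mul_integral_comp_add_mul (f := fun t => m (t, v.2))]
    simp
  set F : ℝ × ℝ → ℝ × ℝ := fun v => (X v, v.2) with hF
  have hFs : ContDiff ℝ ∞ F := hXs.prodMk contDiff_snd
  refine ⟨F, N', hFs, hN'o, ha₀N', fun v hv => (hN'sub hv).2, fun v hv a b => ?_⟩
  have hXd : HasFDerivAt X (fderiv ℝ X v) v := (hXs.differentiable (by simp) v).hasFDerivAt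
  have hFd : fderiv ℝ F v = (fderiv ℝ X v).prod (.snd ℝ ℝ ℝ) := (hXd.prodMk hasFDerivAt_snd).fderiv
  have hXx : fderiv ℝ X v (1, 0) = μ v := by
    have h1 : HasDerivAt (fun t : ℝ => X (t, v.2)) (fderiv ℝ X v (1, 0)) v.1 := by
      have hγ : HasDerivAt (fun t : ℝ => (t, v.2)) ((1 : ℝ), (0 : ℝ)) v.1 :=
        (hasDerivAt_id v.1).prodMk (hasDerivAt_const v.1 v.2)
      exact HasFDerivAt.comp_hasDerivAt v.1 (f := fun t : ℝ => (t, v.2)) hXd hγ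
    have hmc : Continuous fun t : ℝ => m (t, v.2) := hm.continuous.comp (by fun_prop)
    have h2 : HasDerivAt (fun t : ℝ => X (t, v.2)) (m v) v.1 := by
      have := intervalIntegral.integral_hasDerivAt_right (a := a₀.1) (b := v.1)
        (hmc.intervalIntegrable _ _)
        (hmc.stronglyMeasurableAtFilter _ _) hmc.continuousAt
      simpa only [hXint] using this
    rw [h1.unique h2]
    exact (hN'sub hv).1
  have hXa : ∀ a : ℝ × ℝ, fderiv ℝ X v a = a.1 * μ v + a.2 * fderiv ℝ X v (0, 1) := by
    intro a
    have : a = a.1 • ((1 : ℝ), (0 : ℝ)) + a.2 • ((0 : ℝ), (1 : ℝ)) := by ext <;> simp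
    conv_lhs => rw [this, map_add, map_smul, map_smul, hXx]
    simp
  simp only [area, hFd, ContinuousLinearMap.prod_apply, ContinuousLinearMap.coe_snd', hXa a, hXa b]
  ring

theorem exists_equiv_of_bijective {V W : Type*} [NormedAddCommGroup V] [NormedSpace ℝ V]
    [CompleteSpace V] [NormedAddCommGroup W] [NormedSpace ℝ W] [CompleteSpace W] {L : V →L[ℝ] W}
    (hL : Function.Bijective L) : ∃ L' : V ≃L[ℝ] W, (L' : V →L[ℝ] W) = L :=
  ⟨ContinuousLinearEquiv.ofBijective L (LinearMap.ker_eq_bot.2 hL.1)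
    (LinearMap.range_eq_top.2 hL.2), by ext; rfl⟩

/-- A function which is constant in the directions of the fibres of a submersion descends. -/
theorem exists_descent {V W H : Type*} [NormedAddCommGroup V] [NormedSpace ℝ V]
    [FiniteDimensional ℝ V] [NormedAddCommGroup W] [NormedSpace ℝ W] [FiniteDimensional ℝ W]
    [NormedAddCommGroup H] [NormedSpace ℝ H] {p : V → W} {u : V → H} {N : Set V} {y₀ : V}
    (hN : IsOpen N) (hy₀ : y₀ ∈ N) (hp : ContDiffOn ℝ ∞ p N) (hu : ContDiffOn ℝ ∞ u N)
    (hsurj : Function.Surjective (fderiv ℝ p y₀))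
    (hker : ∀ y ∈ N, ∀ v, fderiv ℝ p y v = 0 → fderiv ℝ u y v = 0) :
    ∃ (N' : Set V) (U : Set W) (u₁ : W → H), IsOpen N' ∧ y₀ ∈ N' ∧ N' ⊆ N ∧ IsOpen U ∧
      MapsTo p N' U ∧ ContDiffOn ℝ ∞ u₁ U ∧ ∀ y ∈ N', u y = u₁ (p y) := by
  have : CompleteSpace V := FiniteDimensional.complete ℝ V
  have : CompleteSpace W := FiniteDimensional.complete ℝ W
  set K : Submodule ℝ V := LinearMap.ker (fderiv ℝ p y₀).toLinearMap with hK
  obtain ⟨ℓ, hℓ⟩ := Submodule.ClosedComplemented.of_finiteDimensional (𝕜 := ℝ) K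
  -- With `ℓ` a projection onto the kernel at `y₀`, the map `(p, ℓ)` straightens the fibres. In a
  -- box each fibre becomes a ball, which is connected, so `u` is constant on it; the slice `ℓ = ℓ
  -- y₀` serves as a section.
  set G : V → W × K := fun y => (p y, ℓ y) with hG
  have hpd : ∀ y ∈ N, HasFDerivAt p (fderiv ℝ p y) y := fun y hy =>
    ((hp.contDiffAt (hN.mem_nhds hy)).differentiableAt (by simp)).hasFDerivAt
  have hud : ∀ y ∈ N, HasFDerivAt u (fderiv ℝ u y) y := fun y hy =>
    ((hu.contDiffAt (hN.mem_nhds hy)).differentiableAt (by simp)).hasFDerivAt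
  have hGd : HasFDerivAt G ((fderiv ℝ p y₀).prod ℓ) y₀ := (hpd y₀ hy₀).prodMk ℓ.hasFDerivAt
  obtain ⟨L, hL⟩ := exists_equiv_of_bijective (L := (fderiv ℝ p y₀).prod ℓ) (by
    constructor
    · rw [injective_iff_map_eq_zero]
      intro v hv
      have h1 : fderiv ℝ p y₀ v = 0 := congrArg Prod.fst hv
      have h2 : ℓ v = 0 := congrArg Prod.snd hv
      have h3 := hℓ ⟨v, h1⟩
      rw [h2] at h3
      exact (congrArg Subtype.val h3).symm
    · rintro ⟨w, k⟩
      obtain ⟨v, rfl⟩ := hsurj w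
      have hk : ∀ k : K, fderiv ℝ p y₀ k = 0 := fun k => k.2
      refine ⟨v - ℓ v + k, ?_⟩
      simp [hk, hℓ])
  obtain ⟨e, he₀, heN, heG, hes, -⟩ := exists_localDiffeo (Φ := G) hN hy₀
    (hp.prodMk (ℓ.contDiff.contDiffOn)) (L := L) (hGd.fderiv.trans hL.symm)
  obtain ⟨r, hr, hball⟩ := Metric.isOpen_iff.1 e.open_target _ (e.map_source he₀)
  have hbox : ∀ m ∈ Metric.ball (p y₀) r, ∀ k ∈ Metric.ball (ℓ y₀) r, (m, k) ∈ e.target := by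
    intro m hm k hk
    refine hball ?_
    rw [heG, Metric.mem_ball, Prod.dist_eq]
    exact max_lt hm hk
  refine ⟨e.source ∩ e ⁻¹' Metric.ball (e y₀) r, Metric.ball (p y₀) r,
    fun m => u (e.symm (m, ℓ y₀)), e.isOpen_inter_preimage Metric.isOpen_ball,
    ⟨he₀, Metric.mem_ball_self hr⟩, fun y hy => heN hy.1, Metric.isOpen_ball, ?_, ?_, ?_⟩
  · rintro y ⟨-, hy⟩
    rw [mem_preimage, heG, heG, Metric.mem_ball, Prod.dist_eq] at hy
    exact (le_max_left _ _).trans_lt hy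
  · refine hu.comp (hes.comp (contDiff_id.prodMk contDiff_const).contDiffOn ?_) ?_
    · exact fun m hm => hbox m hm _ (Metric.mem_ball_self hr)
    · exact fun m hm => heN (e.map_target (hbox m hm _ (Metric.mem_ball_self hr)))
  · rintro y ⟨hys, hy⟩
    rw [mem_preimage, heG, heG, Metric.mem_ball, Prod.dist_eq, max_lt_iff] at hy
    have key := Metric.isOpen_ball.is_const_of_fderiv_eq_zero (𝕜 := ℝ)
      (f := fun k : K => u (e.symm (p y, k))) (s := Metric.ball (ℓ y₀) r)
      (convex_ball _ _).isPreconnected ?_ ?_ hy.2 (Metric.mem_ball_self hr)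
    · have h := e.left_inv hys
      rw [heG] at h
      have h' : e.symm (p y, ℓ y) = y := h
      change u (e.symm (p y, ℓ y)) = _ at key
      rwa [h'] at key
    all_goals
      have hd : ∀ k ∈ Metric.ball (ℓ y₀) r,
          HasFDerivAt (fun k : K => u (e.symm (p y, k))) (0 : K →L[ℝ] H) k := by
        intro k hk
        have ht := hbox (p y) hy.1 k hk
        have hsN := heN (e.map_target ht)
        have h1 : HasFDerivAt (fun k : K => e.symm (p y, k)) _ k :=
          (((hes.contDiffAt (e.open_target.mem_nhds ht)).differentiableAt
            (by simp)).hasFDerivAt).comp k (hasFDerivAt_prodMk_right (p y) k)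
        have h2 := (hpd _ hsN).comp k h1
        have h3 : HasFDerivAt (fun k : K => p (e.symm (p y, k))) (0 : K →L[ℝ] W) k := by
          refine (hasFDerivAt_const (p y) k).congr_of_eventuallyEq ?_
          filter_upwards [Metric.isOpen_ball.mem_nhds hk] with k' hk'
          have := e.right_inv (hbox (p y) hy.1 k' hk')
          rw [heG] at this
          exact congrArg Prod.fst this
        have h4 := h2.unique h3
        have h5 := (hud _ hsN).comp k h1
        refine h5.congr_fderiv ?_
        ext v
        refine hker _ hsN _ ?_
        exact congrArg (fun l => l v) h4
    · exact fun k hk => (hd k hk).differentiableAt.differentiableWithinAt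
    · exact fun k hk => (hd k hk).fderiv

end Backlund

/-! ### One-forms, pullbacks and brackets on normed spaces -/

namespace Backlund

open Set Filter VectorField

theorem minSmoothness_le_infty : minSmoothness ℝ 2 ≤ (∞ : WithTop ℕ∞) := by
  rw [minSmoothness_of_isRCLikeNormedField]
  exact WithTop.coe_le_coe.2 (le_top : (2 : ℕ∞) ≤ ⊤)

section OneForms

variable {V W : Type*} [NormedAddCommGroup V] [NormedSpace ℝ V]
  [NormedAddCommGroup W] [NormedSpace ℝ W]

/-- The exterior derivative of a 1-form on a normed space. -/
noncomputable def ed (α : V → V →L[ℝ] ℝ) (x : V) : V →L[ℝ] V →L[ℝ] ℝ :=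
  fderiv ℝ α x - (fderiv ℝ α x).flip

theorem ed_apply (α : V → V →L[ℝ] ℝ) (x v w : V) :
    ed α x v w = fderiv ℝ α x v w - fderiv ℝ α x w v := rfl

theorem ed_swap (α : V → V →L[ℝ] ℝ) (x v w : V) : ed α x v w = -ed α x w v := by
  simp [ed_apply]

theorem ed_self (α : V → V →L[ℝ] ℝ) (x v : V) : ed α x v v = 0 := by simp [ed_apply]

/-- The pullback of a 1-form on a normed space. -/
noncomputable def pb (p : V → W) (θ : W → W →L[ℝ] ℝ) (y : V) : V →L[ℝ] ℝ :=
  (θ (p y)).comp (fderiv ℝ p y)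

theorem pb_apply (p : V → W) (θ : W → W →L[ℝ] ℝ) (y v : V) :
    pb p θ y v = θ (p y) (fderiv ℝ p y v) := rfl

theorem contDiffOn_pb {p : V → W} {θ : W → W →L[ℝ] ℝ} {N : Set V} {U : Set W} (hN : IsOpen N)
    (hp : ContDiffOn ℝ ∞ p N) (hθ : ContDiffOn ℝ ∞ θ U) (h : MapsTo p N U) :
    ContDiffOn ℝ ∞ (pb p θ) N :=
  (hθ.comp hp h).clm_comp (hp.fderiv_of_isOpen hN (by simp))

/-- The terms with the second derivative of `p` are symmetric and cancel on antisymmetrisation. -/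
theorem ed_pb {p : V → W} {θ : W → W →L[ℝ] ℝ} {y : V} (hp : ContDiffAt ℝ ∞ p y)
    (hθ : DifferentiableAt ℝ θ (p y)) (v w : V) :
    ed (pb p θ) y v w = ed θ (p y) (fderiv ℝ p y v) (fderiv ℝ p y w) := by
  have h1 : HasFDerivAt (fun y => θ (p y)) _ y :=
    hθ.hasFDerivAt.comp y (hp.differentiableAt (by simp)).hasFDerivAt
  have h2 : HasFDerivAt (fderiv ℝ p) (fderiv ℝ (fderiv ℝ p) y) y :=
    ((hp.fderiv_right (m := ∞) (by simp)).differentiableAt (by simp)).hasFDerivAt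
  have h3 : fderiv ℝ (pb p θ) y = _ := (h1.clm_comp h2).fderiv
  have hs : IsSymmSndFDerivAt ℝ p y := hp.isSymmSndFDerivAt minSmoothness_le_infty
  rw [ed_apply, ed_apply, h3]
  simp [hs.eq v w]

theorem ed_congr {α α' : V → V →L[ℝ] ℝ} {x : V} (h : α =ᶠ[𝓝 x] α') : ed α x = ed α' x := by
  simp only [ed, h.fderiv_eq]

/-- Cartan's formula for the exterior derivative on two fields with constant pairings. -/
theorem ed_eq_neg_lieBracket {α : V → V →L[ℝ] ℝ} {X Y : V → V} {x : V} {c d : ℝ}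
    (hα : DifferentiableAt ℝ α x) (hX : DifferentiableAt ℝ X x) (hY : DifferentiableAt ℝ Y x)
    (hαX : ∀ᶠ z in 𝓝 x, α z (X z) = c) (hαY : ∀ᶠ z in 𝓝 x, α z (Y z) = d) :
    ed α x (X x) (Y x) = -α x (lieBracket ℝ X Y x) := by
  -- Differentiating the constant pairing trades the derivative of `α` for that of the field.
  have key : ∀ {Z : V → V} {c : ℝ}, DifferentiableAt ℝ Z x → (∀ᶠ z in 𝓝 x, α z (Z z) = c) →
      ∀ v, fderiv ℝ α x v (Z x) + α x (fderiv ℝ Z x v) = 0 := by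
    intro Z c hZ hc v
    have h1 := hα.hasFDerivAt.clm_apply hZ.hasFDerivAt
    have h2 : HasFDerivAt (fun z => α z (Z z)) (0 : V →L[ℝ] ℝ) x :=
      (hasFDerivAt_const c x).congr_of_eventuallyEq hc
    have := congrArg (fun l => l v) (h1.unique h2)
    simpa [add_comm] using this
  have h1 := key hX hαX (Y x)
  have h2 := key hY hαY (X x)
  rw [ed_apply, lieBracket, map_sub]
  linarith

/-- The Lie derivative of a pulled back 2-form in a vertical direction vanishes. -/
theorem pullback_lieBracket_eq_zero {p : V → W} {Φ : W → W →L[ℝ] W →L[ℝ] ℝ} {ξ X Y : V → V}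
    {y : V} (hp : ContDiffAt ℝ ∞ p y) (hΦ : DifferentiableAt ℝ Φ (p y))
    (hξ : DifferentiableAt ℝ ξ y) (hX : DifferentiableAt ℝ X y) (hY : DifferentiableAt ℝ Y y)
    (hpξ : ∀ᶠ z in 𝓝 y, fderiv ℝ p z (ξ z) = 0)
    (h : ∀ᶠ z in 𝓝 y, Φ (p z) (fderiv ℝ p z (X z)) (fderiv ℝ p z (Y z)) = 0) :
    Φ (p y) (fderiv ℝ p y (lieBracket ℝ ξ X y)) (fderiv ℝ p y (Y y)) +
      Φ (p y) (fderiv ℝ p y (X y)) (fderiv ℝ p y (lieBracket ℝ ξ Y y)) = 0 := by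
  have hpd := (hp.differentiableAt (by simp)).hasFDerivAt
  have h2 : HasFDerivAt (fderiv ℝ p) (fderiv ℝ (fderiv ℝ p) y) y :=
    ((hp.fderiv_right (m := ∞) (by simp)).differentiableAt (by simp)).hasFDerivAt
  have hs : IsSymmSndFDerivAt ℝ p y := hp.isSymmSndFDerivAt minSmoothness_le_infty
  have hξ0 := hpξ.self_of_nhds
  have hξ' : ∀ v, fderiv ℝ (fderiv ℝ p) y v (ξ y) + fderiv ℝ p y (fderiv ℝ ξ y v) = 0 := by
    intro v
    have h3 := h2.clm_apply hξ.hasFDerivAt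
    have h4 : HasFDerivAt (fun z => fderiv ℝ p z (ξ z)) (0 : V →L[ℝ] W) y :=
      (hasFDerivAt_const 0 y).congr_of_eventuallyEq hpξ
    have := congrArg (fun l => l v) (h3.unique h4)
    simpa [add_comm] using this
  -- Because `Dp ξ` vanishes identically and `D²p` is symmetric, the derivative of `Dp Z` along `ξ`
  -- is `Dp [ξ, Z]`. The base point `p z` does not move along `ξ` to first order, so `Φ` itself
  -- contributes nothing.
  have hpush : ∀ {Z : V → V}, DifferentiableAt ℝ Z y →
      ∃ l : V →L[ℝ] W, HasFDerivAt (fun z => fderiv ℝ p z (Z z)) l y ∧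
        l (ξ y) = fderiv ℝ p y (lieBracket ℝ ξ Z y) := by
    intro Z hZ
    refine ⟨_, h2.clm_apply hZ.hasFDerivAt, ?_⟩
    have := hξ' (Z y)
    rw [hs.eq] at this
    simp only [lieBracket, map_sub, add_apply,
      ContinuousLinearMap.comp_apply, ContinuousLinearMap.flip_apply]
    rw [eq_neg_of_add_eq_zero_left this]
    abel
  obtain ⟨lX, hlX, eX⟩ := hpush hX
  obtain ⟨lY, hlY, eY⟩ := hpush hY
  have h4 : HasFDerivAt (fun z => Φ (p z)) ((fderiv ℝ Φ (p y)).comp (fderiv ℝ p y)) y :=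
    HasFDerivAt.comp (G := W →L[ℝ] W →L[ℝ] ℝ) y hΦ.hasFDerivAt hpd
  have h5 := (h4.clm_apply hlX).clm_apply hlY
  have h6 := h5.unique ((hasFDerivAt_const 0 y).congr_of_eventuallyEq h)
  have := congrArg (fun l => l (ξ y)) h6
  simpa [eX, eY, hξ0, add_comm] using this

/-- The dual frame of a smooth coframe is smooth. -/
theorem exists_dualFrame {n : ℕ} [FiniteDimensional ℝ V] (hn : Module.finrank ℝ V = n)
    {α : Fin n → V → V →L[ℝ] ℝ} {N : Set V} (hα : ∀ i, ContDiffOn ℝ ∞ (α i) N)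
    (hinj : ∀ y ∈ N, ∀ v, (∀ i, α i y v = 0) → v = 0) :
    ∃ e : Fin n → V → V, (∀ j, ContDiffOn ℝ ∞ (e j) N) ∧
      ∀ y ∈ N, ∀ i j, α i y (e j y) = if i = j then 1 else 0 := by
  have : CompleteSpace V := FiniteDimensional.complete ℝ V
  set A : V → V →L[ℝ] (Fin n → ℝ) := fun y => ContinuousLinearMap.pi fun i => α i y with hA
  have hAs : ContDiffOn ℝ ∞ A N := by
    have h : A = fun y => ∑ i, (ContinuousLinearMap.single ℝ (fun _ : Fin n => ℝ) i).comp
        (α i y) := by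
      funext y
      ext v j
      simp [hA, Finset.sum_apply, Pi.single_apply]
    rw [h]
    exact ContDiffOn.sum fun i _ => contDiffOn_const.clm_comp (hα i)
  have hAe : ∀ y ∈ N, ∃ L : V ≃L[ℝ] (Fin n → ℝ), (L : V →L[ℝ] (Fin n → ℝ)) = A y := by
    intro y hy
    have hi : Function.Injective (A y) := by
      rw [injective_iff_map_eq_zero]
      exact fun v hv => hinj y hy v fun i => congrFun hv i
    exact exists_equiv_of_bijective ⟨hi, (LinearMap.injective_iff_surjective_of_finrank_eq_finrank
      (f := (A y).toLinearMap) (by simp [hn])).1 hi⟩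
  refine ⟨fun j y => (A y).inverse (Pi.single j 1), fun j y hy => ?_, fun y hy i j => ?_⟩
  · obtain ⟨L, hL⟩ := hAe y hy
    have h1 : ContDiffAt ℝ ∞ ContinuousLinearMap.inverse (A y) := hL ▸ contDiffAt_map_inverse L
    exact (h1.comp_contDiffWithinAt y (hAs y hy)).clm_apply contDiffWithinAt_const
  · obtain ⟨L, hL⟩ := hAe y hy
    have h1 : A y ((A y).inverse (Pi.single j 1)) = Pi.single j 1 := by simp [← hL]
    have := congrFun h1 i
    simpa [hA, Pi.single_apply] using this

end OneForms

end Backlund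

/-! ### Characteristic coframings and their vertical directions -/

namespace Backlund

open Set Filter VectorField

section

variable {V W : Type*} [NormedAddCommGroup V] [NormedSpace ℝ V]
  [NormedAddCommGroup W] [NormedSpace ℝ W]

/-- The value on two vectors of the wedge product of two covectors. -/
def wdg (α β : V →L[ℝ] ℝ) (v w : V) : ℝ := α v * β w - α w * β v

theorem eq_sum_dualFrame {n : ℕ} {α : Fin n → V →L[ℝ] ℝ} {e : Fin n → V}
    (hinj : ∀ v, (∀ i, α i v = 0) → v = 0) (he : ∀ i j, α i (e j) = if i = j then 1 else 0)
    (v : V) : v = ∑ i, α i v • e i := by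
  refine sub_eq_zero.1 (hinj _ fun i => ?_)
  simp [he]

omit [NormedSpace ℝ V] in
theorem eventually_mem_isOpen {N : Set V} (hN : IsOpen N) {y : V} (hy : y ∈ N) {P : V → Prop}
    (h : ∀ z ∈ N, P z) : ∀ᶠ z in 𝓝 y, P z :=
  (hN.eventually_mem hy).mono h

theorem ContDiffOn.differentiableAt_of_isOpen {f : V → W} {N : Set V} (hf : ContDiffOn ℝ ∞ f N)
    (hN : IsOpen N) {y : V} (hy : y ∈ N) : DifferentiableAt ℝ f y :=
  (hf.contDiffAt (hN.mem_nhds hy)).differentiableAt (by simp)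

theorem differentiableAt_linearIsometryEquiv {Z G H : Type*} [NormedAddCommGroup Z]
    [NormedSpace ℝ Z] [NormedAddCommGroup G] [NormedSpace ℝ G] [NormedAddCommGroup H]
    [NormedSpace ℝ H] (L : G ≃ₗᵢ[ℝ] H) {f : Z → G} {z : Z} (hf : DifferentiableAt ℝ f z) :
    DifferentiableAt ℝ (fun z => L (f z)) z :=
  L.differentiable.differentiableAt.comp z hf

theorem differentiableAt_flip {f : V → W →L[ℝ] W →L[ℝ] ℝ} {z : V} (hf : DifferentiableAt ℝ f z) :
    DifferentiableAt ℝ (fun z => (f z).flip) z :=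
  differentiableAt_linearIsometryEquiv (G := W →L[ℝ] W →L[ℝ] ℝ) (H := W →L[ℝ] W →L[ℝ] ℝ)
    (ContinuousLinearMap.flipₗᵢ ℝ W W ℝ) hf

/-- A submersion `p` onto a contact manifold with a Monge-Ampère system generated by `θ`, `dθ`, `Ψ`,
and a coframing `(p^*θ, β, κ⁰, κ¹, κ², κ³)` adapted to the two characteristic systems. -/
structure IsCharacteristicCoframing (N : Set V) (U : Set W) (p : V → W) (θ : W → W →L[ℝ] ℝ)
    (Ψ : W → W →L[ℝ] W →L[ℝ] ℝ) (β : V → V →L[ℝ] ℝ) (κ : Fin 4 → V → V →L[ℝ] ℝ) : Prop where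
  isOpen_N : IsOpen N
  isOpen_U : IsOpen U
  smooth_p : ContDiffOn ℝ ∞ p N
  mapsTo : MapsTo p N U
  smooth_θ : ContDiffOn ℝ ∞ θ U
  smooth_Ψ : ∀ m ∈ U, DifferentiableAt ℝ Ψ m
  smooth_β : ContDiffOn ℝ ∞ β N
  smooth_κ : ∀ i, ContDiffOn ℝ ∞ (κ i) N
  coframe : ∀ y ∈ N, ∀ v, pb p θ y v = 0 → β y v = 0 → (∀ i, κ i y v = 0) → v = 0
  surjective : ∀ y ∈ N, Function.Surjective (fderiv ℝ p y)
  structure_eq : ∀ y ∈ N, ∃ a c s t : ℝ, a ≠ 0 ∧ c ≠ 0 ∧ s * c - t * a ≠ 0 ∧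
    (∀ v w, pb p θ y v = 0 → pb p θ y w = 0 → ed (pb p θ) y v w =
      a * wdg (κ 0 y) (κ 1 y) v w + c * wdg (κ 2 y) (κ 3 y) v w) ∧
    (∀ v w, pb p θ y v = 0 → pb p θ y w = 0 → β y v = 0 → β y w = 0 →
      Ψ (p y) (fderiv ℝ p y v) (fderiv ℝ p y w) =
      s * wdg (κ 0 y) (κ 1 y) v w + t * wdg (κ 2 y) (κ 3 y) v w)

namespace IsCharacteristicCoframing

variable {N : Set V} {U : Set W} {p : V → W} {θ : W → W →L[ℝ] ℝ}
  {Ψ : W → W →L[ℝ] W →L[ℝ] ℝ} {β : V → V →L[ℝ] ℝ} {κ : Fin 4 → V → V →L[ℝ] ℝ}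

theorem contDiffAt_p (h : IsCharacteristicCoframing N U p θ Ψ β κ) {y : V} (hy : y ∈ N) :
    ContDiffAt ℝ ∞ p y := h.smooth_p.contDiffAt (h.isOpen_N.mem_nhds hy)

theorem ed_pb_eq (h : IsCharacteristicCoframing N U p θ Ψ β κ) {y : V} (hy : y ∈ N) (v w : V) :
    ed (pb p θ) y v w = ed θ (p y) (fderiv ℝ p y v) (fderiv ℝ p y w) :=
  ed_pb (h.contDiffAt_p hy) (ContDiffOn.differentiableAt_of_isOpen h.smooth_θ h.isOpen_U
    (h.mapsTo hy)) v w

/-- The coframing as a single family. -/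
noncomputable def coframing (p : V → W) (θ : W → W →L[ℝ] ℝ) (β : V → V →L[ℝ] ℝ)
    (κ : Fin 4 → V → V →L[ℝ] ℝ) : Fin 6 → V → V →L[ℝ] ℝ :=
  ![pb p θ, β, κ 0, κ 1, κ 2, κ 3]

variable [FiniteDimensional ℝ V]

/-- Index convention from here on: `e 0` is dual to the contact form, `e 1` to `β`, and `e 2, …, e
5` to `κ 0, …, κ 3`. The shift by two is `natAdd 2`. -/
theorem exists_frame (h : IsCharacteristicCoframing N U p θ Ψ β κ)
    (hV : Module.finrank ℝ V = 6) :
    ∃ e : Fin 6 → V → V, (∀ j, ContDiffOn ℝ ∞ (e j) N) ∧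
      (∀ y ∈ N, ∀ i j, coframing p θ β κ i y (e j y) = if i = j then 1 else 0) ∧
      ∀ y ∈ N, ∀ v, v = pb p θ y v • e 0 y + β y v • e 1 y + κ 0 y v • e 2 y + κ 1 y v • e 3 y +
        κ 2 y v • e 4 y + κ 3 y v • e 5 y := by
  have hinj : ∀ y ∈ N, ∀ v, (∀ i, coframing p θ β κ i y v = 0) → v = 0 := by
    intro y hy v hv
    refine h.coframe y hy v (hv 0) (hv 1) fun i => ?_
    fin_cases i
    exacts [hv 2, hv 3, hv 4, hv 5]
  obtain ⟨e, he, hd⟩ := exists_dualFrame hV (α := coframing p θ β κ) (N := N) (by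
    intro i
    fin_cases i
    exacts [contDiffOn_pb h.isOpen_N h.smooth_p h.smooth_θ h.mapsTo, h.smooth_β, h.smooth_κ 0,
      h.smooth_κ 1, h.smooth_κ 2, h.smooth_κ 3]) hinj
  refine ⟨e, he, hd, fun y hy v => ?_⟩
  have := eq_sum_dualFrame (α := fun i => coframing p θ β κ i y) (e := fun i => e i y)
    (hinj y hy) (hd y hy) v
  simpa [Fin.sum_univ_six, coframing] using this

/-- The vertical directions of `p` are annihilated by all forms of the coframing but `β`. -/
theorem vertical (h : IsCharacteristicCoframing N U p θ Ψ β κ) (hV : Module.finrank ℝ V = 6)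
    {y : V} (hy : y ∈ N) {v : V} (hv : fderiv ℝ p y v = 0) :
    pb p θ y v = 0 ∧ ∀ i, κ i y v = 0 := by
  obtain ⟨e, -, he, -⟩ := h.exists_frame hV
  have h0 : pb p θ y v = 0 := by rw [pb_apply, hv, map_zero]
  obtain ⟨a, c, -, -, ha, hc, -, hs, -⟩ := h.structure_eq y hy
  have hκ : ∀ (i : Fin 4) (j : Fin 6), κ i y (e j y) = if (i.natAdd 2 : Fin 6) = j then 1 else 0 := by
    intro i j
    have := he y hy (i.natAdd 2) j
    fin_cases i <;> exact this
  -- The derivative of the contact form is pulled back from the base, so a vertical `v` lies in its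
  -- kernel. Pairing with `e 2, …, e 5` isolates the four values `κ i y v`, because `a` and `c` are
  -- nonzero.
  have hz : ∀ w, pb p θ y w = 0 →
      a * wdg (κ 0 y) (κ 1 y) v w + c * wdg (κ 2 y) (κ 3 y) v w = 0 := by
    intro w hw
    rw [← hs v w h0 hw, h.ed_pb_eq hy, hv]
    simp
  have h2 := hz (e 2 y) (he y hy 0 2)
  have h3 := hz (e 3 y) (he y hy 0 3)
  have h4 := hz (e 4 y) (he y hy 0 4)
  have h5 := hz (e 5 y) (he y hy 0 5)
  simp [wdg, hκ, ha, hc, Fin.ext_iff] at h2 h3 h4 h5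
  refine ⟨h0, fun i => ?_⟩
  fin_cases i
  exacts [h3, h2, h5, h4]

/-- The kernel of `Dp` is nonzero because 6 > 5, and a nonzero vertical vector is seen by `β` alone.
Hence every vector annihilated by the other five forms is a multiple of it. -/
theorem vertical_iff [FiniteDimensional ℝ W] (h : IsCharacteristicCoframing N U p θ Ψ β κ)
    (hV : Module.finrank ℝ V = 6)
    (hW : Module.finrank ℝ W = 5) {y : V} (hy : y ∈ N) (v : V) :
    fderiv ℝ p y v = 0 ↔ pb p θ y v = 0 ∧ ∀ i, κ i y v = 0 := by
  refine ⟨fun hv => h.vertical hV hy hv, fun ⟨hv0, hv⟩ => ?_⟩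
  have hnt : ∃ x : V, x ≠ 0 ∧ fderiv ℝ p y x = 0 := by
    by_contra! hcon
    have hi : Function.Injective (fderiv ℝ p y) := by
      rw [injective_iff_map_eq_zero]
      exact fun x hx => by_contra fun hx0 => hcon x hx0 hx
    have := LinearMap.finrank_le_finrank_of_injective (f := (fderiv ℝ p y).toLinearMap) hi
    omega
  obtain ⟨x, hx0, hx⟩ := hnt
  obtain ⟨hx1, hx2⟩ := h.vertical hV hy hx
  have hβx : β y x ≠ 0 := fun hβ => hx0 (h.coframe y hy x hx1 hβ hx2)
  have : v - (β y v / β y x) • x = 0 := by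
    refine h.coframe y hy _ ?_ ?_ fun i => ?_
    · simp [hv0, hx1]
    · simp [hβx]
    · simp [hv i, hx2 i]
  rw [sub_eq_zero.1 this, map_smul, hx, smul_zero]

/-- Vertical fields are Cauchy characteristics of the pulled back characteristic systems. -/
theorem ed_vertical [FiniteDimensional ℝ W] (h : IsCharacteristicCoframing N U p θ Ψ β κ)
    (hV : Module.finrank ℝ V = 6)
    (hW : Module.finrank ℝ W = 5) {y : V} (hy : y ∈ N) {v w : V} (hv : fderiv ℝ p y v = 0)
    (hw : pb p θ y w = 0) :
    (κ 0 y w = 0 → κ 1 y w = 0 → ed (κ 0) y v w = 0 ∧ ed (κ 1) y v w = 0) ∧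
    (κ 2 y w = 0 → κ 3 y w = 0 → ed (κ 2) y v w = 0 ∧ ed (κ 3) y v w = 0) := by
  obtain ⟨e, hes, he, hspan⟩ := h.exists_frame hV
  have hed : ∀ j, ∀ z ∈ N, DifferentiableAt ℝ (e j) z := fun j z hz =>
    ContDiffOn.differentiableAt_of_isOpen (hes j) h.isOpen_N hz
  have hκd : ∀ i, DifferentiableAt ℝ (κ i) y := fun i =>
    ContDiffOn.differentiableAt_of_isOpen (h.smooth_κ i) h.isOpen_N hy
  have hβe : ∀ z ∈ N, ∀ j, β z (e j z) = if 1 = j then 1 else 0 := fun z hz j => he z hz 1 j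
  have hθe : ∀ z ∈ N, ∀ j, pb p θ z (e j z) = if 0 = j then 1 else 0 := fun z hz j => he z hz 0 j
  have hκ : ∀ z ∈ N, ∀ (i : Fin 4) (j : Fin 6),
      κ i z (e j z) = if (i.natAdd 2 : Fin 6) = j then 1 else 0 := by
    intro z hz i j
    have := he z hz (i.natAdd 2) j
    fin_cases i <;> exact this
  have hξ : ∀ z ∈ N, fderiv ℝ p z (e 1 z) = 0 := fun z hz =>
    (h.vertical_iff hV hW hz _).2 ⟨hθe z hz 1, fun i => by
      rw [hκ z hz]; fin_cases i <;> simp [Fin.ext_iff]⟩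
  set ξ := e 1 with hξdef
  -- brackets with the vertical field stay in the contact distribution
  have hbr : ∀ j, pb p θ y (lieBracket ℝ ξ (e j) y) = 0 := by
    intro j
    have h1 := ed_eq_neg_lieBracket (α := pb p θ) (X := ξ) (Y := e j) (x := y)
      (ContDiffOn.differentiableAt_of_isOpen
        (contDiffOn_pb h.isOpen_N h.smooth_p h.smooth_θ h.mapsTo) h.isOpen_N hy)
      (hed 1 y hy) (hed j y hy)
      (eventually_mem_isOpen h.isOpen_N hy fun z hz => hθe z hz 1)
      (eventually_mem_isOpen h.isOpen_N hy fun z hz => hθe z hz j)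
    rw [h.ed_pb_eq hy, hξ y hy] at h1
    simpa using h1.symm
  have hκbr : ∀ i j, ed (κ i) y (ξ y) (e j y) = -κ i y (lieBracket ℝ ξ (e j) y) := fun i j =>
    ed_eq_neg_lieBracket (hκd i) (hed 1 y hy) (hed j y hy)
      (eventually_mem_isOpen h.isOpen_N hy fun z hz => hκ z hz i 1)
      (eventually_mem_isOpen h.isOpen_N hy fun z hz => hκ z hz i j)
  -- `Ψ` on the contact distribution, modulo vertical vectors
  have hΨ : ∀ z ∈ N, ∀ s t : ℝ, (∀ v w, pb p θ z v = 0 → pb p θ z w = 0 → β z v = 0 → β z w = 0 →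
      Ψ (p z) (fderiv ℝ p z v) (fderiv ℝ p z w) =
      s * wdg (κ 0 z) (κ 1 z) v w + t * wdg (κ 2 z) (κ 3 z) v w) →
      ∀ v w, pb p θ z v = 0 → pb p θ z w = 0 →
      Ψ (p z) (fderiv ℝ p z v) (fderiv ℝ p z w) =
      s * wdg (κ 0 z) (κ 1 z) v w + t * wdg (κ 2 z) (κ 3 z) v w := by
    intro z hz s t hst v w hv hw
    have h1 := hst (v - β z v • ξ z) (w - β z w • ξ z) (by simp [hv, hθe z hz, hξdef])
      (by simp [hw, hθe z hz, hξdef]) (by simp [hβe z hz, hξdef]) (by simp [hβe z hz, hξdef])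
    have hκξ : ∀ i, κ i z (ξ z) = 0 := fun i => by
      rw [hξdef, hκ z hz]; fin_cases i <;> simp [Fin.ext_iff]
    simpa [wdg, hξ z hz, hκξ] using h1
  -- the two relations coming from `dθ` and from `Ψ`
  have hrel : ∀ (Φ : W → W →L[ℝ] W →L[ℝ] ℝ), DifferentiableAt ℝ Φ (p y) →
      (∀ z ∈ N, ∃ s t : ℝ, ∀ v w, pb p θ z v = 0 → pb p θ z w = 0 →
        Φ (p z) (fderiv ℝ p z v) (fderiv ℝ p z w) =
          s * wdg (κ 0 z) (κ 1 z) v w + t * wdg (κ 2 z) (κ 3 z) v w) →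
      ∀ i ∈ ({2, 3} : Set (Fin 6)), ∀ j ∈ ({4, 5} : Set (Fin 6)),
        Φ (p y) (fderiv ℝ p y (lieBracket ℝ ξ (e i) y)) (fderiv ℝ p y (e j y)) +
        Φ (p y) (fderiv ℝ p y (e i y)) (fderiv ℝ p y (lieBracket ℝ ξ (e j) y)) = 0 := by
    intro Φ hΦ hst i hi j hj
    refine pullback_lieBracket_eq_zero (h.contDiffAt_p hy) hΦ (hed 1 y hy) (hed i y hy)
      (hed j y hy) (eventually_mem_isOpen h.isOpen_N hy hξ)
      (eventually_mem_isOpen h.isOpen_N hy fun z hz => ?_)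
    obtain ⟨s, t, hst⟩ := hst z hz
    rcases hi with rfl | rfl <;> rcases hj with rfl | rfl <;>
    · rw [hst _ _ (by rw [hθe z hz]; simp) (by rw [hθe z hz]; simp)]
      simp [wdg, hκ z hz, Fin.ext_iff]
  obtain ⟨a, c, s, t, ha, hc, hdet, hsθ, hsΨ⟩ := h.structure_eq y hy
  have hsθ' : ∀ v w, pb p θ y v = 0 → pb p θ y w = 0 →
      ed θ (p y) (fderiv ℝ p y v) (fderiv ℝ p y w) =
      a * wdg (κ 0 y) (κ 1 y) v w + c * wdg (κ 2 y) (κ 3 y) v w := fun v w hv hw => by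
    rw [← h.ed_pb_eq hy, hsθ v w hv hw]
  have hsΨ' := hΨ y hy s t hsΨ
  have hedθ : DifferentiableAt ℝ (ed θ) (p y) := by
    have h1 : ContDiffOn ℝ ∞ (fderiv ℝ θ) U := h.smooth_θ.fderiv_of_isOpen h.isOpen_U (by simp)
    have h2 := ContDiffOn.differentiableAt_of_isOpen h1 h.isOpen_U (h.mapsTo hy)
    have h3 : DifferentiableAt ℝ (fun z => (fderiv ℝ θ z).flip) (p y) :=
      differentiableAt_flip h2
    exact h2.sub h3
  -- Both 2-forms vanish on `(e i, e j)` with `i`, `j` from different blocks, so their Lie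
  -- derivatives along `ξ` give two linear equations in the same two unknowns. The determinant is `s
  -- * c - t * a`, and therefore both unknowns are zero.
  have key : ∀ i ∈ ({2, 3} : Set (Fin 6)), ∀ j ∈ ({4, 5} : Set (Fin 6)),
      wdg (κ 0 y) (κ 1 y) (e i y) (lieBracket ℝ ξ (e j) y) = 0 ∧
      wdg (κ 2 y) (κ 3 y) (lieBracket ℝ ξ (e i) y) (e j y) = 0 := by
    intro i hi j hj
    have r1 := hrel (ed θ) hedθ (fun z hz => by
      obtain ⟨a, c, -, -, -, -, -, hsθ, -⟩ := h.structure_eq z hz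
      exact ⟨a, c, fun v w hv hw => by rw [← h.ed_pb_eq hz, hsθ v w hv hw]⟩) i hi j hj
    have r2 := hrel Ψ (h.smooth_Ψ _ (h.mapsTo hy)) (fun z hz => by
      obtain ⟨-, -, s, t, -, -, -, -, hsΨ⟩ := h.structure_eq z hz
      exact ⟨s, t, hΨ z hz s t hsΨ⟩) i hi j hj
    have hi0 : pb p θ y (e i y) = 0 := by
      rw [hθe y hy]; rcases hi with rfl | rfl <;> simp
    have hj0 : pb p θ y (e j y) = 0 := by
      rw [hθe y hy]; rcases hj with rfl | rfl <;> simp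
    rw [hsθ' _ _ (hbr i) hj0, hsθ' _ _ hi0 (hbr j)] at r1
    rw [hsΨ' _ _ (hbr i) hj0, hsΨ' _ _ hi0 (hbr j)] at r2
    have z1 : wdg (κ 0 y) (κ 1 y) (lieBracket ℝ ξ (e i) y) (e j y) = 0 := by
      rcases hj with rfl | rfl <;> simp [wdg, hκ y hy, Fin.ext_iff]
    have z2 : wdg (κ 2 y) (κ 3 y) (e i y) (lieBracket ℝ ξ (e j) y) = 0 := by
      rcases hi with rfl | rfl <;> simp [wdg, hκ y hy, Fin.ext_iff]
    rw [z1, z2] at r1 r2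
    constructor
    · refine (mul_eq_zero.1 (?_ : (s * c - t * a) * _ = 0)).resolve_left hdet
      linear_combination c * r2 - t * r1
    · refine (mul_eq_zero.1 (?_ : (s * c - t * a) * _ = 0)).resolve_left hdet
      linear_combination s * r1 - a * r2
  have hE : ∀ j ∈ ({4, 5} : Set (Fin 6)), κ 0 y (lieBracket ℝ ξ (e j) y) = 0 ∧
      κ 1 y (lieBracket ℝ ξ (e j) y) = 0 := by
    intro j hj
    have h2 := (key 2 (by simp) j hj).1
    have h3 := (key 3 (by simp) j hj).1
    simp [wdg, hκ y hy, Fin.ext_iff] at h2 h3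
    exact ⟨h3, h2⟩
  have hF : ∀ i ∈ ({2, 3} : Set (Fin 6)), κ 2 y (lieBracket ℝ ξ (e i) y) = 0 ∧
      κ 3 y (lieBracket ℝ ξ (e i) y) = 0 := by
    intro i hi
    have h4 := (key i hi 4 (by simp)).2
    have h5 := (key i hi 5 (by simp)).2
    simp [wdg, hκ y hy, Fin.ext_iff] at h4 h5
    exact ⟨h5, h4⟩
  obtain ⟨hv0, hvκ⟩ := h.vertical hV hy hv
  have hve : v = β y v • ξ y := by
    have := hspan y hy v
    simpa [hv0, hvκ] using this
  have hwe := hspan y hy w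
  constructor
  · intro hw0 hw1
    rw [hw, hw0, hw1] at hwe
    rw [hve, hwe]
    constructor <;>
      simp [ed_self, hκbr, hE]
  · intro hw2 hw3
    rw [hw, hw2, hw3] at hwe
    rw [hve, hwe]
    constructor <;>
      simp [ed_self, hκbr, hF]

end IsCharacteristicCoframing

end

end Backlund

/-! ### Integrability of the characteristic systems -/

namespace Backlund

open Set Filter VectorField

namespace IsCharacteristicCoframing

section

variable {V W₁ W₂ : Type*} [NormedAddCommGroup V] [NormedSpace ℝ V]
  [NormedAddCommGroup W₁] [NormedSpace ℝ W₁] [NormedAddCommGroup W₂] [NormedSpace ℝ W₂]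
  {N : Set V} {U₁ : Set W₁} {p₁ : V → W₁} {θ₁ : W₁ → W₁ →L[ℝ] ℝ} {Ψ₁ : W₁ → W₁ →L[ℝ] W₁ →L[ℝ] ℝ}
  {U₂ : Set W₂} {p₂ : V → W₂} {θ₂ : W₂ → W₂ →L[ℝ] ℝ} {Ψ₂ : W₂ → W₂ →L[ℝ] W₂ →L[ℝ] ℝ}
  {κ : Fin 4 → V → V →L[ℝ] ℝ} {β : V → V →L[ℝ] ℝ}

/-- The two characteristic systems can be exchanged. -/
theorem exchange (h : IsCharacteristicCoframing N U₁ p₁ θ₁ Ψ₁ β κ) :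
    IsCharacteristicCoframing N U₁ p₁ θ₁ Ψ₁ β (κ ∘ ![2, 3, 0, 1]) where
  isOpen_N := h.isOpen_N
  isOpen_U := h.isOpen_U
  smooth_p := h.smooth_p
  mapsTo := h.mapsTo
  smooth_θ := h.smooth_θ
  smooth_Ψ := h.smooth_Ψ
  smooth_β := h.smooth_β
  smooth_κ i := h.smooth_κ _
  coframe y hy v h0 h1 h2 := h.coframe y hy v h0 h1 fun i => by
    fin_cases i
    exacts [h2 2, h2 3, h2 0, h2 1]
  surjective := h.surjective
  structure_eq y hy := by
    obtain ⟨a, c, s, t, ha, hc, hst, h1, h2⟩ := h.structure_eq y hy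
    refine ⟨c, a, t, s, hc, ha, fun h0 => hst (by linarith), fun v w hv hw => ?_,
      fun v w hv hw hv' hw' => ?_⟩
    · rw [h1 v w hv hw, add_comm]; rfl
    · rw [h2 v w hv hw hv' hw', add_comm]; rfl

variable [FiniteDimensional ℝ V] [FiniteDimensional ℝ W₁] [FiniteDimensional ℝ W₂]

/-- If the torsion of a characteristic system vanishes, its derived system is integrable. -/
theorem ed_eq_zero (h₁ : IsCharacteristicCoframing N U₁ p₁ θ₁ Ψ₁ (pb p₂ θ₂) κ)
    (h₂ : IsCharacteristicCoframing N U₂ p₂ θ₂ Ψ₂ (pb p₁ θ₁) κ)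
    (hV : Module.finrank ℝ V = 6) (hW₁ : Module.finrank ℝ W₁ = 5) (hW₂ : Module.finrank ℝ W₂ = 5)
    (hT : ∀ i : Fin 4, (i = 0 ∨ i = 1) → ∀ y ∈ N, ∀ v w, pb p₁ θ₁ y v = 0 → pb p₁ θ₁ y w = 0 → pb p₂ θ₂ y v = 0 →
      pb p₂ θ₂ y w = 0 → κ 0 y v = 0 → κ 0 y w = 0 → κ 1 y v = 0 → κ 1 y w = 0 →
      ed (κ i) y v w = 0) {y : V} (hy : y ∈ N) {v w : V} (hv₀ : κ 0 y v = 0) (hv₁ : κ 1 y v = 0)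
    (hw₀ : κ 0 y w = 0) (hw₁ : κ 1 y w = 0) {i : Fin 4} (hi : i = 0 ∨ i = 1) :
    ed (κ i) y v w = 0 := by
  obtain ⟨e, hes, he, hspan⟩ := h₁.exists_frame hV
  have hN := h₁.isOpen_N
  have hed : ∀ j, ∀ z ∈ N, ContDiffAt ℝ ∞ (e j) z := fun j z hz =>
    (hes j).contDiffAt (hN.mem_nhds hz)
  have hed' : ∀ j, ∀ z ∈ N, DifferentiableAt ℝ (e j) z := fun j z hz =>
    (hed j z hz).differentiableAt (by simp)
  have hκd : ∀ i, ∀ z ∈ N, DifferentiableAt ℝ (κ i) z := fun i z hz =>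
    ContDiffOn.differentiableAt_of_isOpen (h₁.smooth_κ i) hN hz
  have hθd : ∀ z ∈ N, DifferentiableAt ℝ (pb p₁ θ₁) z := fun z hz =>
    ContDiffOn.differentiableAt_of_isOpen h₂.smooth_β hN hz
  have hθ₁ : ∀ z ∈ N, ∀ j, pb p₁ θ₁ z (e j z) = if 0 = j then 1 else 0 := fun z hz j => he z hz 0 j
  have hθ₂ : ∀ z ∈ N, ∀ j, pb p₂ θ₂ z (e j z) = if 1 = j then 1 else 0 := fun z hz j => he z hz 1 j
  have hκ : ∀ z ∈ N, ∀ (i : Fin 4) (j : Fin 6),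
      κ i z (e j z) = if (i.natAdd 2 : Fin 6) = j then 1 else 0 := by
    intro z hz i j
    have := he z hz (i.natAdd 2) j
    fin_cases i <;> exact this
  -- The frame is shared: `e 1` spans the fibre of `p₁` and `e 0` that of `p₂`. Being Cauchy
  -- characteristic, they settle the values of `ed (κ i)` on all pairs from `e 0, e 1, e 4, e 5`
  -- except `(e 4, e 5)`, which is the torsion hypothesis, and `(e 0, e 1)`.
  have hx₁ : ∀ z ∈ N, fderiv ℝ p₁ z (e 1 z) = 0 := fun z hz =>
    (h₁.vertical_iff hV hW₁ hz _).2 ⟨hθ₁ z hz 1, fun i => by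
      rw [hκ z hz]; fin_cases i <;> simp [Fin.ext_iff]⟩
  have hx₀ : ∀ z ∈ N, fderiv ℝ p₂ z (e 0 z) = 0 := fun z hz =>
    (h₂.vertical_iff hV hW₂ hz _).2 ⟨hθ₂ z hz 0, fun i => by
      rw [hκ z hz]; fin_cases i <;> simp [Fin.ext_iff]⟩
  have hv1 : ∀ i : Fin 4, (i = 0 ∨ i = 1) → ∀ z ∈ N, ∀ x, pb p₁ θ₁ z x = 0 → κ 0 z x = 0 → κ 1 z x = 0 →
      ed (κ i) z (e 1 z) x = 0 := by
    intro i hi z hz x h0 h1 h2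
    have := (h₁.ed_vertical hV hW₁ hz (hx₁ z hz) h0).1 h1 h2
    rcases hi with rfl | rfl
    exacts [this.1, this.2]
  have hv0 : ∀ i : Fin 4, (i = 0 ∨ i = 1) → ∀ z ∈ N, ∀ x, pb p₂ θ₂ z x = 0 → κ 0 z x = 0 → κ 1 z x = 0 →
      ed (κ i) z (e 0 z) x = 0 := by
    intro i hi z hz x h0 h1 h2
    have := (h₂.ed_vertical hV hW₂ hz (hx₀ z hz) h0).1 h1 h2
    rcases hi with rfl | rfl
    exacts [this.1, this.2]
  -- the derivative vanishes on the characteristic distribution of the first system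
  have hΔ : ∀ i : Fin 4, (i = 0 ∨ i = 1) → ∀ z ∈ N, ∀ a b, pb p₁ θ₁ z a = 0 → κ 0 z a = 0 → κ 1 z a = 0 →
      pb p₁ θ₁ z b = 0 → κ 0 z b = 0 → κ 1 z b = 0 → ed (κ i) z a b = 0 := by
    intro i hi z hz a b ha ha0 ha1 hb hb0 hb1
    have hsp : ∀ x, pb p₁ θ₁ z x = 0 → κ 0 z x = 0 → κ 1 z x = 0 →
        ∃ (r : ℝ) (x' : V), x = r • e 1 z + x' ∧ pb p₁ θ₁ z x' = 0 ∧ pb p₂ θ₂ z x' = 0 ∧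
          κ 0 z x' = 0 ∧ κ 1 z x' = 0 := fun x hx hx0 hx1 =>
      ⟨pb p₂ θ₂ z x, x - pb p₂ θ₂ z x • e 1 z, by abel, by simp [hθ₁ z hz, hx],
        by simp [hθ₂ z hz], by simp [hκ z hz, hx0, Fin.ext_iff], by simp [hκ z hz, hx1, Fin.ext_iff]⟩
    obtain ⟨r, a, rfl, a1, a2, a3, a4⟩ := hsp a ha ha0 ha1
    obtain ⟨r', b, rfl, b1, b2, b3, b4⟩ := hsp b hb hb0 hb1
    have e1 := hT i hi z hz a b a1 b1 a2 b2 a3 b3 a4 b4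
    have e2 := hv1 i hi z hz a a1 a3 a4
    have e3 := hv1 i hi z hz b b1 b3 b4
    rw [ed_swap] at e2
    simp [ed_self, e1, e3, neg_eq_zero.1 e2]
  have hbr : ∀ {X Y : V → V} {c d : ℝ}, ∀ z ∈ N, ∀ k, DifferentiableAt ℝ X z → DifferentiableAt ℝ Y z →
      (∀ z ∈ N, κ k z (X z) = c) → (∀ z ∈ N, κ k z (Y z) = d) →
      ed (κ k) z (X z) (Y z) = -κ k z (lieBracket ℝ X Y z) := fun z hz k hX hY hX' hY' =>
    ed_eq_neg_lieBracket (hκd k z hz) hX hY (eventually_mem_isOpen hN hz hX')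
      (eventually_mem_isOpen hN hz hY')
  have hbrθ : ∀ j j', ∀ z ∈ N, ed (pb p₁ θ₁) z (e j z) (e j' z) =
      -pb p₁ θ₁ z (lieBracket ℝ (e j) (e j') z) := fun j j' z hz =>
    ed_eq_neg_lieBracket (hθd z hz) (hed' j z hz) (hed' j' z hz)
      (eventually_mem_isOpen hN hz fun x hx => hθ₁ x hx j)
      (eventually_mem_isOpen hN hz fun x hx => hθ₁ x hx j')
  have hbrs : ∀ j j', ∀ z ∈ N, DifferentiableAt ℝ (lieBracket ℝ (e j) (e j')) z :=
    fun j j' z hz => (ContDiffAt.lieBracket_vectorField (m := ∞) (hed j z hz) (hed j' z hz)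
      (by simp)).differentiableAt (by simp)
  have hκ' : ∀ z ∈ N, ∀ j, j ≠ 2 → j ≠ 3 → ∀ k : Fin 4, (k = 0 ∨ k = 1) → κ k z (e j z) = 0 := by
    intro z hz j h2 h3 k hk
    rw [hκ z hz, if_neg]
    rcases hk with rfl | rfl
    exacts [fun hh => h2 hh.symm, fun hh => h3 hh.symm]
  -- brackets of the vertical field with the characteristic distribution
  have hA : ∀ j, j ∈ ({4, 5} : Set (Fin 6)) → ∀ z ∈ N,
      pb p₁ θ₁ z (lieBracket ℝ (e 1) (e j) z) = 0 ∧ ∀ k : Fin 4, (k = 0 ∨ k = 1) →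
        κ k z (lieBracket ℝ (e 1) (e j) z) = 0 := by
    intro j hj z hz
    have hj2 : j ≠ 2 ∧ j ≠ 3 ∧ j ≠ 0 := by rcases hj with rfl | rfl <;> decide
    have h0 : pb p₁ θ₁ z (e j z) = 0 := by rw [hθ₁ z hz, if_neg hj2.2.2.symm]
    constructor
    · have := hbrθ 1 j z hz
      rw [h₁.ed_pb_eq hz, hx₁ z hz] at this
      simpa using this.symm
    · intro k hk
      have h1 := hbr (X := e 1) (Y := e j) z hz k (hed' 1 z hz) (hed' j z hz)
        (fun x hx => hκ' x hx 1 (by decide) (by decide) k hk)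
        (fun x hx => hκ' x hx j hj2.1 hj2.2.1 k hk)
      have h2 := (h₁.ed_vertical hV hW₁ hz (hx₁ z hz) h0).1
        (hκ' z hz j hj2.1 hj2.2.1 0 (by simp)) (hκ' z hz j hj2.1 hj2.2.1 1 (by simp))
      rcases hk with rfl | rfl
      · rw [h2.1] at h1; linarith
      · rw [h2.2] at h1; linarith
  have hZ : ∀ z ∈ N, ∀ k : Fin 4, (k = 0 ∨ k = 1) → ed (κ k) z (e 4 z) (e 5 z) =
      -κ k z (lieBracket ℝ (e 4) (e 5) z) := fun z hz k hk =>
    hbr z hz k (hed' 4 z hz) (hed' 5 z hz)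
      (fun x hx => hκ' x hx 4 (by decide) (by decide) k hk)
      (fun x hx => hκ' x hx 5 (by decide) (by decide) k hk)
  have hzero : ∀ z ∈ N, ∀ j ∈ ({4, 5} : Set (Fin 6)), pb p₁ θ₁ z (e j z) = 0 ∧ κ 0 z (e j z) = 0 ∧
      κ 1 z (e j z) = 0 := by
    rintro z hz j (rfl | rfl) <;> simp [hθ₁ z hz, hκ z hz, Fin.ext_iff]
  -- the Jacobi identity
  have hJ : ed (κ i) y (e 1 y) (e 0 y) = 0 := by
    have hiZ : ∀ k : Fin 4, (k = 0 ∨ k = 1) → ∀ z ∈ N, κ k z (lieBracket ℝ (e 4) (e 5) z) = 0 := by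
      intro k hk z hz
      have h1 := hZ z hz k hk
      obtain ⟨a1, a2, a3⟩ := hzero z hz 4 (by simp)
      obtain ⟨b1, b2, b3⟩ := hzero z hz 5 (by simp)
      rw [hΔ k hk z hz _ _ a1 a2 a3 b1 b2 b3] at h1
      linarith
    -- The brackets of `e 1` with `e 4` and `e 5` stay in the common kernel of the first contact
    -- form, `κ 0` and `κ 1`. On that kernel `ed (κ i)` vanishes by `hΔ`, so the two right-hand
    -- terms of the Jacobi identity are annihilated by `κ i`.
    have jac := leibniz_identity_lieBracket minSmoothness_le_infty (hed 1 y hy) (hed 4 y hy)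
      (hed 5 y hy)
    have j1 := hbr (X := e 1) (Y := lieBracket ℝ (e 4) (e 5)) y hy i (hed' 1 y hy) (hbrs 4 5 y hy)
      (fun x hx => hκ' x hx 1 (by decide) (by decide) i hi) (hiZ i hi)
    have j2 := hbr (X := lieBracket ℝ (e 1) (e 4)) (Y := e 5) y hy i (hbrs 1 4 y hy) (hed' 5 y hy)
      (fun x hx => (hA 4 (by simp) x hx).2 i hi)
      (fun x hx => hκ' x hx 5 (by decide) (by decide) i hi)
    have j3 := hbr (X := e 4) (Y := lieBracket ℝ (e 1) (e 5)) y hy i (hed' 4 y hy) (hbrs 1 5 y hy)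
      (fun x hx => hκ' x hx 4 (by decide) (by decide) i hi)
      (fun x hx => (hA 5 (by simp) x hx).2 i hi)
    obtain ⟨a1, a2, a3⟩ := hzero y hy 4 (by simp)
    obtain ⟨b1, b2, b3⟩ := hzero y hy 5 (by simp)
    rw [hΔ i hi y hy _ _ (hA 4 (by simp) y hy).1 ((hA 4 (by simp) y hy).2 0 (by simp))
      ((hA 4 (by simp) y hy).2 1 (by simp)) b1 b2 b3] at j2
    rw [hΔ i hi y hy _ _ a1 a2 a3 (hA 5 (by simp) y hy).1 ((hA 5 (by simp) y hy).2 0 (by simp))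
      ((hA 5 (by simp) y hy).2 1 (by simp))] at j3
    rw [jac, map_add] at j1
    have j4 : ed (κ i) y (e 1 y) (lieBracket ℝ (e 4) (e 5) y) = 0 := by rw [j1]; linarith
    -- Since `c ≠ 0`, this bracket leaves the contact distribution, while `κ 0` and `κ 1` vanish on
    -- it. Modulo vectors already treated, it is a nonzero multiple of `e 0`, which turns `j4` into
    -- the missing value on `(e 1, e 0)`.
    set Z := lieBracket ℝ (e 4) (e 5) y with hZdef
    have hZ0 : pb p₁ θ₁ y Z ≠ 0 := by
      obtain ⟨a, c, -, -, -, hc, -, hs, -⟩ := h₁.structure_eq y hy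
      have h1 := hbrθ 4 5 y hy
      rw [hs _ _ a1 b1] at h1
      simp only [wdg, hκ y hy] at h1
      simp [Fin.ext_iff] at h1
      intro h0
      rw [← hZdef, h0, neg_zero] at h1
      exact hc h1
    have hZk : ∀ k : Fin 4, (k = 0 ∨ k = 1) → κ k y Z = 0 := fun k hk => hiZ k hk y hy
    have h5 := hv1 i hi y hy (Z - pb p₁ θ₁ y Z • e 0 y) (by simp [hθ₁ y hy])
      (by simp [hκ y hy, hZk, Fin.ext_iff]) (by simp [hκ y hy, hZk, Fin.ext_iff])
    rw [map_sub, j4, map_smul, zero_sub, neg_eq_zero, smul_eq_mul] at h5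
    exact (mul_eq_zero.1 h5).resolve_left hZ0
  have hsp : ∀ x, κ 0 y x = 0 → κ 1 y x = 0 → ∃ (r : ℝ) (x' : V), x = r • e 0 y + x' ∧
      pb p₁ θ₁ y x' = 0 ∧ κ 0 y x' = 0 ∧ κ 1 y x' = 0 := fun x hx0 hx1 =>
    ⟨pb p₁ θ₁ y x, x - pb p₁ θ₁ y x • e 0 y, by abel, by simp [hθ₁ y hy],
      by simp [hκ y hy, hx0, Fin.ext_iff], by simp [hκ y hy, hx1, Fin.ext_iff]⟩
  have h0 : ∀ x, pb p₁ θ₁ y x = 0 → κ 0 y x = 0 → κ 1 y x = 0 → ed (κ i) y (e 0 y) x = 0 := by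
    intro x hx hx0 hx1
    have h1 := hv0 i hi y hy (x - pb p₂ θ₂ y x • e 1 y) (by simp [hθ₂ y hy])
      (by simp [hκ y hy, hx0, Fin.ext_iff]) (by simp [hκ y hy, hx1, Fin.ext_iff])
    rw [ed_swap] at hJ
    simpa [neg_eq_zero.1 hJ] using h1
  obtain ⟨r, v, rfl, v1, v2, v3⟩ := hsp v hv₀ hv₁
  obtain ⟨r', w, rfl, w1, w2, w3⟩ := hsp w hw₀ hw₁
  have h1 := h0 v v1 v2 v3
  rw [ed_swap, neg_eq_zero] at h1
  simp [ed_self, h1, h0 w w1 w2 w3, hΔ i hi y hy _ _ v1 v2 v3 w1 w2 w3]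

/-- First integrals of a characteristic system. -/
theorem exists_firstIntegrals {V : Type} [NormedAddCommGroup V] [NormedSpace ℝ V]
    [FiniteDimensional ℝ V] {N : Set V} {p₁ : V → W₁} {p₂ : V → W₂} {κ : Fin 4 → V → V →L[ℝ] ℝ}
    (h₁ : IsCharacteristicCoframing N U₁ p₁ θ₁ Ψ₁ (pb p₂ θ₂) κ)
    (h₂ : IsCharacteristicCoframing N U₂ p₂ θ₂ Ψ₂ (pb p₁ θ₁) κ)
    (hV : Module.finrank ℝ V = 6) (hW₁ : Module.finrank ℝ W₁ = 5) (hW₂ : Module.finrank ℝ W₂ = 5)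
    (hT : ∀ i : Fin 4, (i = 0 ∨ i = 1) → ∀ y ∈ N, ∀ v w, pb p₁ θ₁ y v = 0 → pb p₁ θ₁ y w = 0 →
      pb p₂ θ₂ y v = 0 → pb p₂ θ₂ y w = 0 → κ 0 y v = 0 → κ 0 y w = 0 → κ 1 y v = 0 →
      κ 1 y w = 0 → ed (κ i) y v w = 0) {y₀ : V} (hy₀ : y₀ ∈ N) :
    ∃ (N' : Set V) (u : V → ℝ × ℝ), IsOpen N' ∧ y₀ ∈ N' ∧ N' ⊆ N ∧ ContDiffOn ℝ ∞ u N' ∧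
      ∀ y ∈ N', ∀ v, fderiv ℝ u y v = 0 ↔ κ 0 y v = 0 ∧ κ 1 y v = 0 := by
  have hκd : ∀ i, ∀ z ∈ N, DifferentiableAt ℝ (κ i) z := fun i z hz =>
    ContDiffOn.differentiableAt_of_isOpen (h₁.smooth_κ i) h₁.isOpen_N hz
  have hη : ContDiffOn ℝ ∞ (fun y => (κ 0 y).prod (κ 1 y)) N := by
    have : (fun y => (κ 0 y).prod (κ 1 y)) = fun y =>
        (ContinuousLinearMap.inl ℝ ℝ ℝ).comp (κ 0 y) +
          (ContinuousLinearMap.inr ℝ ℝ ℝ).comp (κ 1 y) := by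
      funext y; ext v <;> simp
    rw [this]
    exact (contDiffOn_const.clm_comp (h₁.smooth_κ 0)).add
      (contDiffOn_const.clm_comp (h₁.smooth_κ 1))
  have hηd : ∀ y ∈ N, ∀ v w, fderiv ℝ (fun y => (κ 0 y).prod (κ 1 y)) y v w =
      (fderiv ℝ (κ 0) y v w, fderiv ℝ (κ 1) y v w) := by
    intro y hy v w
    have h0 := ContDiffOn.differentiableAt_of_isOpen hη h₁.isOpen_N hy
    have e1 := (h0.hasFDerivAt.clm_apply (hasFDerivAt_const w y))
    have e2 := ((hκd 0 y hy).hasFDerivAt.clm_apply (hasFDerivAt_const w y)).prodMk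
      ((hκd 1 y hy).hasFDerivAt.clm_apply (hasFDerivAt_const w y))
    have := congrArg (fun l => l v) (e1.unique e2)
    simpa using this
  obtain ⟨e, -, he, -⟩ := h₁.exists_frame hV
  -- The pair of forms is one form with values in the plane. As `frobenius` wants source and target
  -- in the same universe, `V` is in `Type`.
  obtain ⟨N', u, hN', hy, hsub, hu, hk⟩ := frobenius (V := V) (H := ℝ × ℝ) (N := N)
    (η := fun y => (κ 0 y).prod (κ 1 y)) (y₀ := y₀) h₁.isOpen_N hy₀ hη (fun z =>
      ⟨z.1 • e 2 y₀ + z.2 • e 3 y₀, by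
        have a0 : κ 0 y₀ (e 2 y₀) = 1 := he y₀ hy₀ 2 2
        have a1 : κ 0 y₀ (e 3 y₀) = 0 := he y₀ hy₀ 2 3
        have a2 : κ 1 y₀ (e 2 y₀) = 0 := he y₀ hy₀ 3 2
        have a3 : κ 1 y₀ (e 3 y₀) = 1 := he y₀ hy₀ 3 3
        simp [a0, a1, a2, a3]⟩) (by
      intro y hy v w hv hw
      have hv' := Prod.ext_iff.1 hv
      have hw' := Prod.ext_iff.1 hw
      have e0 := ed_eq_zero h₁ h₂ hV hW₁ hW₂ hT hy hv'.1 hv'.2 hw'.1 hw'.2 (i := 0) (by simp)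
      have e1 := ed_eq_zero h₁ h₂ hV hW₁ hW₂ hT hy hv'.1 hv'.2 hw'.1 hw'.2 (i := 1) (by simp)
      rw [ed_apply, sub_eq_zero] at e0 e1
      rw [hηd y hy, hηd y hy, e0, e1])
  refine ⟨N', u, hN', hy, hsub, hu, fun y hy v => ?_⟩
  rw [hk y hy]
  simp [Prod.ext_iff]

end

end IsCharacteristicCoframing

end Backlund

/-! ### Structure functions of a contact frame -/

namespace Backlund

open Set Filter VectorField

section

variable {W : Type*} [NormedAddCommGroup W] [NormedSpace ℝ W]

/-- The derivative of a function along a vector field. -/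
noncomputable def along (X : W → W) (f : W → ℝ) (z : W) : ℝ := fderiv ℝ f z (X z)

theorem contDiffOn_along {X : W → W} {f : W → ℝ} {N : Set W} (hN : IsOpen N)
    (hX : ContDiffOn ℝ ∞ X N) (hf : ContDiffOn ℝ ∞ f N) : ContDiffOn ℝ ∞ (along X f) N :=
  (hf.fderiv_of_isOpen hN (by simp)).clm_apply hX

theorem along_eq_zero_of_eqOn {X : W → W} {f : W → ℝ} {N : Set W} (hN : IsOpen N) {c : ℝ}
    (h : ∀ z ∈ N, f z = c) {z : W} (hz : z ∈ N) : along X f z = 0 := by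
  have : HasFDerivAt f (0 : W →L[ℝ] ℝ) z :=
    (hasFDerivAt_const c z).congr_of_eventuallyEq (eventually_mem_isOpen hN hz h)
  simp [along, this.fderiv]

theorem along_congr {X : W → W} {f g : W → ℝ} {N : Set W} (hN : IsOpen N)
    (h : ∀ z ∈ N, f z = g z) {z : W} (hz : z ∈ N) : along X f z = along X g z := by
  have : f =ᶠ[𝓝 z] g := eventually_mem_isOpen hN hz h
  simp [along, this.fderiv_eq]

theorem along_neg {X : W → W} {f : W → ℝ} {z : W} :
    along X (fun z => -f z) z = -along X f z := by
  simp [along]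

theorem along_sub {X : W → W} {f g : W → ℝ} {z : W} (hf : DifferentiableAt ℝ f z)
    (hg : DifferentiableAt ℝ g z) :
    along X (fun z => f z - g z) z = along X f z - along X g z := by
  simp [along, fderiv_fun_sub hf hg]

theorem along_log {X : W → W} {f : W → ℝ} {z : W} (hf : DifferentiableAt ℝ f z) (h : f z ≠ 0) :
    along X (fun z => Real.log (f z)) z = along X f z / f z := by
  rw [along, (hf.hasFDerivAt.log h).fderiv]
  simp [along, div_eq_inv_mul]

theorem along_commutator {X Y : W → W} {f : W → ℝ} {z : W} (hf : ContDiffAt ℝ ∞ f z)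
    (hX : DifferentiableAt ℝ X z) (hY : DifferentiableAt ℝ Y z) :
    along X (along Y f) z - along Y (along X f) z = fderiv ℝ f z (lieBracket ℝ X Y z) := by
  rw [fderiv_apply_lieBracket hf minSmoothness_le_infty hY hX]
  rfl

/-- A frame whose brackets are all proportional to its last field. -/
structure IsContactFrame (N : Set W) (e : Fin 5 → W → W) (c : Fin 5 → Fin 5 → W → ℝ) : Prop where
  isOpen : IsOpen N
  smooth : ∀ i, ContDiffOn ℝ ∞ (e i) N
  smooth_coeff : ∀ i j, ContDiffOn ℝ ∞ (c i j) N
  ne_zero : ∀ z ∈ N, e 4 z ≠ 0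
  bracket : ∀ i j, ∀ z ∈ N, lieBracket ℝ (e i) (e j) z = c i j z • e 4 z

namespace IsContactFrame

variable {N : Set W} {e : Fin 5 → W → W} {c : Fin 5 → Fin 5 → W → ℝ}

theorem differentiableAt (h : IsContactFrame N e c) (i : Fin 5) {z : W} (hz : z ∈ N) :
    DifferentiableAt ℝ (e i) z :=
  ContDiffOn.differentiableAt_of_isOpen (h.smooth i) h.isOpen hz

theorem skew (h : IsContactFrame N e c) (i j : Fin 5) {z : W} (hz : z ∈ N) :
    c i j z = -c j i z := by
  have h1 := h.bracket i j z hz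
  rw [lieBracket_swap, h.bracket j i z hz, ← neg_smul] at h1
  exact smul_left_injective ℝ (h.ne_zero z hz) h1.symm

theorem coeff_self (h : IsContactFrame N e c) (i : Fin 5) {z : W} (hz : z ∈ N) :
    c i i z = 0 := by
  have := h.skew i i hz
  linarith

theorem commutator (h : IsContactFrame N e c) (i j : Fin 5) {f : W → ℝ} (hf : ContDiffOn ℝ ∞ f N)
    {z : W} (hz : z ∈ N) :
    along (e i) (along (e j) f) z - along (e j) (along (e i) f) z = c i j z * along (e 4) f z := by
  rw [along_commutator (hf.contDiffAt (h.isOpen.mem_nhds hz)) (h.differentiableAt i hz)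
    (h.differentiableAt j hz), h.bracket i j z hz]
  simp [along]

theorem bracket_bracket (h : IsContactFrame N e c) (i j k : Fin 5) {z : W} (hz : z ∈ N) :
    lieBracket ℝ (e k) (lieBracket ℝ (e i) (e j)) z =
      (along (e k) (c i j) z + c i j z * c k 4 z) • e 4 z := by
  have h1 : lieBracket ℝ (e i) (e j) =ᶠ[𝓝 z] fun z => c i j z • e 4 z :=
    eventually_mem_isOpen h.isOpen hz (h.bracket i j)
  rw [EventuallyEq.lieBracket_vectorField_eq EventuallyEq.rfl h1, lieBracket_smul_right
    (ContDiffOn.differentiableAt_of_isOpen (h.smooth_coeff i j) h.isOpen hz)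
    (h.differentiableAt 4 hz), h.bracket k 4 z hz, smul_smul, ← add_smul]
  rfl

/-- All brackets are multiples of the nonzero field `e 4`, so the Jacobi identity for fields reduces
to one scalar equation. -/
theorem jacobi (h : IsContactFrame N e c) (i j k : Fin 5) {z : W} (hz : z ∈ N) :
    along (e k) (c i j) z + c i j z * c k 4 z + (along (e i) (c j k) z + c j k z * c i 4 z) +
      (along (e j) (c k i) z + c k i z * c j 4 z) = 0 := by
  have hs : ∀ i, ContDiffAt ℝ ∞ (e i) z := fun i => (h.smooth i).contDiffAt (h.isOpen.mem_nhds hz)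
  have h1 := leibniz_identity_lieBracket minSmoothness_le_infty (hs k) (hs i) (hs j)
  have h3 : lieBracket ℝ (e i) (lieBracket ℝ (e k) (e j)) z =
      -lieBracket ℝ (e i) (lieBracket ℝ (e j) (e k)) z := by
    have : lieBracket ℝ (e k) (e j) = -lieBracket ℝ (e j) (e k) := by
      funext z; exact lieBracket_swap
    rw [this]
    simp [lieBracket, fderiv_neg]
    abel
  rw [lieBracket_swap (V := lieBracket ℝ (e k) (e i)), h3, h.bracket_bracket _ _ _ hz,
    h.bracket_bracket _ _ _ hz, h.bracket_bracket _ _ _ hz, ← sub_eq_zero, sub_eq_add_neg,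
    neg_add, neg_neg, neg_neg, ← add_smul, ← add_smul, smul_eq_zero] at h1
  have := h1.resolve_right (h.ne_zero z hz)
  linarith

variable (h : IsContactFrame N e c)
  (hmix : ∀ i ∈ ({0, 1} : Set (Fin 5)), ∀ k ∈ ({2, 3} : Set (Fin 5)), ∀ z ∈ N, c i k z = 0)
  (ha : ∀ z ∈ N, c 0 1 z ≠ 0) (hc : ∀ z ∈ N, c 2 3 z ≠ 0)

include h hmix

/-- The other two cyclic terms of the Jacobi identity contain only mixed coefficients, which vanish.
This fixes the logarithmic derivative of one structure function along the other block. -/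
theorem along_coeff₀₁ {k : Fin 5} (hk : k ∈ ({2, 3} : Set (Fin 5))) {z : W} (hz : z ∈ N) :
    along (e k) (c 0 1) z = -c 0 1 z * c k 4 z := by
  have h1 := h.jacobi 0 1 k hz
  have h2 : ∀ z ∈ N, c k 0 z = 0 := fun z hz => by
    rw [h.skew _ _ hz, hmix 0 (by simp) k hk z hz, neg_zero]
  rw [hmix 1 (by simp) k hk z hz, h2 z hz,
    along_eq_zero_of_eqOn h.isOpen (hmix 1 (by simp) k hk) hz,
    along_eq_zero_of_eqOn h.isOpen h2 hz] at h1
  linarith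

theorem along_coeff₂₃ {k : Fin 5} (hk : k ∈ ({0, 1} : Set (Fin 5))) {z : W} (hz : z ∈ N) :
    along (e k) (c 2 3) z = -c 2 3 z * c k 4 z := by
  have h1 := h.jacobi 2 3 k hz
  have h2 : ∀ z ∈ N, c 3 k z = 0 := fun z hz => by
    rw [h.skew _ _ hz, hmix k hk 3 (by simp) z hz, neg_zero]
  rw [hmix k hk 2 (by simp) z hz, h2 z hz,
    along_eq_zero_of_eqOn h.isOpen (hmix k hk 2 (by simp)) hz,
    along_eq_zero_of_eqOn h.isOpen h2 hz] at h1
  linarith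

-- Skew-symmetry cancels the quadratic terms of the Jacobi identity when one of the three fields is
-- `e 4`.
omit hmix in
theorem along_last (i j : Fin 5) {z : W} (hz : z ∈ N) :
    along (e 4) (c i j) z = along (e j) (c i 4) z - along (e i) (c j 4) z := by
  have h1 := h.jacobi i j 4 hz
  have h2 : along (e j) (c 4 i) z = -along (e j) (c i 4) z := by
    rw [← along_neg]
    exact along_congr h.isOpen (fun z hz => h.skew 4 i hz) hz
  rw [h2, h.coeff_self 4 hz, h.skew 4 i hz] at h1
  linarith

include ha hc

/-- The logarithm of the ratio of the two nonzero structure functions. -/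
theorem along_log_ratio :
    let g := fun z => Real.log (c 2 3 z) - Real.log (c 0 1 z)
    ContDiffOn ℝ ∞ g N ∧ (∀ z ∈ N, along (e 4) g z = 0) ∧
    (∀ i ∈ ({0, 1} : Set (Fin 5)), ∀ z ∈ N,
      along (e i) g z = -c i 4 z - along (e i) (c 0 1) z / c 0 1 z) ∧
    ∀ i ∈ ({0, 1} : Set (Fin 5)), ∀ k ∈ ({2, 3, 4} : Set (Fin 5)), ∀ z ∈ N,
      along (e k) (along (e i) g) z = 0 := by
  intro g
  have hN := h.isOpen
  -- `Real.log` is log|·|, so no signs need to be fixed. What is aimed at is that the derivatives of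
  -- `g` in the first block do not change along the remaining fields, which means that `g` is a sum
  -- of a function for each block.
  set α := fun z => Real.log (c 0 1 z) with hα
  set γ := fun z => Real.log (c 2 3 z) with hγ
  have hαs : ContDiffOn ℝ ∞ α N := (h.smooth_coeff 0 1).log ha
  have hγs : ContDiffOn ℝ ∞ γ N := (h.smooth_coeff 2 3).log hc
  have hgs : ContDiffOn ℝ ∞ g N := hγs.sub hαs
  have hd : ∀ {f : W → ℝ}, ContDiffOn ℝ ∞ f N → ∀ z ∈ N, DifferentiableAt ℝ f z := fun hf z hz =>
    ContDiffOn.differentiableAt_of_isOpen hf hN hz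
  have hsm : ∀ i {f : W → ℝ}, ContDiffOn ℝ ∞ f N → ContDiffOn ℝ ∞ (along (e i) f) N := fun i _ hf =>
    contDiffOn_along hN (h.smooth i) hf
  have dα : ∀ k ∈ ({2, 3} : Set (Fin 5)), ∀ z ∈ N, along (e k) α z = -c k 4 z := by
    intro k hk z hz
    rw [hα, along_log (hd (h.smooth_coeff 0 1) z hz) (ha z hz), h.along_coeff₀₁ hmix hk hz]
    field_simp [ha z hz]
  have dγ : ∀ k ∈ ({0, 1} : Set (Fin 5)), ∀ z ∈ N, along (e k) γ z = -c k 4 z := by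
    intro k hk z hz
    rw [hγ, along_log (hd (h.smooth_coeff 2 3) z hz) (hc z hz), h.along_coeff₂₃ hmix hk hz]
    field_simp [hc z hz]
  have ddα : ∀ i, ∀ k ∈ ({2, 3} : Set (Fin 5)), ∀ z ∈ N,
      along (e i) (along (e k) α) z = -along (e i) (c k 4) z := by
    intro i k hk z hz
    rw [← along_neg]
    exact along_congr hN (dα k hk) hz
  have ddγ : ∀ i, ∀ k ∈ ({0, 1} : Set (Fin 5)), ∀ z ∈ N,
      along (e i) (along (e k) γ) z = -along (e i) (c k 4) z := by
    intro i k hk z hz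
    rw [← along_neg]
    exact along_congr hN (dγ k hk) hz
  -- The commutator of `e 2` and `e 3`, applied to `α`, produces `c 2 3` times the derivative of `α`
  -- along `e 4`. By `along_last` this is the derivative of `c 2 3` itself, so `α` and `γ` change
  -- equally along `e 4`.
  have d4 : ∀ z ∈ N, along (e 4) g z = 0 := by
    intro z hz
    have h1 := h.commutator 2 3 hαs hz
    rw [ddα 2 3 (by simp) z hz, ddα 3 2 (by simp) z hz] at h1
    have h2 := h.along_last 2 3 hz
    change along (e 4) (fun z => γ z - α z) z = 0
    rw [along_sub (hd hγs z hz) (hd hαs z hz), hγ,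
      along_log (hd (h.smooth_coeff 2 3) z hz) (hc z hz), sub_eq_zero,
      div_eq_iff (hc z hz), h2]
    linarith
  have di : ∀ i ∈ ({0, 1} : Set (Fin 5)), ∀ z ∈ N,
      along (e i) g z = -c i 4 z - along (e i) α z := by
    intro i hi z hz
    change along (e i) (fun z => γ z - α z) z = _
    rw [along_sub (hd hγs z hz) (hd hαs z hz), dγ i hi z hz]
  -- Fields from different blocks commute, so second derivatives may be exchanged; `along_last` for
  -- the vanishing coefficient `c i k` then makes the two logarithms cancel.
  have dd : ∀ i ∈ ({0, 1} : Set (Fin 5)), ∀ k ∈ ({2, 3} : Set (Fin 5)), ∀ z ∈ N,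
      along (e k) (along (e i) g) z = 0 := by
    intro i hi k hk z hz
    have h0 : ∀ z ∈ N, along (e i) g z = along (e i) γ z - along (e i) α z := fun z hz =>
      along_sub (hd hγs z hz) (hd hαs z hz)
    rw [along_congr hN h0 hz, along_sub (hd (hsm i hγs) z hz) (hd (hsm i hαs) z hz),
      ddγ k i hi z hz]
    have h1 := h.commutator k i hαs hz
    rw [ddα i k hk z hz, h.skew k i hz, hmix i hi k hk z hz] at h1
    have h2 := h.along_last i k hz
    rw [along_eq_zero_of_eqOn hN (hmix i hi k hk) hz] at h2
    linarith
  refine ⟨hgs, d4, fun i hi z hz => ?_, fun i hi k hk z hz => ?_⟩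
  · rw [di i hi z hz, hα, along_log (hd (h.smooth_coeff 0 1) z hz) (ha z hz)]
  · rcases hk with rfl | rfl | rfl
    · exact dd i hi 2 (by simp) z hz
    · exact dd i hi 3 (by simp) z hz
    -- Both `e 2` and `e 3` annihilate the derivative of `g` along `e i`, hence so does their
    -- bracket, a nonzero multiple of `e 4`.
    · have h1 := h.commutator 2 3 (hsm i hgs) hz
      rw [along_eq_zero_of_eqOn hN (dd i hi 3 (by simp)) hz,
        along_eq_zero_of_eqOn hN (dd i hi 2 (by simp)) hz, sub_self] at h1
      exact (mul_eq_zero.1 h1.symm).resolve_left (hc z hz)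

end IsContactFrame

end

end Backlund

/-! ### Normal form of the contact form -/

namespace Backlund

open Set Filter VectorField

section

variable {W : Type*} [NormedAddCommGroup W] [NormedSpace ℝ W]

theorem ed_add {α β : W → W →L[ℝ] ℝ} {z : W} (hα : DifferentiableAt ℝ α z)
    (hβ : DifferentiableAt ℝ β z) (v w : W) :
    ed (fun z => α z + β z) z v w = ed α z v w + ed β z v w := by
  simp only [ed_apply, fderiv_fun_add hα hβ, add_apply]
  ring

theorem ed_smul {f : W → ℝ} {α : W → W →L[ℝ] ℝ} {z : W} (hf : DifferentiableAt ℝ f z)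
    (hα : DifferentiableAt ℝ α z) (v w : W) :
    ed (fun z => f z • α z) z v w = f z * ed α z v w + wdg (fderiv ℝ f z) (α z) v w := by
  simp only [ed_apply, fderiv_fun_smul hf hα, wdg]
  simp
  ring

theorem ed_fderiv {f : W → ℝ} {z : W} (hf : ContDiffAt ℝ ∞ f z) (v w : W) :
    ed (fderiv ℝ f) z v w = 0 := by
  rw [ed_apply, (hf.isSymmSndFDerivAt minSmoothness_le_infty).eq v w, sub_self]

/-- Reduces closedness of a 1-form to finitely many structure equations, one for each pair of frame
vectors. -/
theorem eq_zero_of_skew_of_frame {n : ℕ} {α : Fin n → W →L[ℝ] ℝ} {e : Fin n → W}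
    {A : W →L[ℝ] W →L[ℝ] ℝ} (hinj : ∀ v, (∀ i, α i v = 0) → v = 0)
    (he : ∀ i j, α i (e j) = if i = j then 1 else 0) (hA : ∀ v w, A v w = -A w v)
    (h : ∀ i j, i < j → A (e i) (e j) = 0) (v w : W) : A v w = 0 := by
  have h' : ∀ i j, A (e i) (e j) = 0 := by
    intro i j
    rcases lt_trichotomy i j with hij | rfl | hij
    · exact h i j hij
    · have := hA (e i) (e i)
      linarith
    · rw [hA, h j i hij, neg_zero]
  rw [eq_sum_dualFrame hinj he v, eq_sum_dualFrame hinj he w]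
  simp [h']

/-- A closed 1-form has a smooth local potential. -/
theorem exists_potential {τ : W → W →L[ℝ] ℝ} {N : Set W} {z₀ : W} (hN : IsOpen N) (hz₀ : z₀ ∈ N)
    (hτ : ContDiffOn ℝ ∞ τ N) (hclosed : ∀ z ∈ N, ∀ v w, ed τ z v w = 0) :
    ∃ (N' : Set W) (f : W → ℝ), IsOpen N' ∧ z₀ ∈ N' ∧ N' ⊆ N ∧ ContDiffOn ℝ ∞ f N' ∧
      ∀ z ∈ N', HasFDerivAt f (τ z) z := by
  obtain ⟨r, hr, hrN⟩ := Metric.isOpen_iff.1 hN z₀ hz₀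
  obtain ⟨f, hf⟩ := (convex_ball z₀ r).exists_forall_hasFDerivAt_of_fderiv_symmetric
    Metric.isOpen_ball ((hτ.mono hrN).differentiableOn (by simp))
    (fun a ha x y => sub_eq_zero.1 (hclosed a (hrN ha) x y))
  refine ⟨Metric.ball z₀ r, f, Metric.isOpen_ball, Metric.mem_ball_self hr, hrN, ?_, hf⟩
  refine (contDiffOn_infty_iff_fderiv_of_isOpen Metric.isOpen_ball).2
    ⟨fun z hz => (hf z hz).differentiableAt.differentiableWithinAt, ?_⟩
  exact (hτ.mono hrN).congr fun z hz => (hf z hz).fderiv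

theorem contDiffOn_linearIsometryEquiv {Z G H : Type*} [NormedAddCommGroup Z]
    [NormedSpace ℝ Z] [NormedAddCommGroup G] [NormedSpace ℝ G] [NormedAddCommGroup H]
    [NormedSpace ℝ H] (L : G ≃ₗᵢ[ℝ] H) {f : Z → G} {N : Set Z} (hf : ContDiffOn ℝ ∞ f N) :
    ContDiffOn ℝ ∞ (fun z => L (f z)) N :=
  L.contDiff.comp_contDiffOn hf

/-- The normal form of a contact form whose differential splits along two pairs of functions. -/
theorem exists_normalForm {W : Type} [NormedAddCommGroup W] [NormedSpace ℝ W]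
    [FiniteDimensional ℝ W] (hW : Module.finrank ℝ W = 5) {U : Set W} (hU : IsOpen U) {m₀ : W}
    (hm₀ : m₀ ∈ U) {θ : W → W →L[ℝ] ℝ} (hθ : ContDiffOn ℝ ∞ θ U) {u v : W → ℝ × ℝ}
    (hu : ContDiffOn ℝ ∞ u U) (hv : ContDiffOn ℝ ∞ v U)
    (hinj : ∀ m ∈ U, ∀ x, θ m x = 0 → fderiv ℝ u m x = 0 → fderiv ℝ v m x = 0 → x = 0)
    (hmix : ∀ m ∈ U, ∀ x y, θ m x = 0 → θ m y = 0 → fderiv ℝ u m x = 0 → fderiv ℝ v m y = 0 →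
      ed θ m x y = 0)
    (hndu : ∀ m ∈ U, ∃ x y, θ m x = 0 ∧ θ m y = 0 ∧ fderiv ℝ v m x = 0 ∧ fderiv ℝ v m y = 0 ∧
      ed θ m x y ≠ 0)
    (hndv : ∀ m ∈ U, ∃ x y, θ m x = 0 ∧ θ m y = 0 ∧ fderiv ℝ u m x = 0 ∧ fderiv ℝ u m y = 0 ∧
      ed θ m x y ≠ 0) :
    ∃ (U' : Set W) (ρ z : W → ℝ) (F G : ℝ × ℝ → ℝ × ℝ) (μ ν : W → ℝ), IsOpen U' ∧ m₀ ∈ U' ∧ U' ⊆ U ∧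
      ContDiff ℝ ∞ F ∧ ContDiff ℝ ∞ G ∧ ContDiffOn ℝ ∞ z U' ∧
      ∀ m ∈ U', ρ m ≠ 0 ∧ μ m ≠ 0 ∧ ν m ≠ 0 ∧
        (∀ a b, area (fderiv ℝ F (u m) a) (fderiv ℝ F (u m) b) = μ m * area a b) ∧
        (∀ a b, area (fderiv ℝ G (v m) a) (fderiv ℝ G (v m) b) = ν m * area a b) ∧
        (∀ x, fderiv ℝ z m x = ρ m * θ m x + (F (u m)).2 * (fderiv ℝ F (u m) (fderiv ℝ u m x)).1 +
          (G (v m)).2 * (fderiv ℝ G (v m) (fderiv ℝ v m x)).1) ∧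
        ∀ x y, θ m x = 0 → θ m y = 0 → ρ m * ed θ m x y =
          μ m * area (fderiv ℝ u m x) (fderiv ℝ u m y) +
          ν m * area (fderiv ℝ v m x) (fderiv ℝ v m y) := by
  have hd : ∀ {H : Type} [NormedAddCommGroup H] [NormedSpace ℝ H] {f : W → H},
      ContDiffOn ℝ ∞ f U → ∀ z ∈ U, DifferentiableAt ℝ f z := fun hf z hz =>
    ContDiffOn.differentiableAt_of_isOpen hf hU hz
  set Du : W → W →L[ℝ] ℝ × ℝ := fderiv ℝ u with hDu
  set Dv : W → W →L[ℝ] ℝ × ℝ := fderiv ℝ v with hDv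
  have hDus : ContDiffOn ℝ ∞ Du U := hu.fderiv_of_isOpen hU (by simp)
  have hDvs : ContDiffOn ℝ ∞ Dv U := hv.fderiv_of_isOpen hU (by simp)
  set fst := ContinuousLinearMap.fst ℝ ℝ ℝ with hfst
  set snd := ContinuousLinearMap.snd ℝ ℝ ℝ with hsnd
  -- In the frame dual to (du, dv, θ) the forms du and dv have constant values. They therefore
  -- annihilate all brackets, which leaves only multiples of the last field, with coefficients
  -- -dθ(eᵢ, eⱼ).
  set α : Fin 5 → W → W →L[ℝ] ℝ := ![fun m => fst.comp (Du m), fun m => snd.comp (Du m),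
    fun m => fst.comp (Dv m), fun m => snd.comp (Dv m), θ] with hα
  have hαinj : ∀ m ∈ U, ∀ x, (∀ i, α i m x = 0) → x = 0 := fun m hm x hx =>
    hinj m hm x (hx 4) (Prod.ext (hx 0) (hx 1)) (Prod.ext (hx 2) (hx 3))
  obtain ⟨e, hes, he⟩ := exists_dualFrame hW (α := α) (N := U) (by
    intro i
    fin_cases i
    exacts [contDiffOn_const.clm_comp hDus, contDiffOn_const.clm_comp hDus,
      contDiffOn_const.clm_comp hDvs, contDiffOn_const.clm_comp hDvs, hθ]) hαinj
  have hue : ∀ m ∈ U, ∀ i, Du m (e i m) = ![(1, 0), (0, 1), 0, 0, 0] i := by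
    intro m hm i
    have h0 : (Du m (e i m)).1 = _ := he m hm 0 i
    have h1 : (Du m (e i m)).2 = _ := he m hm 1 i
    ext
    · rw [h0]; fin_cases i <;> simp
    · rw [h1]; fin_cases i <;> simp
  have hve : ∀ m ∈ U, ∀ i, Dv m (e i m) = ![0, 0, (1, 0), (0, 1), 0] i := by
    intro m hm i
    have h0 : (Dv m (e i m)).1 = _ := he m hm 2 i
    have h1 : (Dv m (e i m)).2 = _ := he m hm 3 i
    ext
    · rw [h0]; fin_cases i <;> simp
    · rw [h1]; fin_cases i <;> simp
  have hθe : ∀ m ∈ U, ∀ i, θ m (e i m) = if 4 = i then 1 else 0 := fun m hm i => he m hm 4 i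
  have hspan : ∀ m ∈ U, ∀ x, x = (Du m x).1 • e 0 m + (Du m x).2 • e 1 m + (Dv m x).1 • e 2 m +
      (Dv m x).2 • e 3 m + θ m x • e 4 m := by
    intro m hm x
    have := eq_sum_dualFrame (α := fun i => α i m) (e := fun i => e i m) (hαinj m hm) (he m hm) x
    simpa [Fin.sum_univ_five, hα, hfst, hsnd] using this
  -- the structure functions
  set c : Fin 5 → Fin 5 → W → ℝ := fun i j m => -ed θ m (e i m) (e j m) with hc
  have hbr0 : ∀ {H : Type} [NormedAddCommGroup H] [NormedSpace ℝ H] {f : W → H},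
      ContDiffOn ℝ ∞ f U → ∀ i j, (∀ k, ∃ a : H, ∀ m ∈ U, fderiv ℝ f m (e k m) = a) → ∀ m ∈ U,
      fderiv ℝ f m (lieBracket ℝ (e i) (e j) m) = 0 := by
    intro H _ _ f hf i j hk m hm
    have hz : ∀ i j, fderiv ℝ (fun x => fderiv ℝ f x (e i x)) m (e j m) = 0 := by
      intro i j
      obtain ⟨a, ha⟩ := hk i
      have : HasFDerivAt (fun x => fderiv ℝ f x (e i x)) (0 : W →L[ℝ] H) m :=
        (hasFDerivAt_const a m).congr_of_eventuallyEq (eventually_mem_isOpen hU hm ha)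
      rw [this.fderiv]
      rfl
    rw [fderiv_apply_lieBracket (hf.contDiffAt (hU.mem_nhds hm)) minSmoothness_le_infty
      (ContDiffOn.differentiableAt_of_isOpen (hes j) hU hm)
      (ContDiffOn.differentiableAt_of_isOpen (hes i) hU hm), hz, hz, sub_self]
  have hedθ : ContDiffOn ℝ ∞ (ed θ) U := by
    have h1 : ContDiffOn ℝ ∞ (fderiv ℝ θ) U := hθ.fderiv_of_isOpen hU (by simp)
    have h2 : ContDiffOn ℝ ∞ (fun z => (fderiv ℝ θ z).flip) U :=
      contDiffOn_linearIsometryEquiv (G := W →L[ℝ] W →L[ℝ] ℝ) (H := W →L[ℝ] W →L[ℝ] ℝ)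
        (ContinuousLinearMap.flipₗᵢ ℝ W W ℝ) h1
    exact h1.sub h2
  have hframe : IsContactFrame U e c := by
    refine ⟨hU, hes, fun i j => ((hedθ.clm_apply (hes i)).clm_apply (hes j)).neg, ?_, ?_⟩
    · intro z hz h0
      have := hθe z hz 4
      simp [h0] at this
    · intro i j z hz
      have h1 := ed_eq_neg_lieBracket (ContDiffOn.differentiableAt_of_isOpen hθ hU hz)
        (ContDiffOn.differentiableAt_of_isOpen (hes i) hU hz)
        (ContDiffOn.differentiableAt_of_isOpen (hes j) hU hz)
        (eventually_mem_isOpen hU hz fun z hz => hθe z hz i)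
        (eventually_mem_isOpen hU hz fun z hz => hθe z hz j)
      have h2 := hspan z hz (lieBracket ℝ (e i) (e j) z)
      rw [hbr0 hu i j (fun k => ⟨_, fun m hm => hue m hm k⟩) z hz,
        hbr0 hv i j (fun k => ⟨_, fun m hm => hve m hm k⟩) z hz] at h2
      rw [h2, hc]
      simp [h1]
  have hcmix : ∀ i ∈ ({0, 1} : Set (Fin 5)), ∀ k ∈ ({2, 3} : Set (Fin 5)), ∀ z ∈ U, c i k z = 0 := by
    rintro i hi k hk z hz
    have h0 : ed θ z (e k z) (e i z) = 0 := by
      refine hmix z hz _ _ ?_ ?_ ?_ ?_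
      · rw [hθe z hz]; rcases hk with rfl | rfl <;> simp
      · rw [hθe z hz]; rcases hi with rfl | rfl <;> simp
      · exact (hue z hz k).trans (by rcases hk with rfl | rfl <;> rfl)
      · exact (hve z hz i).trans (by rcases hi with rfl | rfl <;> rfl)
    rw [hc]
    dsimp only
    rw [ed_swap, h0]
    simp
  have ha : ∀ z ∈ U, c 0 1 z ≠ 0 := by
    intro z hz h0
    obtain ⟨x, y, hx, hy, hx', hy', hxy⟩ := hndu z hz
    have h1 := hspan z hz x
    have h2 := hspan z hz y
    rw [hx, hx'] at h1
    rw [hy, hy'] at h2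
    have h3 : ed θ z (e 0 z) (e 1 z) = 0 := neg_eq_zero.1 h0
    have h4 := h3
    rw [ed_swap, neg_eq_zero] at h4
    apply hxy
    rw [h1, h2]
    simp [ed_self, h3, h4]
  have hcc : ∀ z ∈ U, c 2 3 z ≠ 0 := by
    intro z hz h0
    obtain ⟨x, y, hx, hy, hx', hy', hxy⟩ := hndv z hz
    have h1 := hspan z hz x
    have h2 := hspan z hz y
    rw [hx, hx'] at h1
    rw [hy, hy'] at h2
    have h3 : ed θ z (e 2 z) (e 3 z) = 0 := neg_eq_zero.1 h0
    have h4 := h3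
    rw [ed_swap, neg_eq_zero] at h4
    apply hxy
    rw [h1, h2]
    simp [ed_self, h3, h4]
  obtain ⟨hg, g4, gi, gk⟩ := hframe.along_log_ratio hcmix ha hcc
  set g := fun z => Real.log (c 2 3 z) - Real.log (c 0 1 z) with hgdef
  -- the potential of the part of `dg` along the first pair of functions
  have hu0 : ContDiffOn ℝ ∞ (fun m => (u m).1) U := hu.fst
  have hu1 : ContDiffOn ℝ ∞ (fun m => (u m).2) U := hu.snd
  have hDu0 : ∀ m ∈ U, ∀ x, fderiv ℝ (fun m => (u m).1) m x = (Du m x).1 := fun m hm x => by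
    rw [((hd hu m hm).hasFDerivAt.fst).fderiv]; rfl
  have hDu1 : ∀ m ∈ U, ∀ x, fderiv ℝ (fun m => (u m).2) m x = (Du m x).2 := fun m hm x => by
    rw [((hd hu m hm).hasFDerivAt.snd).fderiv]; rfl
  have hal : ∀ i, ContDiffOn ℝ ∞ (along (e i) g) U := fun i => contDiffOn_along hU (hes i) hg
  have hd0 : ∀ {f : W → ℝ}, ContDiffOn ℝ ∞ f U → ContDiffOn ℝ ∞ (fderiv ℝ f) U := fun hf =>
    hf.fderiv_of_isOpen hU (by simp)
  obtain ⟨N₁, B, hN₁, hm₁, hN₁U, hBs, hB⟩ := exists_potential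
    (τ := fun m => along (e 0) g m • fderiv ℝ (fun m => (u m).1) m +
      along (e 1) g m • fderiv ℝ (fun m => (u m).2) m) hU hm₀
    (((hal 0).smul (hd0 hu0)).add ((hal 1).smul (hd0 hu1))) (by
      intro m hm
      refine eq_zero_of_skew_of_frame (hαinj m hm) (he m hm) (fun _ _ => ed_swap _ _ _ _) ?_
      intro i j hij
      rw [ed_add ((hd (hal 0) m hm).fun_smul (hd (hd0 hu0) m hm))
        ((hd (hal 1) m hm).fun_smul (hd (hd0 hu1) m hm)), ed_smul (hd (hal 0) m hm) (hd (hd0 hu0) m hm),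
        ed_smul (hd (hal 1) m hm) (hd (hd0 hu1) m hm), ed_fderiv (hu0.contDiffAt (hU.mem_nhds hm)),
        ed_fderiv (hu1.contDiffAt (hU.mem_nhds hm))]
      simp only [wdg, hDu0 m hm, hDu1 m hm, hue m hm]
      -- On `(e 0, e 1)` closedness is the commutator identity, since `g` is constant along `e 4`;
      -- every other pair is covered by the splitting of `g`.
      have h01 := hframe.commutator 0 1 hg hm
      rw [g4 m hm, mul_zero, sub_eq_zero] at h01
      have hk : ∀ i ∈ ({0, 1} : Set (Fin 5)), ∀ k ∈ ({2, 3, 4} : Set (Fin 5)),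
        fderiv ℝ (along (e i) g) m (e k m) = 0 := fun i hi k hk => gk i hi k hk m hm
      change fderiv ℝ (along (e 1) g) m (e 0 m) = fderiv ℝ (along (e 0) g) m (e 1 m) at h01
      fin_cases i <;> fin_cases j <;> simp at hij ⊢ <;> simp [hk, h01])
  have hBe : ∀ m ∈ N₁, ∀ x, fderiv ℝ B m x = along (e 0) g m * (Du m x).1 +
      along (e 1) g m * (Du m x).2 := fun m hm x => by
    rw [(hB m hm).fderiv]
    simp [hDu0 m (hN₁U hm), hDu1 m (hN₁U hm)]
  have hBd : ∀ m ∈ N₁, DifferentiableAt ℝ B m := fun m hm => (hB m hm).differentiableAt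
  -- the conformal factor
  set E := fun m => Real.exp (-B m) with hE
  have hEs : ContDiffOn ℝ ∞ E N₁ := hBs.neg.exp
  -- `B` carries the dependence of `g` on u. With this factor `ρ * c 0 1 = exp (-B)` depends on u
  -- alone, and `ρ * c 2 3`, of absolute value `exp (g - B)`, depends on v alone.
  set ρ := fun m => E m / c 0 1 m with hρ
  have hρs : ContDiffOn ℝ ∞ ρ N₁ := hEs.div ((hframe.smooth_coeff 0 1).mono hN₁U)
    fun m hm => ha m (hN₁U hm)
  have hρ0 : ∀ m ∈ N₁, ρ m ≠ 0 := fun m hm => div_ne_zero (Real.exp_pos _).ne' (ha m (hN₁U hm))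
  have hρa : ∀ m ∈ N₁, ρ m * c 0 1 m = E m := fun m hm => div_mul_cancel₀ _ (ha m (hN₁U hm))
  set Q := fun m => ρ m * c 2 3 m with hQ
  have hQs : ContDiffOn ℝ ∞ Q N₁ := hρs.mul ((hframe.smooth_coeff 2 3).mono hN₁U)
  have hQ0 : ∀ m ∈ N₁, Q m ≠ 0 := fun m hm => mul_ne_zero (hρ0 m hm) (hcc m (hN₁U hm))
  have hlogρ : ∀ m ∈ N₁, Real.log (ρ m) = -B m - Real.log (c 0 1 m) := fun m hm => by
    rw [hρ, Real.log_div (Real.exp_pos _).ne' (ha m (hN₁U hm)), Real.log_exp]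
  have hlogQ : ∀ m ∈ N₁, Real.log (Q m) = g m - B m := fun m hm => by
    rw [hQ, Real.log_mul (hρ0 m hm) (hcc m (hN₁U hm)), hlogρ m hm, hgdef]
    ring
  have hd1 : ∀ {H : Type} [NormedAddCommGroup H] [NormedSpace ℝ H] {f : W → H},
      ContDiffOn ℝ ∞ f N₁ → ∀ z ∈ N₁, DifferentiableAt ℝ f z := fun hf z hz =>
    ContDiffOn.differentiableAt_of_isOpen hf hN₁ hz
  have hdc : ∀ i j, ∀ z ∈ U, DifferentiableAt ℝ (c i j) z := fun i j z hz =>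
    hd (hframe.smooth_coeff i j) z hz
  have hBal : ∀ i, ∀ m ∈ N₁, along (e i) B m = ![along (e 0) g m, along (e 1) g m, 0, 0, 0] i := by
    intro i m hm
    rw [along, hBe m hm, hue m (hN₁U hm)]
    fin_cases i <;> simp
  -- These are the equations saying that d(ρθ) has no component along θ.
  have hρal : ∀ i : Fin 5, i ≠ 4 → ∀ m ∈ N₁, along (e i) ρ m = ρ m * c i 4 m := by
    intro i hi m hm
    have hm' := hN₁U hm
    have h1 := along_log (X := e i) (hd1 hρs m hm) (hρ0 m hm)
    rw [along_congr hN₁ hlogρ hm, along_sub (hBd m hm).fun_neg ((hdc 0 1 m hm').log (ha m hm')),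
      along_neg, along_log (hdc 0 1 m hm') (ha m hm'), hBal i m hm] at h1
    rw [eq_div_iff (hρ0 m hm)] at h1
    rw [← h1, mul_comm]
    congr 1
    have e0 := gi 0 (by simp) m hm'
    have e1 := gi 1 (by simp) m hm'
    have e2 := hframe.along_coeff₀₁ hcmix (k := 2) (by simp) hm'
    have e3 := hframe.along_coeff₀₁ hcmix (k := 3) (by simp) hm'
    have hne := ha m hm'
    fin_cases i
    · simp [e0]
    · simp [e1]
    · simp; field_simp; linarith
    · simp; field_simp; linarith
    · exact absurd rfl hi
  have hQal : ∀ i ∈ ({0, 1, 4} : Set (Fin 5)), ∀ m ∈ N₁, along (e i) Q m = 0 := by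
    intro i hi m hm
    have hm' := hN₁U hm
    have h1 := along_log (X := e i) (hd1 hQs m hm) (hQ0 m hm)
    rw [along_congr hN₁ hlogQ hm, along_sub (hd hg m hm') (hBd m hm), hBal i m hm] at h1
    rw [eq_comm, div_eq_iff (hQ0 m hm)] at h1
    rw [h1]
    rcases hi with rfl | rfl | rfl <;> simp [g4 m hm']
  have hsurj_u : Function.Surjective (fderiv ℝ u m₀) := fun a =>
    ⟨a.1 • e 0 m₀ + a.2 • e 1 m₀, by
      change Du m₀ _ = _
      rw [map_add, map_smul, map_smul, hue m₀ hm₀, hue m₀ hm₀]; simp⟩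
  have hsurj_v : Function.Surjective (fderiv ℝ v m₀) := fun a =>
    ⟨a.1 • e 2 m₀ + a.2 • e 3 m₀, by
      change Dv m₀ _ = _
      rw [map_add, map_smul, map_smul, hve m₀ hm₀, hve m₀ hm₀]; simp⟩
  -- the two densities descend to the plane
  obtain ⟨N₂, U₂, β, hN₂, hm₂, hN₂₁, hU₂, hmaps₂, hβ, hβu⟩ := exists_descent hN₁ hm₁
    (hu.mono hN₁U) hBs hsurj_u (by
      intro m hm x hx
      change Du m x = 0 at hx
      rw [hBe m hm, hx]
      simp)
  obtain ⟨N₃, U₃, q, hN₃, hm₃, hN₃₁, hU₃, hmaps₃, hq, hqv⟩ := exists_descent hN₁ hm₁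
    (hv.mono hN₁U) hQs hsurj_v (by
      intro m hm x hx
      have hx' := hspan m (hN₁U hm) x
      change Dv m x = 0 at hx
      have q0 : fderiv ℝ Q m (e 0 m) = 0 := hQal 0 (by simp) m hm
      have q1 : fderiv ℝ Q m (e 1 m) = 0 := hQal 1 (by simp) m hm
      have q4 : fderiv ℝ Q m (e 4 m) = 0 := hQal 4 (by simp) m hm
      rw [hx', hx]
      simp [q0, q1, q4])
  -- The Jacobian is negative to match signs. The differential of F₂dF₁ is minus the pulled-back
  -- area form, hence exp(-B) du₁∧du₂, and dθ(eᵢ, eⱼ) = -c i j; the two contributions to the closed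
  -- form cancel.
  obtain ⟨F, U₂', hF, hU₂', hmU₂', hU₂₂, hFa⟩ := exists_area_eq hU₂ (hmaps₂ hm₂)
    (μ := fun a => -Real.exp (-β a)) hβ.neg.exp.neg
  obtain ⟨G, U₃', hG, hU₃', hmU₃', hU₃₃, hGa⟩ := exists_area_eq hU₃ (hmaps₃ hm₃)
    (μ := fun a => -q a) hq.neg
  set N₄ : Set W := (U ∩ u ⁻¹' U₂') ∩ (U ∩ v ⁻¹' U₃') ∩ (N₂ ∩ N₃) with hN₄def
  have hN₄ : IsOpen N₄ := ((hu.continuousOn.isOpen_inter_preimage hU hU₂').inter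
    (hv.continuousOn.isOpen_inter_preimage hU hU₃')).inter (hN₂.inter hN₃)
  have hm₄ : m₀ ∈ N₄ := ⟨⟨⟨hm₀, hmU₂'⟩, ⟨hm₀, hmU₃'⟩⟩, hm₂, hm₃⟩
  have hN₄₁ : N₄ ⊆ N₁ := fun m hm => hN₂₁ hm.2.1
  have hN₄U : N₄ ⊆ U := fun m hm => hm.1.1.1
  have hd4 : ∀ {H : Type} [NormedAddCommGroup H] [NormedSpace ℝ H] {f : W → H},
      ContDiffOn ℝ ∞ f N₄ → ∀ z ∈ N₄, DifferentiableAt ℝ f z := fun hf z hz =>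
    ContDiffOn.differentiableAt_of_isOpen hf hN₄ hz
  have hFu : ContDiffOn ℝ ∞ (fun m => F (u m)) N₄ := hF.comp_contDiffOn (hu.mono hN₄U)
  have hGv : ContDiffOn ℝ ∞ (fun m => G (v m)) N₄ := hG.comp_contDiffOn (hv.mono hN₄U)
  have hFud : ∀ m ∈ N₄, HasFDerivAt (fun m => F (u m)) ((fderiv ℝ F (u m)).comp (Du m)) m :=
    fun m hm => (hF.differentiable (by simp) _).hasFDerivAt.comp m (hd hu m (hN₄U hm)).hasFDerivAt
  have hGvd : ∀ m ∈ N₄, HasFDerivAt (fun m => G (v m)) ((fderiv ℝ G (v m)).comp (Dv m)) m :=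
    fun m hm => (hG.differentiable (by simp) _).hasFDerivAt.comp m (hd hv m (hN₄U hm)).hasFDerivAt
  have hF1 : ∀ m ∈ N₄, ∀ x, fderiv ℝ (fun m => (F (u m)).1) m x = (fderiv ℝ F (u m) (Du m x)).1 :=
    fun m hm x => by rw [(hFud m hm).fst.fderiv]; rfl
  have hF2 : ∀ m ∈ N₄, ∀ x, fderiv ℝ (fun m => (F (u m)).2) m x = (fderiv ℝ F (u m) (Du m x)).2 :=
    fun m hm x => by rw [(hFud m hm).snd.fderiv]; rfl
  have hG1 : ∀ m ∈ N₄, ∀ x, fderiv ℝ (fun m => (G (v m)).1) m x = (fderiv ℝ G (v m) (Dv m x)).1 :=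
    fun m hm x => by rw [(hGvd m hm).fst.fderiv]; rfl
  have hG2 : ∀ m ∈ N₄, ∀ x, fderiv ℝ (fun m => (G (v m)).2) m x = (fderiv ℝ G (v m) (Dv m x)).2 :=
    fun m hm x => by rw [(hGvd m hm).snd.fderiv]; rfl
  have hd4' : ∀ {f : W → ℝ}, ContDiffOn ℝ ∞ f N₄ → ContDiffOn ℝ ∞ (fderiv ℝ f) N₄ := fun hf =>
    hf.fderiv_of_isOpen hN₄ (by simp)
  have sX := hd4' hFu.fst
  have sY := hd4' hGv.fst
  have sρθ : ContDiffOn ℝ ∞ (fun m => ρ m • θ m) N₄ := (hρs.mono hN₄₁).smul (hθ.mono hN₄U)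
  have sPX : ContDiffOn ℝ ∞ (fun m => (F (u m)).2 • fderiv ℝ (fun m => (F (u m)).1) m) N₄ :=
    hFu.snd.smul sX
  have sQY : ContDiffOn ℝ ∞ (fun m => (G (v m)).2 • fderiv ℝ (fun m => (G (v m)).1) m) N₄ :=
    hGv.snd.smul sY
  have hedτ : ∀ m ∈ N₄, ∀ x y, ed (fun m => ρ m • θ m +
      (F (u m)).2 • fderiv ℝ (fun m => (F (u m)).1) m +
      (G (v m)).2 • fderiv ℝ (fun m => (G (v m)).1) m) m x y =
      ρ m * ed θ m x y + wdg (fderiv ℝ ρ m) (θ m) x y + E m * area (Du m x) (Du m y) +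
        Q m * area (Dv m x) (Dv m y) := by
    intro m hm x y
    have hFE : ∀ a b, area (fderiv ℝ F (u m) a) (fderiv ℝ F (u m) b) = -E m * area a b := by
      intro a b
      rw [hFa _ hm.1.1.2, ← hβu m hm.2.1]
    have hGQ : ∀ a b, area (fderiv ℝ G (v m) a) (fderiv ℝ G (v m) b) = -Q m * area a b := by
      intro a b
      rw [hGa _ hm.1.2.2, ← hqv m hm.2.2]
    have k1 := hFE (Du m x) (Du m y)
    have k2 := hGQ (Dv m x) (Dv m y)
    rw [ed_add ((hd4 sρθ m hm).fun_add (hd4 sPX m hm)) (hd4 sQY m hm), ed_add (hd4 sρθ m hm) (hd4 sPX m hm),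
      ed_smul (hd1 hρs m (hN₄₁ hm)) (hd hθ m (hN₄U hm)),
      ed_smul (hd4 hFu.snd m hm) (hd4 sX m hm), ed_smul (hd4 hGv.snd m hm) (hd4 sY m hm),
      ed_fderiv (hFu.fst.contDiffAt (hN₄.mem_nhds hm)),
      ed_fderiv (hGv.fst.contDiffAt (hN₄.mem_nhds hm))]
    simp only [wdg, hF1 m hm, hF2 m hm, hG1 m hm, hG2 m hm]
    simp only [area] at k1 k2 ⊢
    linarith
  have hclosed : ∀ m ∈ N₄, ∀ x y, ed (fun m => ρ m • θ m +
      (F (u m)).2 • fderiv ℝ (fun m => (F (u m)).1) m +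
      (G (v m)).2 • fderiv ℝ (fun m => (G (v m)).1) m) m x y = 0 := by
    intro m hm
    have hm1 := hN₄₁ hm
    have hmU := hN₄U hm
    refine eq_zero_of_skew_of_frame (hαinj m hmU) (he m hmU) (fun _ _ => ed_swap _ _ _ _) ?_
    intro i j hij
    rw [hedτ m hm]
    have hcd : ∀ i j, ed θ m (e i m) (e j m) = -c i j m := fun i j => (neg_neg _).symm
    rw [hcd, hue m hmU, hue m hmU, hve m hmU, hve m hmU]
    simp only [wdg, hθe m hmU]
    have ρ0 : fderiv ℝ ρ m (e 0 m) = ρ m * c 0 4 m := hρal 0 (by decide) m hm1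
    have ρ1 : fderiv ℝ ρ m (e 1 m) = ρ m * c 1 4 m := hρal 1 (by decide) m hm1
    have ρ2 : fderiv ℝ ρ m (e 2 m) = ρ m * c 2 4 m := hρal 2 (by decide) m hm1
    have ρ3 : fderiv ℝ ρ m (e 3 m) = ρ m * c 3 4 m := hρal 3 (by decide) m hm1
    have z1 := hρa m hm1
    have z2 : ρ m * c 2 3 m = Q m := rfl
    have z02 := hcmix 0 (by simp) 2 (by simp) m hmU
    have z03 := hcmix 0 (by simp) 3 (by simp) m hmU
    have z12 := hcmix 1 (by simp) 2 (by simp) m hmU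
    have z13 := hcmix 1 (by simp) 3 (by simp) m hmU
    clear_value ρ Q E c
    fin_cases i <;> fin_cases j <;> simp [area] at hij ⊢ <;>
      simp [ρ0, ρ1, ρ2, ρ3, z1, z2, z02, z03, z12, z13]
  obtain ⟨N₅, z, hN₅, hm₅, hN₅₄, hzs, hz⟩ := exists_potential hN₄ hm₄ ((sρθ.add sPX).add sQY)
    hclosed
  refine ⟨N₅, ρ, z, F, G, fun m => -E m, fun m => -Q m, hN₅, hm₅, hN₅₄.trans hN₄U, hF, hG, hzs,
    fun m hm => ?_⟩
  have hm4 := hN₅₄ hm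
  refine ⟨hρ0 m (hN₄₁ hm4), neg_ne_zero.2 (Real.exp_pos _).ne', neg_ne_zero.2 (hQ0 m (hN₄₁ hm4)),
    fun a b => by rw [hFa _ hm4.1.1.2, ← hβu m hm4.2.1], fun a b => by
      rw [hGa _ hm4.1.2.2, ← hqv m hm4.2.2], fun x => ?_, fun x y hx hy => ?_⟩
  · rw [(hz m hm).fderiv]
    simp [hF1 m hm4, hG1 m hm4, hDu, hDv]
  · have h1 := hclosed m hm4 x y
    rw [hedτ m hm4] at h1
    simp only [wdg, hx, hy] at h1
    change ρ m * ed θ m x y = -E m * area (Du m x) (Du m y) + -Q m * area (Dv m x) (Dv m y)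
    linarith

end

end Backlund

/-! ### Wave coordinates from the normal form -/

namespace Backlund

open Set Filter

theorem area_map (L : ℝ × ℝ →L[ℝ] ℝ × ℝ) (a b : ℝ × ℝ) : area (L a) (L b) = L.det * area a b := by
  have hL : ∀ c : ℝ × ℝ, L c = c.1 • L (1, 0) + c.2 • L (0, 1) := fun c => by
    rw [← map_smul, ← map_smul, ← map_add]
    simp
  have hdet : L.det = area (L (1, 0)) (L (0, 1)) := by
    rw [ContinuousLinearMap.det, ← LinearMap.det_toMatrix (Module.Basis.finTwoProd ℝ),
      Matrix.det_fin_two]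
    simp [LinearMap.toMatrix_apply, area]
    ring
  rw [hdet, hL a, hL b]
  simp [area]
  ring

theorem eq_zero_of_area_map {L : ℝ × ℝ →L[ℝ] ℝ × ℝ} {μ : ℝ} (hμ : μ ≠ 0)
    (h : ∀ a b, area (L a) (L b) = μ * area a b) {a : ℝ × ℝ} (ha : L a = 0) : a = 0 := by
  -- Paired with its rotation by a right angle, `a` spans the area a₁² + a₂².
  have h1 := h a (-a.2, a.1)
  rw [ha] at h1
  have h2 : a.1 * a.1 + a.2 * a.2 = 0 := by
    have : area a (-a.2, a.1) = a.1 * a.1 + a.2 * a.2 := by simp [area]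
    rw [← this]
    refine (mul_eq_zero.1 (h1.symm.trans ?_)).resolve_left hμ
    simp [area]
  have h3 := mul_self_nonneg a.1
  have h4 := mul_self_nonneg a.2
  exact Prod.ext (mul_self_eq_zero.1 (by linarith)) (mul_self_eq_zero.1 (by linarith))

theorem exists_equiv_of_injective {V W : Type*} [NormedAddCommGroup V] [NormedSpace ℝ V]
    [FiniteDimensional ℝ V] [NormedAddCommGroup W] [NormedSpace ℝ W] [FiniteDimensional ℝ W]
    (hd : Module.finrank ℝ V = Module.finrank ℝ W) {L : V →L[ℝ] W} (hL : ∀ v, L v = 0 → v = 0) :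
    ∃ L' : V ≃L[ℝ] W, (L' : V →L[ℝ] W) = L := by
  have : CompleteSpace V := FiniteDimensional.complete ℝ V
  have : CompleteSpace W := FiniteDimensional.complete ℝ W
  have hi : Function.Injective L := (injective_iff_map_eq_zero L).2 hL
  exact exists_equiv_of_bijective ⟨hi, (LinearMap.injective_iff_surjective_of_finrank_eq_finrank
    (f := L.toLinearMap) hd).1 hi⟩

theorem dcoord_apply (i : Fin 5) (x : E 5) : dcoord i ![x] = x i := rfl

theorem waveContact_apply (m x : E 5) :
    waveContact m ![x] = x 2 - m 3 * x 0 - m 4 * x 1 := by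
  simp [waveContact, dcoord_apply]

theorem fderiv_coord {V : Type*} [NormedAddCommGroup V] [NormedSpace ℝ V] {n : ℕ} {Φ : V → E n}
    {m : V} (h : DifferentiableAt ℝ Φ m) (i : Fin n) (x : V) :
    fderiv ℝ Φ m x i = fderiv ℝ (fun m => Φ m i) m x := by
  have h1 : HasFDerivAt (fun m => Φ m i) _ m :=
    (EuclideanSpace.proj i : E n →L[ℝ] ℝ).hasFDerivAt.comp m h.hasFDerivAt
  rw [h1.fderiv]
  rfl

/-- Wave coordinates for a contact form whose differential splits along two pairs of functions. -/
theorem exists_waveChart {U : Set (E 5)} (hU : IsOpen U) {m₀ : E 5}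
    (hm₀ : m₀ ∈ U) {θ : E 5 → E 5 →L[ℝ] ℝ} (hθ : ContDiffOn ℝ ∞ θ U) {u v : E 5 → ℝ × ℝ}
    (hu : ContDiffOn ℝ ∞ u U) (hv : ContDiffOn ℝ ∞ v U)
    (hinj : ∀ m ∈ U, ∀ x, θ m x = 0 → fderiv ℝ u m x = 0 → fderiv ℝ v m x = 0 → x = 0)
    (hmix : ∀ m ∈ U, ∀ x y, θ m x = 0 → θ m y = 0 → fderiv ℝ u m x = 0 → fderiv ℝ v m y = 0 →
      ed θ m x y = 0)
    (hndu : ∀ m ∈ U, ∃ x y, θ m x = 0 ∧ θ m y = 0 ∧ fderiv ℝ v m x = 0 ∧ fderiv ℝ v m y = 0 ∧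
      ed θ m x y ≠ 0)
    (hndv : ∀ m ∈ U, ∃ x y, θ m x = 0 ∧ θ m y = 0 ∧ fderiv ℝ u m x = 0 ∧ fderiv ℝ u m y = 0 ∧
      ed θ m x y ≠ 0) :
    ∃ (φ : OpenPartialHomeomorph (E 5) (E 5)) (ρ : E 5 → ℝ) (F G : ℝ × ℝ → ℝ × ℝ)
      (μ ν : E 5 → ℝ), m₀ ∈ φ.source ∧ φ.source ⊆ U ∧ ContDiffOn ℝ ∞ φ φ.source ∧
      ContDiffOn ℝ ∞ φ.symm φ.target ∧ ContDiff ℝ ∞ F ∧ ContDiff ℝ ∞ G ∧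
      ∀ m ∈ φ.source, ρ m ≠ 0 ∧ μ m ≠ 0 ∧ ν m ≠ 0 ∧
        (∀ a b, area (fderiv ℝ F (u m) a) (fderiv ℝ F (u m) b) = μ m * area a b) ∧
        (∀ a b, area (fderiv ℝ G (v m) a) (fderiv ℝ G (v m) b) = ν m * area a b) ∧
        xp (φ m) = F (u m) ∧ yq (φ m) = G (v m) ∧
        (∀ x, xp (fderiv ℝ φ m x) = fderiv ℝ F (u m) (fderiv ℝ u m x) ∧
          yq (fderiv ℝ φ m x) = fderiv ℝ G (v m) (fderiv ℝ v m x) ∧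
          waveContact (φ m) ![fderiv ℝ φ m x] = ρ m * θ m x) ∧
        ∀ x y, θ m x = 0 → θ m y = 0 → ρ m * ed θ m x y =
          μ m * area (fderiv ℝ u m x) (fderiv ℝ u m y) +
          ν m * area (fderiv ℝ v m x) (fderiv ℝ v m y) := by
  obtain ⟨U', ρ, z, F, G, μ, ν, hU', hm', hsub, hF, hG, hz, h⟩ :=
    exists_normalForm (by simp) hU hm₀ hθ hu hv hinj hmix hndu hndv
  have hFu : ContDiffOn ℝ ∞ (fun m => F (u m)) U' := hF.comp_contDiffOn (hu.mono hsub)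
  have hGv : ContDiffOn ℝ ∞ (fun m => G (v m)) U' := hG.comp_contDiffOn (hv.mono hsub)
  have hFud : ∀ m ∈ U', HasFDerivAt (fun m => F (u m)) ((fderiv ℝ F (u m)).comp (fderiv ℝ u m)) m :=
    fun m hm => (hF.differentiable (by simp) _).hasFDerivAt.comp m
      (ContDiffOn.differentiableAt_of_isOpen hu hU (hsub hm)).hasFDerivAt
  have hGvd : ∀ m ∈ U', HasFDerivAt (fun m => G (v m)) ((fderiv ℝ G (v m)).comp (fderiv ℝ v m)) m :=
    fun m hm => (hG.differentiable (by simp) _).hasFDerivAt.comp m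
      (ContDiffOn.differentiableAt_of_isOpen hv hU (hsub hm)).hasFDerivAt
  -- Here (x, p) = F(u) and (y, q) = G(v), so the relation dz = ρθ + F₂dF₁ + G₂dG₁ says that the
  -- standard contact form pulls back to ρθ.
  set Φ : E 5 → E 5 := fun m =>
    !₂[(F (u m)).1, (G (v m)).1, z m, (F (u m)).2, (G (v m)).2] with hΦ
  have hΦs : ContDiffOn ℝ ∞ Φ U' := by
    rw [contDiffOn_euclidean]
    intro i
    fin_cases i
    exacts [hFu.fst, hGv.fst, hz, hFu.snd, hGv.snd]
  have hΦd : ∀ m ∈ U', ∀ x, xp (fderiv ℝ Φ m x) = fderiv ℝ F (u m) (fderiv ℝ u m x) ∧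
      yq (fderiv ℝ Φ m x) = fderiv ℝ G (v m) (fderiv ℝ v m x) ∧
      fderiv ℝ Φ m x 2 = fderiv ℝ z m x := by
    intro m hm x
    have hd := ContDiffOn.differentiableAt_of_isOpen hΦs hU' hm
    have h0 : fderiv ℝ Φ m x 0 = _ := (fderiv_coord hd 0 x).trans
      (congrArg (fun l => l x) (hFud m hm).fst.fderiv)
    have h3 : fderiv ℝ Φ m x 3 = _ := (fderiv_coord hd 3 x).trans
      (congrArg (fun l => l x) (hFud m hm).snd.fderiv)
    have h1 : fderiv ℝ Φ m x 1 = _ := (fderiv_coord hd 1 x).trans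
      (congrArg (fun l => l x) (hGvd m hm).fst.fderiv)
    have h4 : fderiv ℝ Φ m x 4 = _ := (fderiv_coord hd 4 x).trans
      (congrArg (fun l => l x) (hGvd m hm).snd.fderiv)
    exact ⟨Prod.ext h0 h3, Prod.ext h1 h4, fderiv_coord hd 2 x⟩
  have hΦc : ∀ m ∈ U', ∀ x, waveContact (Φ m) ![fderiv ℝ Φ m x] = ρ m * θ m x := by
    intro m hm x
    obtain ⟨h1, h2, h3⟩ := hΦd m hm x
    have h1' : fderiv ℝ Φ m x 0 = (fderiv ℝ F (u m) (fderiv ℝ u m x)).1 := congrArg Prod.fst h1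
    have h2' : fderiv ℝ Φ m x 1 = (fderiv ℝ G (v m) (fderiv ℝ v m x)).1 := congrArg Prod.fst h2
    rw [waveContact_apply, h1', h2', h3, (h m hm).2.2.2.2.2.1 x]
    simp [hΦ]
    ring
  -- A vector killed by the derivative is killed by ρθ and, since `F` and `G` have nonzero
  -- Jacobians, by du and dv. These five forms are a coframe.
  have hinj' : ∀ x, fderiv ℝ Φ m₀ x = 0 → x = 0 := by
    intro x hx
    obtain ⟨hρ, hμ, hν, hFa, hGa, -, -⟩ := h m₀ hm'
    obtain ⟨h1, h2, h3⟩ := hΦd m₀ hm' x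
    have h4 := hΦc m₀ hm' x
    rw [waveContact_apply, hx] at h4
    rw [hx] at h1 h2
    simp [hρ] at h4
    exact hinj m₀ hm₀ x h4 (eq_zero_of_area_map hμ hFa h1.symm)
      (eq_zero_of_area_map hν hGa h2.symm)
  obtain ⟨L, hL⟩ := exists_equiv_of_injective rfl hinj'
  obtain ⟨φ, hmφ, hφU, hφ, hφs, -⟩ := exists_localDiffeo hU' hm' hΦs (L := L) hL.symm
  have hφ' : (φ : E 5 → E 5) = Φ := funext hφ
  refine ⟨φ, ρ, F, G, μ, ν, hmφ, hφU.trans hsub, hφ' ▸ hΦs.mono hφU, hφs, hF, hG, fun m hm => ?_⟩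
  obtain ⟨hρ, hμ, hν, hFa, hGa, -, hed⟩ := h m (hφU hm)
  rw [hφ']
  exact ⟨hρ, hμ, hν, hFa, hGa, rfl, rfl, fun x => ⟨(hΦd m (hφU hm) x).1, (hΦd m (hφU hm) x).2.1,
    hΦc m (hφU hm) x⟩, hed⟩

end Backlund

/-! ### Wave charts below a characteristic coframing -/

namespace Backlund

open Set Filter

theorem isOpen_image_of_surjective {V W : Type*} [NormedAddCommGroup V] [NormedSpace ℝ V]
    [FiniteDimensional ℝ V] [NormedAddCommGroup W] [NormedSpace ℝ W] [FiniteDimensional ℝ W]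
    {p : V → W} {N : Set V} (hN : IsOpen N) (hp : ContDiffOn ℝ ∞ p N)
    (h : ∀ y ∈ N, Function.Surjective (fderiv ℝ p y)) : IsOpen (p '' N) := by
  have : CompleteSpace V := FiniteDimensional.complete ℝ V
  have : CompleteSpace W := FiniteDimensional.complete ℝ W
  refine isOpen_iff_mem_nhds.2 ?_
  rintro _ ⟨y, hy, rfl⟩
  have h1 : HasStrictFDerivAt p (fderiv ℝ p y) y :=
    (hp.contDiffAt (hN.mem_nhds hy)).hasStrictFDerivAt (by simp)
  rw [← h1.map_nhds_eq_of_surj (LinearMap.range_eq_top.2 (h y hy))]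
  exact image_mem_map (hN.mem_nhds hy)

/-- A pair of functions pulls the area form back to a multiple of a decomposable 2-form with
the same kernel. -/
theorem exists_area_eq_wdg {V : Type*} [NormedAddCommGroup V] [NormedSpace ℝ V]
    {L : V →L[ℝ] ℝ × ℝ} {α β : V →L[ℝ] ℝ} (h : ∀ v, L v = 0 ↔ α v = 0 ∧ β v = 0) {e f : V}
    (he : α e = 1) (he' : β e = 0) (hf : α f = 0) (hf' : β f = 1) :
    ∃ k ≠ 0, ∀ v w, area (L v) (L w) = k * wdg α β v w := by
  have hL : ∀ v, L v = α v • L e + β v • L f := by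
    intro v
    have := (h (v - α v • e - β v • f)).2 (by simp [he, he', hf, hf'])
    rw [map_sub, map_sub, map_smul, map_smul] at this
    rw [← sub_eq_zero, ← this]
    abel
  -- If this area were zero, some nontrivial combination of `e` and `f` would lie in the kernel of
  -- `L`, hence in that of `α` and `β`.
  refine ⟨area (L e) (L f), fun h0 => ?_, fun v w => ?_⟩
  · have key : ∀ a b : ℝ, a • L e + b • L f = 0 → a = 0 ∧ b = 0 := by
      intro a b hab
      have := (h (a • e + b • f)).1 (by simpa using hab)
      simpa [he, he', hf, hf'] using this
    simp only [area] at h0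
    obtain ⟨h1, h2⟩ := key (L f).1 (-(L e).1) (by
      ext
      · simp; ring
      · simp; linarith)
    obtain ⟨h3, h4⟩ := key (L f).2 (-(L e).2) (by
      ext
      · simp; linarith
      · simp; ring)
    have := key 0 1 (by ext <;> simp [h1, h3])
    exact one_ne_zero this.2
  · rw [hL v, hL w]
    simp [area, wdg]
    ring

/-- `φ` is a chart on the base of the submersion `p` in which the Monge-Ampère system generated by
`θ`, `dθ`, `Ψ` is the one of the wave equation and whose characteristic coordinates are functions of
the first integrals `u` and `v`. -/
structure IsWaveChart {V : Type*} [NormedAddCommGroup V] [NormedSpace ℝ V] (N : Set V)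
    (p : V → E 5) (θ : E 5 → E 5 →L[ℝ] ℝ) (Ψ : E 5 → E 5 →L[ℝ] E 5 →L[ℝ] ℝ)
    (u v : V → ℝ × ℝ) (φ : OpenPartialHomeomorph (E 5) (E 5)) (u₁ v₁ : E 5 → ℝ × ℝ) (ρ : E 5 → ℝ)
    (F G : ℝ × ℝ → ℝ × ℝ) (μ ν : E 5 → ℝ) : Prop where
  smooth : ContDiffOn ℝ ∞ φ φ.source
  smooth_symm : ContDiffOn ℝ ∞ φ.symm φ.target
  smooth_F : ContDiff ℝ ∞ F
  smooth_G : ContDiff ℝ ∞ G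
  continuousOn_u : ContinuousOn u₁ φ.source
  continuousOn_v : ContinuousOn v₁ φ.source
  u_eq : ∀ y ∈ N, u y = u₁ (p y)
  v_eq : ∀ y ∈ N, v y = v₁ (p y)
  ρ_ne_zero : ∀ m ∈ φ.source, ρ m ≠ 0
  μ_ne_zero : ∀ m ∈ φ.source, μ m ≠ 0
  ν_ne_zero : ∀ m ∈ φ.source, ν m ≠ 0
  area_F : ∀ m ∈ φ.source, ∀ a b,
    area (fderiv ℝ F (u₁ m) a) (fderiv ℝ F (u₁ m) b) = μ m * area a b
  area_G : ∀ m ∈ φ.source, ∀ a b,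
    area (fderiv ℝ G (v₁ m) a) (fderiv ℝ G (v₁ m) b) = ν m * area a b
  xp_eq : ∀ m ∈ φ.source, xp (φ m) = F (u₁ m)
  yq_eq : ∀ m ∈ φ.source, yq (φ m) = G (v₁ m)
  contact : ∀ m ∈ φ.source, ∀ x, waveContact (φ m) ![fderiv ℝ φ m x] = ρ m * θ m x
  two_forms : ∀ m ∈ φ.source, ∃ a c s t : ℝ, s * c - t * a ≠ 0 ∧ ∀ x y, θ m x = 0 → θ m y = 0 →
    ed θ m x y = a * area (xp (fderiv ℝ φ m x)) (xp (fderiv ℝ φ m y)) +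
      c * area (yq (fderiv ℝ φ m x)) (yq (fderiv ℝ φ m y)) ∧
    Ψ m x y = s * area (xp (fderiv ℝ φ m x)) (xp (fderiv ℝ φ m y)) +
      t * area (yq (fderiv ℝ φ m x)) (yq (fderiv ℝ φ m y))
  ed_eq : ∀ y ∈ N, p y ∈ φ.source → ∀ x w, pb p θ y x = 0 → pb p θ y w = 0 →
    ρ (p y) * ed (pb p θ) y x w = μ (p y) * area (fderiv ℝ u y x) (fderiv ℝ u y w) +
      ν (p y) * area (fderiv ℝ v y x) (fderiv ℝ v y w)
  pb_eq_zero : ∀ y ∈ N, p y ∈ φ.source → ∀ x, fderiv ℝ u y x = 0 → fderiv ℝ v y x = 0 →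
    fderiv ℝ φ (p y) (fderiv ℝ p y x) 2 = 0 → pb p θ y x = 0

/-- The system below a characteristic coframing with first integrals has wave coordinates. -/
theorem IsCharacteristicCoframing.exists_waveChart {V : Type*} [NormedAddCommGroup V]
    [NormedSpace ℝ V] [FiniteDimensional ℝ V] {N N₀ : Set V} {U : Set (E 5)} {p : V → E 5}
    {θ : E 5 → E 5 →L[ℝ] ℝ} {Ψ : E 5 → E 5 →L[ℝ] E 5 →L[ℝ] ℝ} {β : V → V →L[ℝ] ℝ}
    {κ : Fin 4 → V → V →L[ℝ] ℝ} (h : IsCharacteristicCoframing N U p θ Ψ β κ)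
    (hV : Module.finrank ℝ V = 6) {u v : V → ℝ × ℝ} {y₀ : V} (hN₀ : IsOpen N₀) (hy₀ : y₀ ∈ N₀)
    (hsub : N₀ ⊆ N) (hu : ContDiffOn ℝ ∞ u N₀) (hv : ContDiffOn ℝ ∞ v N₀)
    (huk : ∀ y ∈ N₀, ∀ x, fderiv ℝ u y x = 0 ↔ κ 0 y x = 0 ∧ κ 1 y x = 0)
    (hvk : ∀ y ∈ N₀, ∀ x, fderiv ℝ v y x = 0 ↔ κ 2 y x = 0 ∧ κ 3 y x = 0) :
    ∃ (N' : Set V) (φ : OpenPartialHomeomorph (E 5) (E 5)) (u₁ v₁ : E 5 → ℝ × ℝ) (ρ : E 5 → ℝ)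
      (F G : ℝ × ℝ → ℝ × ℝ) (μ ν : E 5 → ℝ), IsOpen N' ∧ y₀ ∈ N' ∧ N' ⊆ N₀ ∧ p y₀ ∈ φ.source ∧
      φ.source ⊆ U ∧ IsWaveChart N' p θ Ψ u v φ u₁ v₁ ρ F G μ ν := by
  have hW : Module.finrank ℝ (E 5) = 5 := by simp
  have hp0 := h.smooth_p.mono hsub
  -- Vertical vectors are annihilated by all `κ i`, so both first integrals are constant along the
  -- fibres and descend.
  have hker : ∀ y ∈ N₀, ∀ x, fderiv ℝ p y x = 0 → fderiv ℝ u y x = 0 ∧ fderiv ℝ v y x = 0 := by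
    intro y hy x hx
    have := (h.vertical hV (hsub hy) hx).2
    exact ⟨(huk y hy x).2 ⟨this 0, this 1⟩, (hvk y hy x).2 ⟨this 2, this 3⟩⟩
  obtain ⟨N₁, O₁, u₁, hN₁, hy₁, hN₁₀, hO₁, hm₁, hu₁, hu₁p⟩ := exists_descent hN₀ hy₀ hp0 hu
    (h.surjective y₀ (hsub hy₀)) fun y hy x hx => (hker y hy x hx).1
  obtain ⟨N₂, O₂, v₁, hN₂, hy₂, hN₂₀, hO₂, hm₂, hv₁, hv₁p⟩ := exists_descent hN₀ hy₀ hp0 hv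
    (h.surjective y₀ (hsub hy₀)) fun y hy x hx => (hker y hy x hx).2
  set N' := N₁ ∩ N₂ with hN'def
  have hN' : IsOpen N' := hN₁.inter hN₂
  have hN'₀ : N' ⊆ N₀ := fun y hy => hN₁₀ hy.1
  have hN'N : N' ⊆ N := hN'₀.trans hsub
  -- Working on the image of `N'` ensures that every point has a preimage at which the structure
  -- equations can be read off.
  set O := p '' N' with hOdef
  have hO : IsOpen O := isOpen_image_of_surjective hN' (h.smooth_p.mono hN'N)
    fun y hy => h.surjective y (hN'N hy)
  have hO1 : O ⊆ O₁ := by rintro _ ⟨y, hy, rfl⟩; exact hm₁ hy.1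
  have hO2 : O ⊆ O₂ := by rintro _ ⟨y, hy, rfl⟩; exact hm₂ hy.2
  have hOU : O ⊆ U := by rintro _ ⟨y, hy, rfl⟩; exact h.mapsTo (hN'N hy)
  have hpd : ∀ y ∈ N', HasFDerivAt p (fderiv ℝ p y) y := fun y hy =>
    ((h.contDiffAt_p (hN'N hy)).differentiableAt (by simp)).hasFDerivAt
  have hDu : ∀ y ∈ N', ∀ x, fderiv ℝ u₁ (p y) (fderiv ℝ p y x) = fderiv ℝ u y x := by
    intro y hy x
    have h1 : HasFDerivAt (fun y => u₁ (p y)) _ y := (ContDiffOn.differentiableAt_of_isOpen hu₁ hO₁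
      (hm₁ hy.1)).hasFDerivAt.comp y (hpd y hy)
    rw [(h1.congr_of_eventuallyEq (eventually_mem_isOpen hN₁ hy.1 hu₁p)).fderiv]
    rfl
  have hDv : ∀ y ∈ N', ∀ x, fderiv ℝ v₁ (p y) (fderiv ℝ p y x) = fderiv ℝ v y x := by
    intro y hy x
    have h1 : HasFDerivAt (fun y => v₁ (p y)) _ y := (ContDiffOn.differentiableAt_of_isOpen hv₁ hO₂
      (hm₂ hy.2)).hasFDerivAt.comp y (hpd y hy)
    rw [(h1.congr_of_eventuallyEq (eventually_mem_isOpen hN₂ hy.2 hv₁p)).fderiv]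
    rfl
  obtain ⟨e, -, he, -⟩ := h.exists_frame hV
  have hθe : ∀ z ∈ N, ∀ j, pb p θ z (e j z) = if 0 = j then 1 else 0 := fun z hz j => he z hz 0 j
  have hβe : ∀ z ∈ N, ∀ j, β z (e j z) = if 1 = j then 1 else 0 := fun z hz j => he z hz 1 j
  have hκ : ∀ z ∈ N, ∀ (i : Fin 4) (j : Fin 6),
      κ i z (e j z) = if (i.natAdd 2 : Fin 6) = j then 1 else 0 := by
    intro z hz i j
    have := he z hz (i.natAdd 2) j
    fin_cases i <;> exact this
  have hedp : ∀ y ∈ N', ∀ x w, ed θ (p y) (fderiv ℝ p y x) (fderiv ℝ p y w) = ed (pb p θ) y x w :=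
    fun y hy x w => (h.ed_pb_eq (hN'N hy) x w).symm
  obtain ⟨φ, ρ, F, G, μ, ν, hmφ, hφO, hφ, hφs, hF, hG, hall⟩ :=
    Backlund.exists_waveChart hO ⟨y₀, ⟨hy₁, hy₂⟩, rfl⟩ (h.smooth_θ.mono hOU) (hu₁.mono hO1)
      (hv₁.mono hO2) (by
      rintro _ ⟨y, hy, rfl⟩ x h0 h1 h2
      obtain ⟨x, rfl⟩ := h.surjective y (hN'N hy) x
      rw [hDu y hy, huk y (hN'₀ hy)] at h1
      rw [hDv y hy, hvk y (hN'₀ hy)] at h2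
      refine (h.vertical_iff hV hW (hN'N hy) x).2 ⟨h0, fun i => ?_⟩
      fin_cases i
      exacts [h1.1, h1.2, h2.1, h2.2]) (by
      rintro _ ⟨y, hy, rfl⟩ x w h0 h1 h2 h3
      obtain ⟨x, rfl⟩ := h.surjective y (hN'N hy) x
      obtain ⟨w, rfl⟩ := h.surjective y (hN'N hy) w
      rw [hDu y hy, huk y (hN'₀ hy)] at h2
      rw [hDv y hy, hvk y (hN'₀ hy)] at h3
      obtain ⟨a, c, -, -, -, -, -, hs, -⟩ := h.structure_eq y (hN'N hy)
      rw [hedp y hy, hs x w h0 h1]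
      simp [wdg, h2, h3]) (by
      rintro _ ⟨y, hy, rfl⟩
      have hyN := hN'N hy
      obtain ⟨a, c, -, -, ha, -, -, hs, -⟩ := h.structure_eq y hyN
      refine ⟨fderiv ℝ p y (e 2 y), fderiv ℝ p y (e 3 y), hθe y hyN 2, hθe y hyN 3, ?_, ?_, ?_⟩
      · rw [hDv y hy, hvk y (hN'₀ hy), hκ y hyN, hκ y hyN]; simp [Fin.ext_iff]
      · rw [hDv y hy, hvk y (hN'₀ hy), hκ y hyN, hκ y hyN]; simp [Fin.ext_iff]
      · rw [hedp y hy, hs _ _ (hθe y hyN 2) (hθe y hyN 3)]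
        simp [wdg, hκ y hyN, Fin.ext_iff, ha]) (by
      rintro _ ⟨y, hy, rfl⟩
      have hyN := hN'N hy
      obtain ⟨a, c, -, -, -, hc, -, hs, -⟩ := h.structure_eq y hyN
      refine ⟨fderiv ℝ p y (e 4 y), fderiv ℝ p y (e 5 y), hθe y hyN 4, hθe y hyN 5, ?_, ?_, ?_⟩
      · rw [hDu y hy, huk y (hN'₀ hy), hκ y hyN, hκ y hyN]; simp [Fin.ext_iff]
      · rw [hDu y hy, huk y (hN'₀ hy), hκ y hyN, hκ y hyN]; simp [Fin.ext_iff]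
      · rw [hedp y hy, hs _ _ (hθe y hyN 4) (hθe y hyN 5)]
        simp [wdg, hκ y hyN, Fin.ext_iff, hc])
  refine ⟨N', φ, u₁, v₁, ρ, F, G, μ, ν, hN', ⟨hy₁, hy₂⟩, hN'₀, hmφ, hφO.trans hOU, {
    smooth := hφ
    smooth_symm := hφs
    smooth_F := hF
    smooth_G := hG
    continuousOn_u := hu₁.continuousOn.mono (hφO.trans hO1)
    continuousOn_v := hv₁.continuousOn.mono (hφO.trans hO2)
    u_eq := fun y hy => hu₁p y hy.1
    v_eq := fun y hy => hv₁p y hy.2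
    ρ_ne_zero := fun m hm => (hall m hm).1
    μ_ne_zero := fun m hm => (hall m hm).2.1
    ν_ne_zero := fun m hm => (hall m hm).2.2.1
    area_F := fun m hm => (hall m hm).2.2.2.1
    area_G := fun m hm => (hall m hm).2.2.2.2.1
    xp_eq := fun m hm => (hall m hm).2.2.2.2.2.1
    yq_eq := fun m hm => (hall m hm).2.2.2.2.2.2.1
    contact := fun m hm x => ((hall m hm).2.2.2.2.2.2.2.1 x).2.2
    two_forms := fun m hm => ?_
    ed_eq := fun y hy hm x w hx hw => ?_
    pb_eq_zero := fun y hy hm x hx hx' hz => ?_ }⟩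
  · obtain ⟨y, hy, rfl⟩ := hφO hm
    have hyN := hN'N hy
    obtain ⟨-, hμ, hν, hFa, hGa, -, -, hD, -⟩ := hall _ hm
    obtain ⟨a, c, s, t, ha, hc, hst, h1, h2⟩ := h.structure_eq y hyN
    obtain ⟨k, hk, hku⟩ := exists_area_eq_wdg (huk y (hN'₀ hy)) (e := e 2 y) (f := e 3 y)
      (hκ y hyN 0 2) (hκ y hyN 1 2) (hκ y hyN 0 3) (hκ y hyN 1 3)
    obtain ⟨l, hl, hlv⟩ := exists_area_eq_wdg (hvk y (hN'₀ hy)) (e := e 4 y) (f := e 5 y)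
      (hκ y hyN 2 4) (hκ y hyN 3 4) (hκ y hyN 2 5) (hκ y hyN 3 5)
    have hx1 : fderiv ℝ p y (e 1 y) = 0 := (h.vertical_iff hV hW hyN _).2 ⟨hθe y hyN 1, fun i => by
      rw [hκ y hyN]; fin_cases i <;> simp [Fin.ext_iff]⟩
    have hw0 : ∀ x w, area (xp (fderiv ℝ φ (p y) (fderiv ℝ p y x)))
        (xp (fderiv ℝ φ (p y) (fderiv ℝ p y w))) = μ (p y) * k * wdg (κ 0 y) (κ 1 y) x w := by
      intro x w
      rw [(hD _).1, (hD _).1, hFa, hDu y hy, hDu y hy, hku]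
      ring
    have hw1 : ∀ x w, area (yq (fderiv ℝ φ (p y) (fderiv ℝ p y x)))
        (yq (fderiv ℝ φ (p y) (fderiv ℝ p y w))) = ν (p y) * l * wdg (κ 2 y) (κ 3 y) x w := by
      intro x w
      rw [(hD _).2.1, (hD _).2.1, hGa, hDv y hy, hDv y hy, hlv]
      ring
    refine ⟨a / (μ (p y) * k), c / (ν (p y) * l), s / (μ (p y) * k), t / (ν (p y) * l), ?_,
      fun x w hx hw => ?_⟩
    · have : s / (μ (p y) * k) * (c / (ν (p y) * l)) - t / (ν (p y) * l) * (a / (μ (p y) * k)) =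
          (s * c - t * a) / (μ (p y) * k * (ν (p y) * l)) := by
        field_simp
      rw [this]
      exact div_ne_zero hst (mul_ne_zero (mul_ne_zero hμ hk) (mul_ne_zero hν hl))
    · obtain ⟨x, rfl⟩ := h.surjective y hyN x
      obtain ⟨w, rfl⟩ := h.surjective y hyN w
      -- Subtracting the vertical component does not change the image under `Dp` but makes `β`
      -- vanish, as the formula for `Ψ` requires.
      have e1 : ∀ x, fderiv ℝ p y x = fderiv ℝ p y (x - β y x • e 1 y) := fun x => by simp [hx1]
      have e2 : ∀ x, β y (x - β y x • e 1 y) = 0 := fun x => by simp [hβe y hyN]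
      rw [e1 x, e1 w] at *
      have f1 := h1 _ _ hx hw
      have f2 := h2 _ _ hx hw (e2 x) (e2 w)
      rw [hedp y hy, f1, f2, hw0, hw1]
      constructor <;> field_simp
  · obtain ⟨-, -, -, -, -, -, -, -, hed⟩ := hall _ hm
    rw [← hedp y hy, hed (fderiv ℝ p y x) (fderiv ℝ p y w) hx hw, hDu y hy, hDu y hy, hDv y hy, hDv y hy]
  · obtain ⟨hρ, -, -, -, -, -, -, hD, -⟩ := hall _ hm
    obtain ⟨h1, h2, h3⟩ := hD (fderiv ℝ p y x)
    rw [hDu y hy, hx, map_zero] at h1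
    rw [hDv y hy, hx', map_zero] at h2
    have h1' : fderiv ℝ φ (p y) (fderiv ℝ p y x) 0 = 0 := congrArg Prod.fst h1
    have h2' : fderiv ℝ φ (p y) (fderiv ℝ p y x) 1 = 0 := congrArg Prod.fst h2
    rw [waveContact_apply, h1', h2', hz] at h3
    rw [pb_apply]
    simpa [hρ] using h3.symm

end Backlund

/-! ### Plane transition maps and the local form of the transformation -/

namespace Backlund

open Set Filter

theorem det_eq_area (L : ℝ × ℝ →L[ℝ] ℝ × ℝ) : L.det = area (L (1, 0)) (L (0, 1)) := by
  rw [area_map]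
  simp [area]

theorem exists_planar_localDiffeo {F : ℝ × ℝ → ℝ × ℝ} (hF : ContDiff ℝ ∞ F) {a₀ : ℝ × ℝ} {μ : ℝ}
    (hμ : μ ≠ 0) (h : ∀ a b, area (fderiv ℝ F a₀ a) (fderiv ℝ F a₀ b) = μ * area a b) :
    ∃ e : OpenPartialHomeomorph (ℝ × ℝ) (ℝ × ℝ), a₀ ∈ e.source ∧ (∀ x, e x = F x) ∧
      ContDiffOn ℝ ∞ e.symm e.target := by
  obtain ⟨L, hL⟩ := exists_equiv_of_injective rfl fun a ha => eq_zero_of_area_map hμ h ha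
  obtain ⟨e, h1, -, h2, h3, -⟩ := exists_localDiffeo isOpen_univ (mem_univ a₀) hF.contDiffOn
    (L := L) hL.symm
  exact ⟨e, h1, h2, h3⟩

/-- The transition between two local diffeomorphisms of the plane. -/
theorem exists_transition {F₁ F₂ : ℝ × ℝ → ℝ × ℝ} (hF₁ : ContDiff ℝ ∞ F₁) (hF₂ : ContDiff ℝ ∞ F₂)
    {a₀ : ℝ × ℝ} {μ₁ μ₂ : ℝ} (hμ₁ : μ₁ ≠ 0) (hμ₂ : μ₂ ≠ 0)
    (h₁ : ∀ a b, area (fderiv ℝ F₁ a₀ a) (fderiv ℝ F₁ a₀ b) = μ₁ * area a b)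
    (h₂ : ∀ a b, area (fderiv ℝ F₂ a₀ a) (fderiv ℝ F₂ a₀ b) = μ₂ * area a b) :
    ∃ (f : OpenPartialHomeomorph (ℝ × ℝ) (ℝ × ℝ)) (S : Set (ℝ × ℝ)), IsOpen S ∧ a₀ ∈ S ∧
      InjOn F₂ S ∧ (∀ a ∈ S, F₁ a ∈ f.source ∧ f (F₁ a) = F₂ a) ∧
      ContDiffOn ℝ ∞ f f.source ∧ ContDiffOn ℝ ∞ f.symm f.target ∧
      ContinuousOn (fun a => (fderiv ℝ f a).det) f.source ∧
      (fderiv ℝ f (F₁ a₀)).det = μ₂ / μ₁ := by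
  obtain ⟨e₁, ha₁, he₁, hs₁⟩ := exists_planar_localDiffeo hF₁ hμ₁ h₁
  obtain ⟨e₂, ha₂, he₂, hs₂⟩ := exists_planar_localDiffeo hF₂ hμ₂ h₂
  have he₁' : (e₁ : ℝ × ℝ → ℝ × ℝ) = F₁ := funext he₁
  have he₂' : (e₂ : ℝ × ℝ → ℝ × ℝ) = F₂ := funext he₂
  -- The transition is F₂ ∘ F₁⁻¹, so the chain rule gives the Jacobian μ₂/μ₁ at the image of `a₀`.
  set f := e₁.symm.trans e₂ with hf
  have hS : ∀ a ∈ e₁.source ∩ e₂.source, F₁ a ∈ f.source ∧ f (F₁ a) = F₂ a := by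
    intro a ha
    have h3 : e₁.symm (F₁ a) = a := he₁ a ▸ e₁.left_inv ha.1
    refine ⟨?_, ?_⟩
    · rw [hf, OpenPartialHomeomorph.trans_source]
      refine ⟨?_, ?_⟩
      · rw [← he₁]; exact e₁.map_source ha.1
      · change e₁.symm (F₁ a) ∈ e₂.source
        rw [h3]
        exact ha.2
    · change e₂ (e₁.symm (F₁ a)) = F₂ a
      rw [h3, he₂]
  have hfs : ContDiffOn ℝ ∞ f f.source := by
    have : (f : ℝ × ℝ → ℝ × ℝ) = F₂ ∘ e₁.symm := by rw [← he₂']; rfl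
    rw [this]
    refine hF₂.comp_contDiffOn (hs₁.mono ?_)
    rw [hf, OpenPartialHomeomorph.trans_source]
    exact inter_subset_left
  have hfs' : ContDiffOn ℝ ∞ f.symm f.target := by
    have : (f.symm : ℝ × ℝ → ℝ × ℝ) = F₁ ∘ e₂.symm := by rw [← he₁']; rfl
    rw [this]
    refine hF₁.comp_contDiffOn (hs₂.mono ?_)
    rw [hf, OpenPartialHomeomorph.trans_target]
    exact inter_subset_left
  have ha₀ := hS a₀ ⟨ha₁, ha₂⟩
  refine ⟨f, e₁.source ∩ e₂.source, e₁.open_source.inter e₂.open_source, ⟨ha₁, ha₂⟩, ?_, hS, hfs,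
    hfs', ?_, ?_⟩
  · rw [← he₂']
    exact e₂.injOn.mono inter_subset_right
  · have hc : ContinuousOn (fderiv ℝ f) f.source :=
      hfs.continuousOn_fderiv_of_isOpen f.open_source (by simp)
    have h1 := hc.clm_apply (continuousOn_const (c := ((1 : ℝ), (0 : ℝ))))
    have h2 := hc.clm_apply (continuousOn_const (c := ((0 : ℝ), (1 : ℝ))))
    simp only [det_eq_area, area]
    exact (h1.fst.mul h2.snd).sub (h1.snd.mul h2.fst)
  · have hd : HasFDerivAt (fun a => f (F₁ a)) ((fderiv ℝ f (F₁ a₀)).comp (fderiv ℝ F₁ a₀)) a₀ :=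
      (ContDiffOn.differentiableAt_of_isOpen hfs f.open_source ha₀.1).hasFDerivAt.comp a₀
        (hF₁.differentiable (by simp) a₀).hasFDerivAt
    have hd' : fderiv ℝ F₂ a₀ = (fderiv ℝ f (F₁ a₀)).comp (fderiv ℝ F₁ a₀) :=
      (hd.congr_of_eventuallyEq (eventually_mem_isOpen (e₁.open_source.inter e₂.open_source)
        ⟨ha₁, ha₂⟩ fun a ha => (hS a ha).2.symm)).fderiv
    have h3 := h₂ (1, 0) (0, 1)
    rw [hd'] at h3
    simp only [ContinuousLinearMap.comp_apply, area_map] at h3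
    have h4 := h₁ (1, 0) (0, 1)
    rw [area_map] at h4
    have h5 : area ((1 : ℝ), (0 : ℝ)) (0, 1) = 1 := by simp [area]
    rw [h5, mul_one, mul_one] at h3 h4
    rw [← h4, ← h3, mul_div_assoc, div_self, mul_one]
    rw [h4]
    exact hμ₁

/-- Two transitions with different Jacobians, restricted to where the Jacobians differ. -/
theorem exists_restrict_det_ne {f g : OpenPartialHomeomorph (ℝ × ℝ) (ℝ × ℝ)} {a b : ℝ × ℝ}
    (ha : a ∈ f.source) (hb : b ∈ g.source)
    (hf : ContinuousOn (fun a => (fderiv ℝ f a).det) f.source)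
    (hg : ContinuousOn (fun a => (fderiv ℝ g a).det) g.source) (hfa : (fderiv ℝ f a).det ≠ 0)
    (hgb : (fderiv ℝ g b).det ≠ 0) (hne : (fderiv ℝ f a).det ≠ (fderiv ℝ g b).det) :
    ∃ S T : Set (ℝ × ℝ), IsOpen S ∧ IsOpen T ∧ a ∈ S ∧ b ∈ T ∧ S ⊆ f.source ∧ T ⊆ g.source ∧
      ∀ v ∈ S, ∀ w ∈ T, 0 ≠ (fderiv ℝ f v).det ∧ (fderiv ℝ f v).det ≠ (fderiv ℝ g w).det ∧
        (fderiv ℝ g w).det ≠ 0 := by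
  obtain ⟨A, B, hA, hB, hA', hB', hAB⟩ := t2_separation hne
  refine ⟨f.source ∩ (fun a => (fderiv ℝ f a).det) ⁻¹' (A ∩ {0}ᶜ),
    g.source ∩ (fun a => (fderiv ℝ g a).det) ⁻¹' (B ∩ {0}ᶜ),
    hf.isOpen_inter_preimage f.open_source (hA.inter isOpen_compl_singleton),
    hg.isOpen_inter_preimage g.open_source (hB.inter isOpen_compl_singleton),
    ⟨ha, hA', hfa⟩, ⟨hb, hB', hgb⟩, inter_subset_left, inter_subset_left, fun v hv w hw => ?_⟩
  refine ⟨fun h => hv.2.2 h.symm, fun h => ?_, hw.2.2⟩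
  have := hw.2.1
  change (fderiv ℝ g w).det ∈ B at this
  rw [← h] at this
  exact disjoint_left.1 hAB hv.2.1 this

/-- `φ` is a chart in which the Monge-Ampère system generated by `θ`, `dθ`, `Ψ` is the one of the
wave equation. -/
structure IsWaveModel (θ : E 5 → E 5 →L[ℝ] ℝ) (Ψ : E 5 → E 5 →L[ℝ] E 5 →L[ℝ] ℝ)
    (φ : OpenPartialHomeomorph (E 5) (E 5)) : Prop where
  smooth : ContDiffOn ℝ ∞ φ φ.source
  smooth_symm : ContDiffOn ℝ ∞ φ.symm φ.target
  contact : ∀ m ∈ φ.source, ∃ r ≠ 0, ∀ x, waveContact (φ m) ![fderiv ℝ φ m x] = r * θ m x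
  two_forms : ∀ m ∈ φ.source, ∃ a c s t : ℝ, s * c - t * a ≠ 0 ∧ ∀ x y, θ m x = 0 → θ m y = 0 →
    ed θ m x y = a * area (xp (fderiv ℝ φ m x)) (xp (fderiv ℝ φ m y)) +
      c * area (yq (fderiv ℝ φ m x)) (yq (fderiv ℝ φ m y)) ∧
    Ψ m x y = s * area (xp (fderiv ℝ φ m x)) (xp (fderiv ℝ φ m y)) +
      t * area (yq (fderiv ℝ φ m x)) (yq (fderiv ℝ φ m y))

theorem IsWaveChart.restrOpen {V : Type*} [NormedAddCommGroup V] [NormedSpace ℝ V] {N : Set V}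
    {p : V → E 5} {θ : E 5 → E 5 →L[ℝ] ℝ} {Ψ : E 5 → E 5 →L[ℝ] E 5 →L[ℝ] ℝ} {u v : V → ℝ × ℝ}
    {φ : OpenPartialHomeomorph (E 5) (E 5)} {u₁ v₁ : E 5 → ℝ × ℝ} {ρ : E 5 → ℝ}
    {F G : ℝ × ℝ → ℝ × ℝ} {μ ν : E 5 → ℝ} (h : IsWaveChart N p θ Ψ u v φ u₁ v₁ ρ F G μ ν)
    {S : Set (E 5)} (hS : IsOpen S) : IsWaveModel θ Ψ (φ.restrOpen S hS) where
  smooth := h.smooth.mono inter_subset_left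
  smooth_symm := h.smooth_symm.mono inter_subset_left
  contact m hm := ⟨ρ m, h.ρ_ne_zero m hm.1, h.contact m hm.1⟩
  two_forms m hm := h.two_forms m hm.1

/-- A system of two characteristic coframings with vanishing torsion is a transformation of the wave
equation by two transformations of the plane. -/
theorem exists_waveTransformation {V : Type} [NormedAddCommGroup V] [NormedSpace ℝ V]
    [FiniteDimensional ℝ V] (hV : Module.finrank ℝ V = 6) {N : Set V} {U₁ U₂ : Set (E 5)}
    {p₁ p₂ : V → E 5} {θ₁ θ₂ : E 5 → E 5 →L[ℝ] ℝ} {Ψ₁ Ψ₂ : E 5 → E 5 →L[ℝ] E 5 →L[ℝ] ℝ}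
    {κ : Fin 4 → V → V →L[ℝ] ℝ} (h₁ : IsCharacteristicCoframing N U₁ p₁ θ₁ Ψ₁ (pb p₂ θ₂) κ)
    (h₂ : IsCharacteristicCoframing N U₂ p₂ θ₂ Ψ₂ (pb p₁ θ₁) κ)
    (hT : ∀ i : Fin 4, (i = 0 ∨ i = 1) → ∀ y ∈ N, ∀ v w, pb p₁ θ₁ y v = 0 → pb p₁ θ₁ y w = 0 →
      pb p₂ θ₂ y v = 0 → pb p₂ θ₂ y w = 0 → κ 0 y v = 0 → κ 0 y w = 0 → κ 1 y v = 0 →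
      κ 1 y w = 0 → ed (κ i) y v w = 0)
    (hT' : ∀ i : Fin 4, (i = 2 ∨ i = 3) → ∀ y ∈ N, ∀ v w, pb p₁ θ₁ y v = 0 → pb p₁ θ₁ y w = 0 →
      pb p₂ θ₂ y v = 0 → pb p₂ θ₂ y w = 0 → κ 2 y v = 0 → κ 2 y w = 0 → κ 3 y v = 0 →
      κ 3 y w = 0 → ed (κ i) y v w = 0)
    {y₀ : V} (hy₀ : y₀ ∈ N)
    (hind : ∀ s : ℝ, ∃ v w, pb p₁ θ₁ y₀ v = 0 ∧ pb p₁ θ₁ y₀ w = 0 ∧ pb p₂ θ₂ y₀ v = 0 ∧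
      pb p₂ θ₂ y₀ w = 0 ∧ ed (pb p₂ θ₂) y₀ v w ≠ s * ed (pb p₁ θ₁) y₀ v w) :
    ∃ (f g : OpenPartialHomeomorph (ℝ × ℝ) (ℝ × ℝ)) (φ₁ φ₂ : OpenPartialHomeomorph (E 5) (E 5))
      (N' : Set V), ContDiffOn ℝ ∞ f f.source ∧ ContDiffOn ℝ ∞ f.symm f.target ∧
      ContDiffOn ℝ ∞ g g.source ∧ ContDiffOn ℝ ∞ g.symm g.target ∧
      (∀ v ∈ f.source, ∀ w ∈ g.source,
        0 ≠ (fderiv ℝ f v).det ∧ (fderiv ℝ f v).det ≠ (fderiv ℝ g w).det ∧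
          (fderiv ℝ g w).det ≠ 0) ∧
      IsOpen N' ∧ y₀ ∈ N' ∧ N' ⊆ N ∧ p₁ y₀ ∈ φ₁.source ∧ p₂ y₀ ∈ φ₂.source ∧ φ₁.source ⊆ U₁ ∧
      φ₂.source ⊆ U₂ ∧ IsWaveModel θ₁ Ψ₁ φ₁ ∧ IsWaveModel θ₂ Ψ₂ φ₂ ∧
      ∀ m₁ ∈ φ₁.source, ∀ m₂ ∈ φ₂.source,
        (∃ y ∈ N', p₁ y = m₁ ∧ p₂ y = m₂) ↔ (φ₁ m₁, φ₂ m₂) ∈ waveTransformation f g := by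
  have hW : Module.finrank ℝ (E 5) = 5 := by simp
  obtain ⟨Nu, u, hNu, hyu, hNuN, hu, huk⟩ :=
    IsCharacteristicCoframing.exists_firstIntegrals h₁ h₂ hV hW hW hT hy₀
  obtain ⟨Nv, v, hNv, hyv, hNvN, hv, hvk⟩ :=
    IsCharacteristicCoframing.exists_firstIntegrals h₁.exchange h₂.exchange hV hW hW (by
      rintro i (rfl | rfl)
      exacts [hT' 2 (by simp), hT' 3 (by simp)]) hy₀
  set N₀ := Nu ∩ Nv with hN₀def
  have hN₀ : IsOpen N₀ := hNu.inter hNv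
  obtain ⟨N₁, φ₁, u₁, v₁, ρ₁, F₁, G₁, μ₁, ν₁, hN₁, hy₁, hN₁₀, hφ₁, hφU₁, c₁⟩ :=
    h₁.exists_waveChart hV hN₀ ⟨hyu, hyv⟩ (fun y hy => hNuN hy.1) (hu.mono inter_subset_left)
      (hv.mono inter_subset_right) (fun y hy => huk y hy.1) (fun y hy => hvk y hy.2)
  obtain ⟨N₂, φ₂, u₂, v₂, ρ₂, F₂, G₂, μ₂, ν₂, hN₂, hy₂, hN₂₀, hφ₂, hφU₂, c₂⟩ :=
    h₂.exists_waveChart hV hN₀ ⟨hyu, hyv⟩ (fun y hy => hNuN hy.1) (hu.mono inter_subset_left)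
      (hv.mono inter_subset_right) (fun y hy => huk y hy.1) (fun y hy => hvk y hy.2)
  have hu₁₀ := c₁.u_eq y₀ hy₁
  have hu₂₀ := c₂.u_eq y₀ hy₂
  have hv₁₀ := c₁.v_eq y₀ hy₁
  have hv₂₀ := c₂.v_eq y₀ hy₂
  have hμ₁ := c₁.μ_ne_zero _ hφ₁
  have hμ₂ := c₂.μ_ne_zero _ hφ₂
  have hν₁ := c₁.ν_ne_zero _ hφ₁
  have hν₂ := c₂.ν_ne_zero _ hφ₂
  obtain ⟨f, Sf, hSf, haf, hinjf, hf, hfs, hfs', hfc, hfd⟩ := exists_transition (a₀ := u y₀)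
    c₁.smooth_F c₂.smooth_F hμ₁ hμ₂ (hu₁₀ ▸ c₁.area_F _ hφ₁) (hu₂₀ ▸ c₂.area_F _ hφ₂)
  obtain ⟨g, Sg, hSg, hag, hinjg, hg, hgs, hgs', hgc, hgd⟩ := exists_transition (a₀ := v y₀)
    c₁.smooth_G c₂.smooth_G hν₁ hν₂ (hv₁₀ ▸ c₁.area_G _ hφ₁) (hv₂₀ ▸ c₂.area_G _ hφ₂)
  -- If the Jacobians agreed, both blocks of ρ₂dθ₂ would be the same multiple of those of ρ₁dθ₁ on
  -- the kernel of θ₁ and θ₂. The scalar passed to `hind` is the resulting ratio of dθ₂ to dθ₁.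
  have hne : (fderiv ℝ f (F₁ (u y₀))).det ≠ (fderiv ℝ g (G₁ (v y₀))).det := by
    rw [hfd, hgd]
    intro heq
    obtain ⟨x, w, hx₁, hw₁, hx₂, hw₂, hxw⟩ :=
      hind (μ₂ (p₂ y₀) / μ₁ (p₁ y₀) * ρ₁ (p₁ y₀) / ρ₂ (p₂ y₀))
    have e₁ := c₁.ed_eq y₀ hy₁ hφ₁ x w hx₁ hw₁
    have e₂ := c₂.ed_eq y₀ hy₂ hφ₂ x w hx₂ hw₂
    have hr₂ := c₂.ρ_ne_zero _ hφ₂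
    refine hxw (mul_left_cancel₀ hr₂ ?_)
    rw [div_eq_div_iff hμ₁ hν₁] at heq
    rw [e₂]
    field_simp
    linear_combination (-μ₂ (p₂ y₀)) * e₁ - area (fderiv ℝ v y₀ x) (fderiv ℝ v y₀ w) * heq
  obtain ⟨S, T, hS, hT, haS, hbT, hSf', hTg', hdet⟩ := exists_restrict_det_ne (hf _ haf).1
    (hg _ hag).1 hfc hgc (hfd ▸ div_ne_zero hμ₂ hμ₁) (hgd ▸ div_ne_zero hν₂ hν₁) hne
  -- the map recording the common coordinates
  have hp₁ := h₁.smooth_p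
  have hp₂ := h₂.smooth_p
  have hN₁N : N₁ ⊆ N := fun y hy => hNuN (hN₁₀ hy).1
  have hN₂N : N₂ ⊆ N := fun y hy => hNuN (hN₂₀ hy).1
  set N₃ : Set V := ((N₁ ∩ p₁ ⁻¹' φ₁.source) ∩ (N₂ ∩ p₂ ⁻¹' φ₂.source)) ∩
    ((N₀ ∩ u ⁻¹' (Sf ∩ F₁ ⁻¹' S)) ∩ (N₀ ∩ v ⁻¹' (Sg ∩ G₁ ⁻¹' T))) with hN₃def
  have hu₀ : ContDiffOn ℝ ∞ u N₀ := hu.mono inter_subset_left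
  have hv₀ : ContDiffOn ℝ ∞ v N₀ := hv.mono inter_subset_right
  have hN₃ : IsOpen N₃ := by
    refine IsOpen.inter (IsOpen.inter ?_ ?_) (IsOpen.inter ?_ ?_)
    · exact (hp₁.continuousOn.mono hN₁N).isOpen_inter_preimage hN₁ φ₁.open_source
    · exact (hp₂.continuousOn.mono hN₂N).isOpen_inter_preimage hN₂ φ₂.open_source
    · exact hu₀.continuousOn.isOpen_inter_preimage hN₀
        (hSf.inter (hS.preimage c₁.smooth_F.continuous))
    · exact hv₀.continuousOn.isOpen_inter_preimage hN₀
        (hSg.inter (hT.preimage c₁.smooth_G.continuous))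
  have hy₃ : y₀ ∈ N₃ := ⟨⟨⟨hy₁, hφ₁⟩, ⟨hy₂, hφ₂⟩⟩, ⟨⟨hyu, hyv⟩, haf, haS⟩, ⟨⟨hyu, hyv⟩, hag, hbT⟩⟩
  have hN₃N : N₃ ⊆ N := fun y hy => hN₁N hy.1.1.1
  have hφp₁ : ContDiffOn ℝ ∞ (fun y => φ₁ (p₁ y)) N₃ :=
    c₁.smooth.comp (hp₁.mono hN₃N) fun y hy => hy.1.1.2
  have hφp₂ : ContDiffOn ℝ ∞ (fun y => φ₂ (p₂ y)) N₃ :=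
    c₂.smooth.comp (hp₂.mono hN₃N) fun y hy => hy.1.2.2
  have hz₁ : ContDiffOn ℝ ∞ (fun y => φ₁ (p₁ y) 2) N₃ := contDiffOn_euclidean.1 hφp₁ 2
  have hz₂ : ContDiffOn ℝ ∞ (fun y => φ₂ (p₂ y) 2) N₃ := contDiffOn_euclidean.1 hφp₂ 2
  -- The functions u, v, z₁, z₂ will be coordinates, their number being 2 + 2 + 1 + 1 = 6. Thus z₁
  -- and z₂ are independent, and the image is the whole transformation. The grouping separates what
  -- is read from the first point from z₂.
  set q : V → ((ℝ × ℝ) × (ℝ × ℝ) × ℝ) × ℝ := fun y => ((u y, v y, φ₁ (p₁ y) 2), φ₂ (p₂ y) 2) with hq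
  have hu₃ := hu₀.mono (fun y (hy : y ∈ N₃) => hy.2.1.1)
  have hv₃ := hv₀.mono (fun y (hy : y ∈ N₃) => hy.2.1.1)
  have hqs : ContDiffOn ℝ ∞ q N₃ := (hu₃.prodMk (hv₃.prodMk hz₁)).prodMk hz₂
  have hd : ∀ {H : Type} [NormedAddCommGroup H] [NormedSpace ℝ H] {f : V → H},
      ContDiffOn ℝ ∞ f N₃ → DifferentiableAt ℝ f y₀ := fun hf =>
    ContDiffOn.differentiableAt_of_isOpen hf hN₃ hy₃
  have hqd : ∀ x, fderiv ℝ q y₀ x = 0 → x = 0 := by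
    intro x hx
    have h0 : HasFDerivAt q _ y₀ := (((hd hu₃).hasFDerivAt.prodMk
      ((hd hv₃).hasFDerivAt.prodMk (hd hz₁).hasFDerivAt)).prodMk (hd hz₂).hasFDerivAt)
    rw [h0.fderiv] at hx
    simp only [ContinuousLinearMap.prod_apply, Prod.mk_eq_zero] at hx
    obtain ⟨⟨hx1, hx2, hx3⟩, hx4⟩ := hx
    have hc₁ : fderiv ℝ (fun y => φ₁ (p₁ y)) y₀ x = fderiv ℝ φ₁ (p₁ y₀) (fderiv ℝ p₁ y₀ x) := by
      have : HasFDerivAt (fun y => φ₁ (p₁ y)) _ y₀ := (ContDiffOn.differentiableAt_of_isOpen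
        c₁.smooth φ₁.open_source hφ₁).hasFDerivAt.comp y₀
          (hd (hp₁.mono hN₃N)).hasFDerivAt
      rw [this.fderiv]
      rfl
    have hc₂ : fderiv ℝ (fun y => φ₂ (p₂ y)) y₀ x = fderiv ℝ φ₂ (p₂ y₀) (fderiv ℝ p₂ y₀ x) := by
      have : HasFDerivAt (fun y => φ₂ (p₂ y)) _ y₀ := (ContDiffOn.differentiableAt_of_isOpen
        c₂.smooth φ₂.open_source hφ₂).hasFDerivAt.comp y₀
          (hd (hp₂.mono hN₃N)).hasFDerivAt
      rw [this.fderiv]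
      rfl
    rw [← fderiv_coord (hd hφp₁), hc₁] at hx3
    rw [← fderiv_coord (hd hφp₂), hc₂] at hx4
    have k := (huk y₀ hyu x).1 hx1
    have k' := (hvk y₀ hyv x).1 hx2
    refine h₁.coframe y₀ hy₀ x (c₁.pb_eq_zero y₀ hy₁ hφ₁ x hx1 hx2 hx3)
      (c₂.pb_eq_zero y₀ hy₂ hφ₂ x hx1 hx2 hx4) fun i => ?_
    fin_cases i
    exacts [k.1, k.2, k'.1, k'.2]
  obtain ⟨L, hL⟩ := exists_equiv_of_injective (by simp [hV]) hqd
  obtain ⟨e, hye, heN, heq, -, -⟩ := exists_localDiffeo hN₃ hy₃ hqs (L := L) hL.symm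
  -- A product box inside the target: `m₁` and `m₂` can then be restricted separately, to `O₁` and
  -- `O₂`.
  obtain ⟨A, C, hA, hC, hqA, hqC, hAC⟩ := isOpen_prod_iff.1 e.open_target (q y₀).1 (q y₀).2
    (heq y₀ ▸ e.map_source hye)
  have hz₁c : ContinuousOn (fun m => φ₁ m 2) φ₁.source :=
    (contDiffOn_euclidean.1 c₁.smooth 2).continuousOn
  have hz₂c : ContinuousOn (fun m => φ₂ m 2) φ₂.source :=
    (contDiffOn_euclidean.1 c₂.smooth 2).continuousOn
  set O₁ : Set (E 5) := φ₁.source ∩ (fun m => (((u₁ m, v₁ m, φ₁ m 2) : (ℝ × ℝ) × (ℝ × ℝ) × ℝ),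
    u₁ m, v₁ m)) ⁻¹' (A ×ˢ Sf ×ˢ Sg) with hO₁def
  set O₂ : Set (E 5) := φ₂.source ∩ (fun m => (φ₂ m 2, u₂ m, v₂ m)) ⁻¹' (C ×ˢ Sf ×ˢ Sg) with hO₂def
  have hO₁ : IsOpen O₁ := ContinuousOn.isOpen_inter_preimage
    ((c₁.continuousOn_u.prodMk (c₁.continuousOn_v.prodMk hz₁c)).prodMk
      (c₁.continuousOn_u.prodMk c₁.continuousOn_v)) φ₁.open_source (hA.prod (hSf.prod hSg))
  have hO₂ : IsOpen O₂ := ContinuousOn.isOpen_inter_preimage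
    (hz₂c.prodMk (c₂.continuousOn_u.prodMk c₂.continuousOn_v)) φ₂.open_source
      (hC.prod (hSf.prod hSg))
  refine ⟨f.restrOpen S hS, g.restrOpen T hT, φ₁.restrOpen O₁ hO₁, φ₂.restrOpen O₂ hO₂, e.source,
    hfs.mono inter_subset_left, hfs'.mono inter_subset_left, hgs.mono inter_subset_left,
    hgs'.mono inter_subset_left, fun v hv w hw => hdet v hv.2 w hw.2, e.open_source, hye,
    heN.trans hN₃N, ⟨hφ₁, hφ₁, ?_⟩, ⟨hφ₂, hφ₂, ?_⟩, inter_subset_left.trans hφU₁,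
    inter_subset_left.trans hφU₂, c₁.restrOpen hO₁, c₂.restrOpen hO₂, fun m₁ hm₁ m₂ hm₂ => ⟨?_, ?_⟩⟩
  · refine ⟨?_, ?_, ?_⟩
    · dsimp only
      rw [← hu₁₀, ← hv₁₀]
      exact hqA
    · change u₁ (p₁ y₀) ∈ Sf
      exact hu₁₀ ▸ haf
    · change v₁ (p₁ y₀) ∈ Sg
      exact hv₁₀ ▸ hag
  · refine ⟨hqC, ?_, ?_⟩
    · change u₂ (p₂ y₀) ∈ Sf
      exact hu₂₀ ▸ haf
    · change v₂ (p₂ y₀) ∈ Sg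
      exact hv₂₀ ▸ hag
  · rintro ⟨y, hy, rfl, rfl⟩
    obtain ⟨⟨⟨y1, y2⟩, ⟨y3, y4⟩⟩, ⟨-, y5, y6⟩, ⟨-, y7, y8⟩⟩ := heN hy
    have e1 := c₁.xp_eq _ y2
    have e2 := c₁.yq_eq _ y2
    have e3 := c₂.xp_eq _ y4
    have e4 := c₂.yq_eq _ y4
    rw [← c₁.u_eq y y1] at e1
    rw [← c₁.v_eq y y1] at e2
    rw [← c₂.u_eq y y3] at e3
    rw [← c₂.v_eq y y3] at e4
    refine ⟨?_, ?_, ?_, ?_⟩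
    · change xp (φ₁ (p₁ y)) ∈ f.source ∩ S
      rw [e1]
      exact ⟨(hf _ y5).1, y6⟩
    · change yq (φ₁ (p₁ y)) ∈ g.source ∩ T
      rw [e2]
      exact ⟨(hg _ y7).1, y8⟩
    · change xp (φ₂ (p₂ y)) = f (xp (φ₁ (p₁ y)))
      rw [e1, e3, (hf _ y5).2]
    · change yq (φ₂ (p₂ y)) = g (yq (φ₁ (p₁ y)))
      rw [e2, e4, (hg _ y7).2]
  · rintro ⟨-, -, r1, r2⟩
    obtain ⟨n1, -, nA, nf, ng⟩ := hm₁
    obtain ⟨n2, -, nC, nf', ng'⟩ := hm₂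
    change xp (φ₂ m₂) = f (xp (φ₁ m₁)) at r1
    change yq (φ₂ m₂) = g (yq (φ₁ m₁)) at r2
    rw [c₁.xp_eq _ n1, c₂.xp_eq _ n2, (hf _ nf).2] at r1
    rw [c₁.yq_eq _ n1, c₂.yq_eq _ n2, (hg _ ng).2] at r2
    -- Injectivity of `F₂` on `Sf` turns the relation between (x₁, p₁) and (x₂, p₂) into equality of
    -- the first integrals, so that one point of `V` can lie over both.
    have r3 : u₂ m₂ = u₁ m₁ := hinjf nf' nf r1
    have r4 : v₂ m₂ = v₁ m₁ := hinjg ng' ng r2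
    have htar : (((u₁ m₁, v₁ m₁, φ₁ m₁ 2) : (ℝ × ℝ) × (ℝ × ℝ) × ℝ), φ₂ m₂ 2) ∈ e.target :=
      hAC ⟨nA, nC⟩
    set y := e.symm ((u₁ m₁, v₁ m₁, φ₁ m₁ 2), φ₂ m₂ 2) with hydef
    have hy : y ∈ e.source := e.map_target htar
    have hqy : q y = ((u₁ m₁, v₁ m₁, φ₁ m₁ 2), φ₂ m₂ 2) := by rw [← heq, hydef, e.right_inv htar]
    simp only [hq, Prod.mk.injEq] at hqy
    obtain ⟨⟨q1, q2, q3⟩, q4⟩ := hqy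
    obtain ⟨⟨⟨y1, y2⟩, ⟨y3, y4⟩⟩, -⟩ := heN hy
    have hext : ∀ m m' : E 5, xp m = xp m' → yq m = yq m' → m 2 = m' 2 → m = m' := by
      intro m m' k1 k2 k3
      ext i
      fin_cases i
      exacts [congrArg Prod.fst k1, congrArg Prod.fst k2, k3, congrArg Prod.snd k1,
        congrArg Prod.snd k2]
    refine ⟨y, hy, φ₁.injOn y2 n1 (hext _ _ ?_ ?_ q3), φ₂.injOn y4 n2 (hext _ _ ?_ ?_ q4)⟩
    · rw [c₁.xp_eq _ y2, c₁.xp_eq _ n1, ← c₁.u_eq y y1, q1]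
    · rw [c₁.yq_eq _ y2, c₁.yq_eq _ n1, ← c₁.v_eq y y1, q2]
    · rw [c₂.xp_eq _ y4, c₂.xp_eq _ n2, ← c₂.u_eq y y3, q1, r3]
    · rw [c₂.yq_eq _ y4, c₂.yq_eq _ n2, ← c₂.v_eq y y3, q2, r4]

end Backlund

/-! ### Integral surfaces and quadrature -/

namespace Backlund

open Set Filter

theorem wedge_dcoord_apply (i j : Fin 5) (x y : E 5) :
    wedge (dcoord i) (dcoord j) ![x, y] = x i * y j - y i * x j := by
  simp [wedge_apply, dcoord_apply]

theorem eq_vec1 {V : Type*} (v : Fin 1 → V) : v = ![v 0] := by ext i; fin_cases i; rfl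

theorem eq_vec2 {V : Type*} (v : Fin 2 → V) : v = ![v 0, v 1] := by ext i; fin_cases i <;> rfl

/-- The degree-1 part of the ideal of the wave equation, as a subspace of the dual of `ℝ⁵`. -/
noncomputable def waveOne (m : E 5) : Submodule ℝ (E 5 [⋀^Fin 1]→L[ℝ] ℝ) :=
  Submodule.span ℝ {waveContact m}

/-- The degree-2 part of the ideal of the wave equation, as a space of 2-covectors on `ℝ⁵`. -/
noncomputable def waveTwo (m : E 5) : Submodule ℝ (E 5 [⋀^Fin 2]→L[ℝ] ℝ) :=
  Submodule.span ℝ {wedge (dcoord 3) (dcoord 0), wedge (dcoord 4) (dcoord 1)}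
    ⊔ idealTwo {waveContact m}

theorem waveContact_mem (m : E 5) : waveContact m ∈ waveOne m :=
  Submodule.mem_span_singleton_self _

theorem wedge_mem_waveTwo (m : E 5) : wedge (dcoord 3) (dcoord 0) ∈ waveTwo m ∧
    wedge (dcoord 4) (dcoord 1) ∈ waveTwo m :=
  ⟨Submodule.mem_sup_left (Submodule.subset_span (Or.inl rfl)),
    Submodule.mem_sup_left (Submodule.subset_span (Or.inr rfl))⟩

theorem exists_eq_smul_of_mem_waveOne {m : E 5} {α : E 5 [⋀^Fin 1]→L[ℝ] ℝ}
    (hα : α ∈ waveOne m) :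
    ∃ r : ℝ, α = r • waveContact m := by
  obtain ⟨r, hr⟩ := Submodule.mem_span_singleton.1 hα
  exact ⟨r, hr.symm⟩

/-- The submodule of 2-covectors vanishing on a pair of vectors. -/
def vanishing {V : Type*} [AddCommGroup V] [Module ℝ V] [TopologicalSpace V] (x y : V) :
    Submodule ℝ (V [⋀^Fin 2]→L[ℝ] ℝ) where
  carrier := {Φ | Φ ![x, y] = 0}
  add_mem' {Φ Ψ} (h : Φ _ = 0) (h' : Ψ _ = 0) := by
    change Φ ![x, y] + Ψ ![x, y] = 0
    rw [h, h', add_zero]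
  zero_mem' := rfl
  smul_mem' c Φ (h : Φ _ = 0) := by
    change c * Φ ![x, y] = 0
    rw [h, mul_zero]

theorem idealTwo_le_vanishing {V : Type*} [AddCommGroup V] [Module ℝ V] [TopologicalSpace V]
    {S : Set (V [⋀^Fin 1]→L[ℝ] ℝ)} {x y : V} (hx : ∀ σ ∈ S, σ ![x] = 0) (hy : ∀ σ ∈ S, σ ![y] = 0) :
    idealTwo S ≤ vanishing x y := by
  refine Submodule.span_le.2 ?_
  rintro _ ⟨σ, hσ, τ, rfl⟩
  change wedge σ τ ![x, y] = 0
  rw [wedge_apply]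
  change σ ![x] * τ ![y] - σ ![y] * τ ![x] = 0
  rw [hx σ hσ, hy σ hσ]
  ring

theorem eq_zero_of_mem_waveTwo {m x y : E 5} (hx : waveContact m ![x] = 0)
    (hy : waveContact m ![y] = 0) (h₁ : area (xp x) (xp y) = 0) (h₂ : area (yq x) (yq y) = 0)
    {Φ : E 5 [⋀^Fin 2]→L[ℝ] ℝ}
    (hΦ : Φ ∈ waveTwo m) : Φ ![x, y] = 0 := by
  have hle : waveTwo m ≤ vanishing x y := by
    refine sup_le (Submodule.span_le.2 ?_) (idealTwo_le_vanishing ?_ ?_)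
    · simp only [area, xp, yq] at h₁ h₂
      rintro _ (rfl | rfl)
      · change wedge (dcoord 3) (dcoord 0) ![x, y] = 0
        rw [wedge_dcoord_apply]
        linarith
      · change wedge (dcoord 4) (dcoord 1) ![x, y] = 0
        rw [wedge_dcoord_apply]
        linarith
    · rintro _ rfl
      exact hx
    · rintro _ rfl
      exact hy
  exact hle hΦ

theorem pull_mfderiv_eq_zero_iff {k n l : ℕ} {s : E n → E l} {u : E n} {φ : E l [⋀^Fin k]→L[ℝ] ℝ} :
    (pull (mfderiv (𝓡 n) (𝓡 l) s u) φ : TangentSpace (𝓡 n) u [⋀^Fin k]→L[ℝ] ℝ) = 0 ↔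
      ∀ x : Fin k → E n, φ (fun i => fderiv ℝ s u (x i)) = 0 := by
  rw [mfderiv_eq_fderiv]
  exact ⟨fun h x => DFunLike.congr_fun h x, fun h => ContinuousAlternatingMap.ext h⟩

/-- Integral surfaces of the wave equation in terms of coordinates. -/
theorem isIntegralSurface_waveIdeal_iff {Ω : Set (E 2)} {s : E 2 → E 5} :
    IsIntegralSurface waveIdeal Ω s ↔ ContDiffOn ℝ ∞ s Ω ∧ ∀ u ∈ Ω,
      (∀ v, fderiv ℝ s u v = 0 → v = 0) ∧
      (∀ v, fderiv ℝ s u v 2 = s u 3 * fderiv ℝ s u v 0 + s u 4 * fderiv ℝ s u v 1) ∧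
      ∀ v w, area (xp (fderiv ℝ s u v)) (xp (fderiv ℝ s u w)) = 0 ∧
        area (yq (fderiv ℝ s u v)) (yq (fderiv ℝ s u w)) = 0 := by
  constructor
  · intro h
    have h2 : ∀ u ∈ Ω, ∀ φ : E 5 [⋀^Fin 2]→L[ℝ] ℝ,
        φ ∈ waveTwo (s u) → ∀ v w,
        φ ![fderiv ℝ s u v, fderiv ℝ s u w] = 0 := by
      intro u hu φ hφ v w
      have h3 := pull_mfderiv_eq_zero_iff.1 (h.deg2 u hu φ hφ) ![v, w]
      rwa [eq_vec2 fun i => fderiv ℝ s u (![v, w] i)] at h3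
    refine ⟨contMDiffOn_iff_contDiffOn.1 h.smooth, fun u hu => ⟨fun v hv => ?_, fun v => ?_,
      fun v w => ⟨?_, ?_⟩⟩⟩
    · have h1 := h.immersion u hu
      rw [mfderiv_eq_fderiv] at h1
      exact h1 (hv.trans (map_zero _).symm)
    · have h3 := pull_mfderiv_eq_zero_iff.1 (h.deg1 u hu _ (waveContact_mem (s u))) ![v]
      rw [eq_vec1 fun i => fderiv ℝ s u (![v] i), waveContact_apply] at h3
      change fderiv ℝ s u v 2 - s u 3 * fderiv ℝ s u v 0 - s u 4 * fderiv ℝ s u v 1 = 0 at h3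
      linarith
    · have h3 := h2 u hu _ (wedge_mem_waveTwo (s u)).1 v w
      rw [wedge_dcoord_apply] at h3
      simp only [area, xp]
      linarith
    · have h3 := h2 u hu _ (wedge_mem_waveTwo (s u)).2 v w
      rw [wedge_dcoord_apply] at h3
      simp only [area, yq]
      linarith
  · rintro ⟨hs, h⟩
    have hcontact : ∀ u ∈ Ω, ∀ v, waveContact (s u) ![fderiv ℝ s u v] = 0 := by
      intro u hu v
      rw [waveContact_apply]
      linarith [(h u hu).2.1 v]
    refine ⟨contMDiffOn_iff_contDiffOn.2 hs, fun u hu => ?_, fun u hu α hα => ?_,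
      fun u hu Φ hΦ => ?_⟩
    · rw [mfderiv_eq_fderiv]
      exact (injective_iff_map_eq_zero (fderiv ℝ s u)).2 (h u hu).1
    · obtain ⟨r, rfl⟩ := exists_eq_smul_of_mem_waveOne hα
      refine pull_mfderiv_eq_zero_iff.2 fun x => ?_
      rw [eq_vec1 fun i => fderiv ℝ s u (x i)]
      change r * waveContact (s u) ![fderiv ℝ s u (x 0)] = 0
      rw [hcontact u hu, mul_zero]
    · refine pull_mfderiv_eq_zero_iff.2 fun x => ?_
      rw [eq_vec2 fun i => fderiv ℝ s u (x i)]
      exact eq_zero_of_mem_waveTwo (hcontact u hu _) (hcontact u hu _) ((h u hu).2.2 _ _).1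
        ((h u hu).2.2 _ _).2 hΦ

/-- Differentiate `f.symm ∘ f = id` at `a`. -/
theorem fderiv_ne_zero_of_localDiffeo {V W : Type*} [NormedAddCommGroup V] [NormedSpace ℝ V]
    [NormedAddCommGroup W] [NormedSpace ℝ W] {f : OpenPartialHomeomorph V W}
    (hf : ContDiffOn ℝ ∞ f f.source) (hf' : ContDiffOn ℝ ∞ f.symm f.target) {a x : V}
    (ha : a ∈ f.source) (hx : fderiv ℝ f a x = 0) : x = 0 := by
  have h1 : HasFDerivAt (fun a => f.symm (f a)) _ a :=
    (ContDiffOn.differentiableAt_of_isOpen hf' f.open_target (f.map_source ha)).hasFDerivAt.comp a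
      (ContDiffOn.differentiableAt_of_isOpen hf f.open_source ha).hasFDerivAt
  have h2 : HasFDerivAt (fun a => f.symm (f a)) (ContinuousLinearMap.id ℝ V) a :=
    (hasFDerivAt_id a).congr_of_eventuallyEq
      (eventually_mem_isOpen f.open_source ha fun _ hb => f.left_inv hb)
  have := congrArg (fun l => l x) (h1.unique h2)
  simpa [hx] using this.symm

/-- Solutions corresponding to a given one are obtained by quadrature. -/
theorem solvedByQuadrature {f g : OpenPartialHomeomorph (ℝ × ℝ) (ℝ × ℝ)}
    (hf : ContDiffOn ℝ ∞ f f.source) (hf' : ContDiffOn ℝ ∞ f.symm f.target)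
    (hg : ContDiffOn ℝ ∞ g g.source) (hg' : ContDiffOn ℝ ∞ g.symm g.target) :
    SolvedByQuadrature f g := by
  intro Ω s u₀ hΩ hconv hu₀ hs hdom σ
  obtain ⟨hss, hs⟩ := isIntegralSurface_waveIdeal_iff.1 hs
  have hsc : ∀ i, ContDiffOn ℝ ∞ (fun u => s u i) Ω := contDiffOn_euclidean.1 hss
  have hd : ∀ {H : Type} [NormedAddCommGroup H] [NormedSpace ℝ H] {f : E 2 → H},
      ContDiffOn ℝ ∞ f Ω → ∀ z ∈ Ω, DifferentiableAt ℝ f z := fun hf z hz =>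
    ContDiffOn.differentiableAt_of_isOpen hf hΩ hz
  set X : E 2 → ℝ × ℝ := fun u => f (xp (s u)) with hX
  set Y : E 2 → ℝ × ℝ := fun u => g (yq (s u)) with hY
  have hxs : ContDiffOn ℝ ∞ (fun u => xp (s u)) Ω := (hsc 0).prodMk (hsc 3)
  have hys : ContDiffOn ℝ ∞ (fun u => yq (s u)) Ω := (hsc 1).prodMk (hsc 4)
  have hXs : ContDiffOn ℝ ∞ X Ω := hf.comp hxs fun u hu => (hdom u hu).1
  have hYs : ContDiffOn ℝ ∞ Y Ω := hg.comp hys fun u hu => (hdom u hu).2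
  have hXd : ∀ u ∈ Ω, ∀ v, fderiv ℝ X u v = fderiv ℝ f (xp (s u)) (xp (fderiv ℝ s u v)) := by
    intro u hu v
    have h1 : HasFDerivAt (fun u => xp (s u)) _ u :=
      (hd (hsc 0) u hu).hasFDerivAt.prodMk (hd (hsc 3) u hu).hasFDerivAt
    have h2 : HasFDerivAt X _ u := (ContDiffOn.differentiableAt_of_isOpen hf f.open_source
      (hdom u hu).1).hasFDerivAt.comp u h1
    rw [h2.fderiv]
    simp [xp, fderiv_coord (hd hss u hu)]
  have hYd : ∀ u ∈ Ω, ∀ v, fderiv ℝ Y u v = fderiv ℝ g (yq (s u)) (yq (fderiv ℝ s u v)) := by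
    intro u hu v
    have h1 : HasFDerivAt (fun u => yq (s u)) _ u :=
      (hd (hsc 1) u hu).hasFDerivAt.prodMk (hd (hsc 4) u hu).hasFDerivAt
    have h2 : HasFDerivAt Y _ u := (ContDiffOn.differentiableAt_of_isOpen hg g.open_source
      (hdom u hu).2).hasFDerivAt.comp u h1
    rw [h2.fderiv]
    simp [yq, fderiv_coord (hd hss u hu)]
  -- On a solution dx∧dp vanishes, and `f` multiplies it by its Jacobian. The same holds for dy∧dq
  -- under `g`, and these two identities are the closedness of the form to be integrated.
  have hX0 : ∀ u ∈ Ω, ∀ v w, area (fderiv ℝ X u v) (fderiv ℝ X u w) = 0 := by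
    intro u hu v w
    rw [hXd u hu, hXd u hu, area_map, ((hs u hu).2.2 v w).1, mul_zero]
  have hY0 : ∀ u ∈ Ω, ∀ v w, area (fderiv ℝ Y u v) (fderiv ℝ Y u w) = 0 := by
    intro u hu v w
    rw [hYd u hu, hYd u hu, area_map, ((hs u hu).2.2 v w).2, mul_zero]
  have hd1 : ∀ {h : E 2 → ℝ × ℝ}, ContDiffOn ℝ ∞ h Ω → ∀ u ∈ Ω, ∀ v,
      fderiv ℝ (fun w => (h w).1) u v = (fderiv ℝ h u v).1 := fun hh u hu v => by
    rw [(hd hh u hu).hasFDerivAt.fst.fderiv]; rfl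
  have hd2 : ∀ {h : E 2 → ℝ × ℝ}, ContDiffOn ℝ ∞ h Ω → ∀ u ∈ Ω, ∀ v,
      fderiv ℝ (fun w => (h w).2) u v = (fderiv ℝ h u v).2 := fun hh u hu v => by
    rw [(hd hh u hu).hasFDerivAt.snd.fderiv]; rfl
  -- the form to be integrated is closed
  set τ : E 2 → E 2 →L[ℝ] ℝ := quadratureForm f g s with hτ
  have hτ' : τ = fun u => (X u).2 • fderiv ℝ (fun w => (X w).1) u +
      (Y u).2 • fderiv ℝ (fun w => (Y w).1) u := rfl
  have sX : ContDiffOn ℝ ∞ (fderiv ℝ fun w => (X w).1) Ω := hXs.fst.fderiv_of_isOpen hΩ (by simp)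
  have sY : ContDiffOn ℝ ∞ (fderiv ℝ fun w => (Y w).1) Ω := hYs.fst.fderiv_of_isOpen hΩ (by simp)
  have hτs : ContDiffOn ℝ ∞ τ Ω := (hXs.snd.smul sX).add (hYs.snd.smul sY)
  have hclosed : ∀ u ∈ Ω, ∀ v w, ed τ u v w = 0 := by
    intro u hu v w
    rw [hτ', ed_add ((hd hXs.snd u hu).fun_smul (hd sX u hu))
      ((hd hYs.snd u hu).fun_smul (hd sY u hu)), ed_smul (hd hXs.snd u hu) (hd sX u hu),
      ed_smul (hd hYs.snd u hu) (hd sY u hu), ed_fderiv (hXs.fst.contDiffAt (hΩ.mem_nhds hu)),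
      ed_fderiv (hYs.fst.contDiffAt (hΩ.mem_nhds hu))]
    have e1 := hX0 u hu v w
    have e2 := hY0 u hu v w
    simp only [area] at e1 e2
    simp only [wdg, hd1 hXs u hu, hd2 hXs u hu, hd1 hYs u hu, hd2 hYs u hu]
    linarith
  set I : E 2 → ℝ := fun u => curveIntegral τ (Path.segment u₀ u) with hI
  have hId : ∀ u ∈ Ω, HasFDerivAt I (τ u) u := fun u hu =>
    (hconv.hasFDerivWithinAt_curveIntegral_segment_of_hasFDerivWithinAt_symmetric
      (fun x hx => (hd hτs x hx).hasFDerivAt.hasFDerivWithinAt)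
      (fun a ha x _ y _ => sub_eq_zero.1 (hclosed a ha x y)) hu₀ hu).hasFDerivAt (hΩ.mem_nhds hu)
  have hIs : ContDiffOn ℝ ∞ I Ω := (contDiffOn_infty_iff_fderiv_of_isOpen hΩ).2
    ⟨fun z hz => (hId z hz).differentiableAt.differentiableWithinAt,
      hτs.congr fun z hz => (hId z hz).fderiv⟩
  have hτv : ∀ u ∈ Ω, ∀ v, τ u v = (X u).2 * (fderiv ℝ X u v).1 + (Y u).2 * (fderiv ℝ Y u v).1 := by
    intro u hu v
    rw [hτ']
    simp [hd1 hXs u hu, hd1 hYs u hu]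
  constructor
  · rintro ⟨hσ, hB⟩
    obtain ⟨hσs, hσ⟩ := isIntegralSurface_waveIdeal_iff.1 hσ
    have hX2 : ∀ u ∈ Ω, X u = xp (σ u) := fun u hu => (hB u hu).2.2.1.symm
    have hY2 : ∀ u ∈ Ω, Y u = yq (σ u) := fun u hu => (hB u hu).2.2.2.symm
    have hσc : ∀ i, ContDiffOn ℝ ∞ (fun u => σ u i) Ω := contDiffOn_euclidean.1 hσs
    have hX3 : ∀ u ∈ Ω, ∀ v, (fderiv ℝ X u v).1 = fderiv ℝ σ u v 0 := by
      intro u hu v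
      have h1 : (fun w => (X w).1) =ᶠ[𝓝 u] fun w => σ w 0 :=
        eventually_mem_isOpen hΩ hu fun w hw => congrArg Prod.fst (hX2 w hw)
      rw [← hd1 hXs u hu, h1.fderiv_eq, fderiv_coord (hd hσs u hu)]
    have hY3 : ∀ u ∈ Ω, ∀ v, (fderiv ℝ Y u v).1 = fderiv ℝ σ u v 1 := by
      intro u hu v
      have h1 : (fun w => (Y w).1) =ᶠ[𝓝 u] fun w => σ w 1 :=
        eventually_mem_isOpen hΩ hu fun w hw => congrArg Prod.fst (hY2 w hw)
      rw [← hd1 hYs u hu, h1.fderiv_eq, fderiv_coord (hd hσs u hu)]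
    -- The third coordinate of `σ` and the quadrature have the same derivative on the connected set
    -- `Ω`. At `u₀` the segment is trivial, so the constant is the value of that coordinate there.
    refine ⟨σ u₀ 2, fun u hu => ?_⟩
    have hconst : EqOn (fun u => σ u 2) (fun u => σ u₀ 2 + I u) Ω := by
      refine hΩ.eqOn_of_fderiv_eq hconv.isPreconnected
        (fun z hz => (hd (hσc 2) z hz).differentiableWithinAt)
        (fun z hz => ((hId z hz).const_add _).differentiableAt.differentiableWithinAt)
        (fun z hz => ?_) hu₀ ?_
      · rw [((hId z hz).const_add (σ u₀ 2)).fderiv]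
        ext v
        have e1 : (X z).2 = σ z 3 := congrArg Prod.snd (hX2 z hz)
        have e2 : (Y z).2 = σ z 4 := congrArg Prod.snd (hY2 z hz)
        rw [← fderiv_coord (hd hσs z hz), (hσ z hz).2.1, hτv z hz, hX3 z hz, hY3 z hz, e1, e2]
      · simp [hI]
    ext i
    fin_cases i
    exacts [(congrArg Prod.fst (hX2 u hu)).symm, (congrArg Prod.fst (hY2 u hu)).symm,
      hconst hu, (congrArg Prod.snd (hX2 u hu)).symm, (congrArg Prod.snd (hY2 u hu)).symm]
  · rintro ⟨c, hc⟩
    have hσc : ∀ u ∈ Ω, σ u 0 = (X u).1 ∧ σ u 1 = (Y u).1 ∧ σ u 2 = c + I u ∧ σ u 3 = (X u).2 ∧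
        σ u 4 = (Y u).2 := by
      intro u hu
      rw [hc u hu]
      exact ⟨rfl, rfl, rfl, rfl, rfl⟩
    have hσs : ContDiffOn ℝ ∞ σ Ω := by
      rw [contDiffOn_euclidean]
      intro i
      fin_cases i
      · exact hXs.fst.congr fun u hu => (hσc u hu).1
      · exact hYs.fst.congr fun u hu => (hσc u hu).2.1
      · exact (contDiffOn_const.add hIs).congr fun u hu => (hσc u hu).2.2.1
      · exact hXs.snd.congr fun u hu => (hσc u hu).2.2.2.1
      · exact hYs.snd.congr fun u hu => (hσc u hu).2.2.2.2
    have hder : ∀ {i : Fin 5} {h : E 2 → ℝ}, (∀ u ∈ Ω, σ u i = h u) → ∀ u ∈ Ω, ∀ v,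
        fderiv ℝ σ u v i = fderiv ℝ h u v := by
      intro i h hi u hu v
      have h1 : (fun w => σ w i) =ᶠ[𝓝 u] h := eventually_mem_isOpen hΩ hu hi
      rw [fderiv_coord (hd hσs u hu), h1.fderiv_eq]
    have hσx : ∀ u ∈ Ω, ∀ v, xp (fderiv ℝ σ u v) = fderiv ℝ X u v := fun u hu v =>
      Prod.ext ((hder (fun u hu => (hσc u hu).1) u hu v).trans (hd1 hXs u hu v))
        ((hder (fun u hu => (hσc u hu).2.2.2.1) u hu v).trans (hd2 hXs u hu v))
    have hσy : ∀ u ∈ Ω, ∀ v, yq (fderiv ℝ σ u v) = fderiv ℝ Y u v := fun u hu v =>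
      Prod.ext ((hder (fun u hu => (hσc u hu).2.1) u hu v).trans (hd1 hYs u hu v))
        ((hder (fun u hu => (hσc u hu).2.2.2.2) u hu v).trans (hd2 hYs u hu v))
    refine ⟨isIntegralSurface_waveIdeal_iff.2 ⟨hσs, fun u hu => ⟨fun v hv => ?_, fun v => ?_,
      fun v w => ?_⟩⟩, fun u hu => ⟨(hdom u hu).1, (hdom u hu).2,
        Prod.ext (hσc u hu).1 (hσc u hu).2.2.2.1, Prod.ext (hσc u hu).2.1 (hσc u hu).2.2.2.2⟩⟩
    -- Injectivity of `Df` and `Dg` carries a kernel vector of `Dσ` back to one killed by the x, p,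
    -- y, q components of `Ds`; the contact relation then kills the z component as well.
    · have e1 := hσx u hu v
      have e2 := hσy u hu v
      rw [hv, hXd u hu] at e1
      rw [hv, hYd u hu] at e2
      have e3 := fderiv_ne_zero_of_localDiffeo hf hf' (hdom u hu).1 e1.symm
      have e4 := fderiv_ne_zero_of_localDiffeo hg hg' (hdom u hu).2 e2.symm
      have k0 : fderiv ℝ s u v 0 = 0 := congrArg Prod.fst e3
      have k1 : fderiv ℝ s u v 1 = 0 := congrArg Prod.fst e4
      have k3 : fderiv ℝ s u v 3 = 0 := congrArg Prod.snd e3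
      have k4 : fderiv ℝ s u v 4 = 0 := congrArg Prod.snd e4
      have k2 := (hs u hu).2.1 v
      rw [k0, k1, mul_zero, mul_zero, add_zero] at k2
      refine (hs u hu).1 v ?_
      ext i
      fin_cases i
      exacts [k0, k1, k2, k3, k4]
    · have e2 := hder (fun u hu => (hσc u hu).2.2.1) u hu v
      have e0 : fderiv ℝ σ u v 0 = (fderiv ℝ X u v).1 := congrArg Prod.fst (hσx u hu v)
      have e1 : fderiv ℝ σ u v 1 = (fderiv ℝ Y u v).1 := congrArg Prod.fst (hσy u hu v)
      rw [e2, ((hId u hu).const_add c).fderiv, hτv u hu, e0, e1, (hσc u hu).2.2.2.1,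
        (hσc u hu).2.2.2.2]
    · rw [hσx u hu, hσx u hu, hσy u hu, hσy u hu]
      exact ⟨hX0 u hu v w, hY0 u hu v w⟩

end Backlund

/-! ### Differential forms in charts -/

namespace Backlund

open Set Filter

section Covectors

variable {V W : Type*} [NormedAddCommGroup V] [NormedSpace ℝ V] [NormedAddCommGroup W]
  [NormedSpace ℝ W]

/-- Alternating 1-forms as covectors. -/
noncomputable def one : (V [⋀^Fin 1]→L[ℝ] ℝ) ≃L[ℝ] (V →L[ℝ] ℝ) :=
  (ContinuousAlternatingMap.ofSubsingletonLIE (𝕜 := ℝ) (E := V) (F := ℝ) (0 : Fin 1)).symm.toContinuousLinearEquiv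

theorem one_apply (α : V [⋀^Fin 1]→L[ℝ] ℝ) (v : V) : one α v = α ![v] := by
  rw [eq_vec1 (![v])]
  obtain ⟨a, rfl⟩ := (ContinuousAlternatingMap.ofSubsingletonLIE (𝕜 := ℝ) (E := V) (F := ℝ) (0 : Fin 1)).surjective α
  simp [one]

theorem one_symm_apply (a : V →L[ℝ] ℝ) (v : Fin 1 → V) : one.symm a v = a (v 0) := by
  have h := one_apply (one.symm a) (v 0)
  rw [ContinuousLinearEquiv.apply_symm_apply, ← eq_vec1] at h
  exact h.symm

/-- Alternating 2-forms as bilinear forms. -/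
noncomputable def two : (V [⋀^Fin 2]→L[ℝ] ℝ) →L[ℝ] (V →L[ℝ] V →L[ℝ] ℝ) :=
  (ContinuousLinearMap.compL ℝ V (V [⋀^Fin 1]→L[ℝ] ℝ) (V →L[ℝ] ℝ)
    (one : (V [⋀^Fin 1]→L[ℝ] ℝ) ≃L[ℝ] (V →L[ℝ] ℝ)).toContinuousLinearMap).comp
    (ContinuousAlternatingMap.curryLeftLI (𝕜 := ℝ) (E := V) (F := ℝ) (n := 1)).toContinuousLinearMap

theorem two_apply (Φ : V [⋀^Fin 2]→L[ℝ] ℝ) (v w : V) : two Φ v w = Φ ![v, w] := by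
  change one (Φ.curryLeft v) w = _
  rw [one_apply]
  rfl

/-- In degree one the alternating sum has two terms, and they are those of `ed`. -/
theorem extDeriv_one_symm (α : V → V [⋀^Fin 1]→L[ℝ] ℝ) {x : V} (hα : DifferentiableAt ℝ α x)
    (v w : V) : extDeriv α x ![v, w] = ed (fun y => one (α y)) x v w := by
  have h : fderiv ℝ (fun y => one (α y)) x =
      ((one : (V [⋀^Fin 1]→L[ℝ] ℝ) ≃L[ℝ] (V →L[ℝ] ℝ)) : _ →L[ℝ] _).comp (fderiv ℝ α x) :=
    (one.toContinuousLinearMap.hasFDerivAt.comp x hα.hasFDerivAt).fderiv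
  rw [ed_apply, h]
  change _ = one (fderiv ℝ α x v) w - one (fderiv ℝ α x w) v
  rw [one_apply, one_apply, extDeriv, ContinuousAlternatingMap.alternatizeUncurryFin_apply,
    Fin.sum_univ_two]
  have h0 : (0 : Fin 2).removeNth ![v, w] = ![w] := by ext i; fin_cases i; rfl
  have h1 : (1 : Fin 2).removeNth ![v, w] = ![v] := by ext i; fin_cases i; rfl
  rw [h0, h1]
  simp [sub_eq_add_neg]

end Covectors

section Charts

variable {n k : ℕ} {M : Type*} [TopologicalSpace M] [ChartedSpace (E n) M]
  {l : ℕ} {M' : Type*} [TopologicalSpace M'] [ChartedSpace (E l) M']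

/-- The derivative of a map between manifolds, with its values in the model spaces. -/
noncomputable def tangent (f : M → M') (x : M) : E n →L[ℝ] E l := mfderiv (𝓡 n) (𝓡 l) f x

/-- The derivative of the inverse of the preferred chart at `x₀`. -/
noncomputable def dpar (x₀ : M) (y : E n) : E n →L[ℝ] E n :=
  mfderiv 𝓘(ℝ, E n) (𝓡 n) (extChartAt (𝓡 n) x₀).symm y

/-- A form at a point, on the model space. -/
def formAt (φ : Form n k M) (x : M) : E n [⋀^Fin k]→L[ℝ] ℝ := φ x

/-- The coordinate expression of a map between manifolds. -/
noncomputable def coordMap (f : M → M') (x₀ : M) (x₁ : M') : E n → E l :=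
  fun y => extChartAt (𝓡 l) x₁ (f ((extChartAt (𝓡 n) x₀).symm y))

/-- A 1-form in a chart. -/
noncomputable def flatOne (φ : Form n 1 M) (x₀ : M) (y : E n) : E n →L[ℝ] ℝ :=
  one (chartRep φ x₀ y)

/-- A 2-form in a chart. -/
noncomputable def flatTwo (φ : Form n 2 M) (x₀ : M) (y : E n) : E n →L[ℝ] E n →L[ℝ] ℝ :=
  two (chartRep φ x₀ y)

theorem chartRep_apply (φ : Form n k M) (x₀ : M) (y : E n) (v : Fin k → E n) :
    chartRep φ x₀ y v = formAt φ ((extChartAt (𝓡 n) x₀).symm y) (fun i => dpar x₀ y (v i)) := rfl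

theorem flatOne_apply (φ : Form n 1 M) (x₀ : M) (y v : E n) :
    flatOne φ x₀ y v = formAt φ ((extChartAt (𝓡 n) x₀).symm y) ![dpar x₀ y v] := by
  rw [flatOne, one_apply, chartRep_apply, eq_vec1 fun i => dpar x₀ y (![v] i)]
  rfl

theorem flatTwo_apply (φ : Form n 2 M) (x₀ : M) (y v w : E n) :
    flatTwo φ x₀ y v w =
      formAt φ ((extChartAt (𝓡 n) x₀).symm y) ![dpar x₀ y v, dpar x₀ y w] := by
  rw [flatTwo, two_apply, chartRep_apply, eq_vec2 fun i => dpar x₀ y (![v, w] i)]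
  rfl

theorem continuousAt_par (x₀ : M) {y : E n} (hy : y ∈ (extChartAt (𝓡 n) x₀).target) :
    ContinuousAt (extChartAt (𝓡 n) x₀).symm y :=
  (continuousOn_extChartAt_symm x₀).continuousAt
    ((isOpen_extChartAt_target x₀).mem_nhds hy)

variable [IsManifold (𝓡 n) ∞ M] [IsManifold (𝓡 l) ∞ M']

theorem contMDiffAt_par (x₀ : M) {y : E n} (hy : y ∈ (extChartAt (𝓡 n) x₀).target) :
    ContMDiffAt 𝓘(ℝ, E n) (𝓡 n) ∞ (extChartAt (𝓡 n) x₀).symm y :=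
  (contMDiffOn_extChartAt_symm x₀).contMDiffAt ((isOpen_extChartAt_target x₀).mem_nhds hy)

theorem contDiffAt_coordMap {f : M → M'} {x₀ : M} {x₁ : M'} {y : E n}
    (hy : y ∈ (extChartAt (𝓡 n) x₀).target)
    (hf : ContMDiffAt (𝓡 n) (𝓡 l) ∞ f ((extChartAt (𝓡 n) x₀).symm y))
    (hx₁ : f ((extChartAt (𝓡 n) x₀).symm y) ∈ (extChartAt (𝓡 l) x₁).source) :
    ContDiffAt ℝ ∞ (coordMap f x₀ x₁ : E n → E l) y := by
  rw [extChartAt_source] at hx₁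
  have h := (contMDiffAt_extChartAt' (I := 𝓡 l) (n := ∞) hx₁).comp y
    (hf.comp y (contMDiffAt_par x₀ hy))
  exact h.contDiffAt

/-- Chain rule for the two factorisations of one map from the model space to `M'`. It lets
pulled-back forms be evaluated in charts. -/
theorem dpar_coordMap {f : M → M'} {x₀ : M} {x₁ : M'} {y : E n}
    (hy : y ∈ (extChartAt (𝓡 n) x₀).target)
    (hf : ContMDiffAt (𝓡 n) (𝓡 l) ∞ f ((extChartAt (𝓡 n) x₀).symm y))
    (hx₁ : f ((extChartAt (𝓡 n) x₀).symm y) ∈ (extChartAt (𝓡 l) x₁).source) (v : E n) :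
    dpar x₁ (coordMap f x₀ x₁ y) (fderiv ℝ (coordMap f x₀ x₁ : E n → E l) y v) =
      tangent f ((extChartAt (𝓡 n) x₀).symm y) (dpar x₀ y v) := by
  have hc := (contDiffAt_coordMap hy hf hx₁).differentiableAt (by simp)
  have ht : coordMap f x₀ x₁ y ∈ (extChartAt (𝓡 l) x₁).target :=
    (extChartAt (𝓡 l) x₁).map_source hx₁
  have h1 : (fun y' => (extChartAt (𝓡 l) x₁).symm (coordMap f x₀ x₁ y')) =ᶠ[𝓝 y]
      fun y' => f ((extChartAt (𝓡 n) x₀).symm y') := by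
    have h2 : ContinuousAt (fun y' => f ((extChartAt (𝓡 n) x₀).symm y')) y :=
      ContinuousAt.comp (g := f) hf.continuousAt (continuousAt_par x₀ hy)
    filter_upwards [h2.preimage_mem_nhds ((isOpen_extChartAt_source x₁).mem_nhds hx₁)] with y' hy'
    exact (extChartAt (𝓡 l) x₁).left_inv hy'
  have h3 := h1.mfderiv_eq (I := 𝓘(ℝ, E n)) (I' := 𝓡 l)
  have h4 := mfderiv_comp y ((contMDiffAt_par x₁ ht).mdifferentiableAt (by simp))
    hc.mdifferentiableAt
  have h5 := mfderiv_comp y (hf.mdifferentiableAt (by simp))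
    ((contMDiffAt_par x₀ hy).mdifferentiableAt (by simp))
  rw [mfderiv_eq_fderiv] at h4
  have h6 := (h4.symm.trans h3).trans h5
  exact DFunLike.congr_fun h6 v

end Charts

end Backlund

/-! ### Change of chart -/

namespace Backlund

open Set Filter

section Charts

variable {n k : ℕ} {M : Type*} [TopologicalSpace M] [ChartedSpace (E n) M]

theorem tangent_id (x : M) (v : E n) : tangent (id : M → M) x v = v := by
  have h : tangent (id : M → M) x = ContinuousLinearMap.id ℝ (E n) := mfderiv_id
  rw [h]
  rfl

theorem par_coordMap_id {x₀ x₁ : M} {y : E n}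
    (hx₁ : (extChartAt (𝓡 n) x₀).symm y ∈ (extChartAt (𝓡 n) x₁).source) :
    (extChartAt (𝓡 n) x₁).symm (coordMap id x₀ x₁ y : E n) = (extChartAt (𝓡 n) x₀).symm y :=
  (extChartAt (𝓡 n) x₁).left_inv hx₁

theorem eventually_mem_chart {x₀ : M} {y : E n} (hy : y ∈ (extChartAt (𝓡 n) x₀).target) {U : Set M}
    (hU : IsOpen U) (hyU : (extChartAt (𝓡 n) x₀).symm y ∈ U) :
    ∀ᶠ y' in 𝓝 y, y' ∈ (extChartAt (𝓡 n) x₀).target ∧ (extChartAt (𝓡 n) x₀).symm y' ∈ U :=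
  Filter.Eventually.and ((isOpen_extChartAt_target x₀).mem_nhds hy)
    ((continuousAt_par x₀ hy).preimage_mem_nhds (hU.mem_nhds hyU))

variable [IsManifold (𝓡 n) ∞ M]

theorem dpar_coordMap_id {x₀ x₁ : M} {y : E n} (hy : y ∈ (extChartAt (𝓡 n) x₀).target)
    (hx₁ : (extChartAt (𝓡 n) x₀).symm y ∈ (extChartAt (𝓡 n) x₁).source) (v : E n) :
    dpar x₁ (coordMap id x₀ x₁ y) (fderiv ℝ (coordMap id x₀ x₁ : E n → E n) y v) = dpar x₀ y v := by
  rw [dpar_coordMap hy contMDiffAt_id hx₁]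
  exact tangent_id _ _

theorem flatOne_eq_pb {φ : Form n 1 M} {x₀ x₁ : M} {y : E n}
    (hy : y ∈ (extChartAt (𝓡 n) x₀).target)
    (hx₁ : (extChartAt (𝓡 n) x₀).symm y ∈ (extChartAt (𝓡 n) x₁).source) :
    flatOne φ x₀ y = pb (coordMap id x₀ x₁) (flatOne φ x₁) y := by
  ext v
  rw [pb_apply, flatOne_apply, flatOne_apply, dpar_coordMap_id hy hx₁, par_coordMap_id hx₁]

theorem chartRep_eq_comp {φ : Form n k M} {x₀ x₁ : M} {y : E n}
    (hy : y ∈ (extChartAt (𝓡 n) x₀).target)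
    (hx₁ : (extChartAt (𝓡 n) x₀).symm y ∈ (extChartAt (𝓡 n) x₁).source) :
    chartRep φ x₀ y = (chartRep φ x₁ (coordMap id x₀ x₁ y)).compContinuousLinearMap
      (fderiv ℝ (coordMap id x₀ x₁ : E n → E n) y) := by
  ext v
  change _ = chartRep φ x₁ (coordMap id x₀ x₁ y)
    fun i => fderiv ℝ (coordMap id x₀ x₁ : E n → E n) y (v i)
  simp only [chartRep_apply, dpar_coordMap_id hy hx₁, par_coordMap_id hx₁]

/-- Smoothness is defined at each point through the chart preferred there; the transition map
transports it to the fixed chart at `x₀`. -/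
theorem contDiffAt_flatOne {φ : Form n 1 M} {U : Set M} (hφ : SmoothFormOn φ U) {x₀ : M} {y : E n}
    (hy : y ∈ (extChartAt (𝓡 n) x₀).target) (hyU : (extChartAt (𝓡 n) x₀).symm y ∈ U) :
    ContDiffAt ℝ ∞ (flatOne φ x₀) y := by
  set x := (extChartAt (𝓡 n) x₀).symm y with hx
  have hxs : x ∈ (extChartAt (𝓡 n) x).source := mem_extChartAt_source x
  have hτ : ContDiffAt ℝ ∞ (coordMap id x₀ x : E n → E n) y :=
    contDiffAt_coordMap hy contMDiffAt_id hxs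
  have h1 : ContDiffAt ℝ ∞ (flatOne φ x) (coordMap id x₀ x y : E n) :=
    (one : (E n [⋀^Fin 1]→L[ℝ] ℝ) ≃L[ℝ] (E n →L[ℝ] ℝ)).contDiff.contDiffAt.comp _ (hφ x hyU)
  have h2 : ContDiffAt ℝ ∞ (pb (coordMap id x₀ x : E n → E n) (flatOne φ x)) y :=
    (h1.comp y hτ).clm_comp (hτ.fderiv_right (by simp))
  refine h2.congr_of_eventuallyEq ?_
  filter_upwards [eventually_mem_chart hy (isOpen_extChartAt_source x) hxs] with y' hy'
  exact flatOne_eq_pb hy'.1 hy'.2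

theorem differentiableAt_flatTwo {φ : Form n 2 M} {U : Set M} (hφ : SmoothFormOn φ U) {x₀ : M}
    {y : E n} (hy : y ∈ (extChartAt (𝓡 n) x₀).target)
    (hyU : (extChartAt (𝓡 n) x₀).symm y ∈ U) :
    DifferentiableAt ℝ (flatTwo φ x₀) y := by
  set x := (extChartAt (𝓡 n) x₀).symm y with hx
  have hxs : x ∈ (extChartAt (𝓡 n) x).source := mem_extChartAt_source x
  have hτ : ContDiffAt ℝ ∞ (coordMap id x₀ x : E n → E n) y :=
    contDiffAt_coordMap hy contMDiffAt_id hxs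
  have h0 : DifferentiableAt ℝ (chartRep φ x) (coordMap id x₀ x y : E n) :=
    (hφ x hyU).differentiableAt (by simp)
  have h1 : DifferentiableAt ℝ (fun y' => chartRep φ x (coordMap id x₀ x y' : E n)) y :=
    h0.comp y (hτ.differentiableAt (by simp))
  have h2 : DifferentiableAt ℝ (chartRep φ x₀) y := by
    refine (h1.continuousAlternatingMapCompContinuousLinearMap
      ((hτ.fderiv_right (m := ∞) (by simp)).differentiableAt (by simp))).congr_of_eventuallyEq ?_
    filter_upwards [eventually_mem_chart hy (isOpen_extChartAt_source x) hxs] with y' hy'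
    exact chartRep_eq_comp hy'.1 hy'.2
  exact DifferentiableAt.comp (G := E n →L[ℝ] E n →L[ℝ] ℝ) y
    (ContinuousLinearMap.differentiableAt (F := E n →L[ℝ] E n →L[ℝ] ℝ) two) h2

/-- The exterior derivative too is computed at each point in that point's own chart. Since `ed`
commutes with pullback along the transition map, the fixed chart gives the same value. -/
theorem formAt_d {φ : Form n 1 M} {U : Set M} (hφ : SmoothFormOn φ U) {x₀ : M} {y : E n}
    (hy : y ∈ (extChartAt (𝓡 n) x₀).target) (hyU : (extChartAt (𝓡 n) x₀).symm y ∈ U) (v w : E n) :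
    formAt (d φ) ((extChartAt (𝓡 n) x₀).symm y) ![dpar x₀ y v, dpar x₀ y w] =
      ed (flatOne φ x₀) y v w := by
  set x := (extChartAt (𝓡 n) x₀).symm y with hx
  have hxs : x ∈ (extChartAt (𝓡 n) x).source := mem_extChartAt_source x
  have hτ : ContDiffAt ℝ ∞ (coordMap id x₀ x : E n → E n) y :=
    contDiffAt_coordMap hy contMDiffAt_id hxs
  have h1 : DifferentiableAt ℝ (chartRep φ x) (coordMap id x₀ x y : E n) :=
    (hφ x hyU).differentiableAt (by simp)
  have h2 : DifferentiableAt ℝ (flatOne φ x) (coordMap id x₀ x y : E n) :=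
    (one : (E n [⋀^Fin 1]→L[ℝ] ℝ) ≃L[ℝ] (E n →L[ℝ] ℝ)).differentiableAt.comp _ h1
  have h3 : flatOne φ x₀ =ᶠ[𝓝 y] pb (coordMap id x₀ x : E n → E n) (flatOne φ x) := by
    filter_upwards [eventually_mem_chart hy (isOpen_extChartAt_source x) hxs] with y' hy'
    exact flatOne_eq_pb hy'.1 hy'.2
  have h4 : fderiv ℝ (coordMap id x₀ x : E n → E n) y =
      ((mfderiv (𝓡 n) 𝓘(ℝ, E n) (extChartAt (𝓡 n) x) x : E n →L[ℝ] E n)).comp (dpar x₀ y) := by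
    have h5 := mfderiv_comp y
      ((contMDiffAt_extChartAt (n := ∞) (I := 𝓡 n) (x := x)).mdifferentiableAt (by simp))
      ((contMDiffAt_par x₀ hy).mdifferentiableAt (by simp))
    rw [mfderiv_eq_fderiv] at h5
    exact h5
  rw [ed_congr h3, ed_pb hτ h2, h4]
  change _ = ed (fun y => one (chartRep φ x y)) _ _ _
  rw [← extDeriv_one_symm _ h1]
  change extDeriv (chartRep φ x) (extChartAt (𝓡 n) x x) (fun i : Fin 2 =>
    (mfderiv (𝓡 n) 𝓘(ℝ, E n) (extChartAt (𝓡 n) x) x : E n →L[ℝ] E n)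
      ((![dpar x₀ y v, dpar x₀ y w] : Fin 2 → E n) i)) = _
  rw [eq_vec2 fun i : Fin 2 => (mfderiv (𝓡 n) 𝓘(ℝ, E n) (extChartAt (𝓡 n) x) x : E n →L[ℝ] E n)
      ((![dpar x₀ y v, dpar x₀ y w] : Fin 2 → E n) i)]
  rfl

end Charts

end Backlund

/-! ### Ideals under linear isomorphisms -/

namespace Backlund

open Set Filter

section Ideals

variable {V W : Type*} [NormedAddCommGroup V] [NormedSpace ℝ V] [NormedAddCommGroup W]
  [NormedSpace ℝ W]

theorem pull_apply₁ (L : V →L[ℝ] W) (α : W [⋀^Fin 1]→L[ℝ] ℝ) (v : V) :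
    pull L α ![v] = α ![L v] := by
  change α (fun i => L ((![v] : Fin 1 → V) i)) = _
  rw [eq_vec1 fun i => L ((![v] : Fin 1 → V) i)]
  rfl

theorem pull_apply₂ (L : V →L[ℝ] W) (Φ : W [⋀^Fin 2]→L[ℝ] ℝ) (v w : V) :
    pull L Φ ![v, w] = Φ ![L v, L w] := by
  change Φ (fun i => L ((![v, w] : Fin 2 → V) i)) = _
  rw [eq_vec2 fun i => L ((![v, w] : Fin 2 → V) i)]
  rfl

theorem ext₁ {α β : V [⋀^Fin 1]→L[ℝ] ℝ} (h : ∀ v, α ![v] = β ![v]) : α = β := by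
  ext v
  rw [eq_vec1 v, h]

theorem ext₂ {Φ Ψ : V [⋀^Fin 2]→L[ℝ] ℝ} (h : ∀ v w, Φ ![v, w] = Ψ ![v, w]) : Φ = Ψ := by
  ext v
  rw [eq_vec2 v, h]

/-- If θ(e) = 1, evaluating Φ on v - θ(v)e and w - θ(w)e gives Φ = θ ∧ Φ(e, ·). If there is no such
e, then θ = 0 and Φ vanishes outright. -/
theorem mem_idealTwo_singleton {θ : V [⋀^Fin 1]→L[ℝ] ℝ} {Φ : V [⋀^Fin 2]→L[ℝ] ℝ}
    (h : ∀ v w, θ ![v] = 0 → θ ![w] = 0 → Φ ![v, w] = 0) : Φ ∈ idealTwo {θ} := by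
  by_cases hθ : ∃ e, θ ![e] = 1
  · obtain ⟨e, he⟩ := hθ
    refine Submodule.subset_span ⟨θ, rfl, one.symm (two Φ e), ext₂ fun v w => ?_⟩
    have h1 := h (v - θ ![v] • e) (w - θ ![w] • e)
    have h2 := two_apply Φ e e
    have h3 := two_apply Φ v e
    have h4 : Φ ![e, e] = 0 := Φ.map_eq_zero_of_eq _ (i := 0) (j := 1) rfl (by simp)
    have h5 : two Φ v e = - two Φ e v := by
      have h6 := two_apply Φ (v + e) (v + e)
      rw [Φ.map_eq_zero_of_eq _ (i := 0) (j := 1) rfl (by simp)] at h6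
      have h7 := two_apply Φ v v
      rw [Φ.map_eq_zero_of_eq _ (i := 0) (j := 1) rfl (by simp)] at h7
      simp only [map_add, add_apply] at h6
      rw [h2, h4, h7] at h6
      linarith
    rw [← two_apply] at h1
    simp only [← one_apply, map_sub, map_smul, sub_apply, smul_eq_mul,
      smul_apply] at h1 he
    simp only [he, mul_one, sub_self, h2, h4, forall_const, mul_zero, sub_zero] at h1
    rw [← two_apply, wedge_apply, one_symm_apply, one_symm_apply]
    simp only [Matrix.cons_val_zero, Matrix.cons_val_one, ← one_apply]
    rw [h5] at h1
    linarith
  · have h0 : ∀ v, θ ![v] = 0 := by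
      intro v
      by_contra hv
      refine hθ ⟨(θ ![v])⁻¹ • v, ?_⟩
      simp only [← one_apply, map_smul, smul_eq_mul] at hv ⊢
      exact inv_mul_cancel₀ hv
    have h1 : Φ = 0 := ext₂ fun v w => h v w (h0 v) (h0 w)
    rw [h1]
    exact Submodule.zero_mem _

theorem exists_coeff_of_mem {A B Φ : V [⋀^Fin 2]→L[ℝ] ℝ} {S : Set (V [⋀^Fin 1]→L[ℝ] ℝ)}
    (h : Φ ∈ Submodule.span ℝ {A, B} ⊔ idealTwo S) :
    ∃ s t : ℝ, ∀ v w, (∀ σ ∈ S, σ ![v] = 0) → (∀ σ ∈ S, σ ![w] = 0) →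
      Φ ![v, w] = s * A ![v, w] + t * B ![v, w] := by
  obtain ⟨X, hX, Y, hY, rfl⟩ := Submodule.mem_sup.1 h
  obtain ⟨s, t, rfl⟩ := Submodule.mem_span_pair.1 hX
  refine ⟨s, t, fun v w hv hw => ?_⟩
  have h1 : Y ![v, w] = 0 := idealTwo_le_vanishing hv hw hY
  change s * A ![v, w] + t * B ![v, w] + Y ![v, w] = _
  rw [h1, add_zero]

/-- Pullback respects wedge products; for the reverse inclusion the second factor is transported by
the inverse isomorphism. -/
theorem map_idealTwo (L : V ≃L[ℝ] W) (c : W [⋀^Fin 1]→L[ℝ] ℝ) :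
    (idealTwo {c}).map (pull (k := 2) (L : V →L[ℝ] W)) =
      idealTwo {pull (L : V →L[ℝ] W) c} := by
  have hw : ∀ τ : W [⋀^Fin 1]→L[ℝ] ℝ, pull (L : V →L[ℝ] W) (wedge c τ) =
      wedge (pull (L : V →L[ℝ] W) c) (pull (L : V →L[ℝ] W) τ) := fun τ => ext₂ fun v w => by
    simp only [pull_apply₂, wedge_apply, Matrix.cons_val_zero, Matrix.cons_val_one, pull_apply₁]
  rw [idealTwo, Submodule.map_span, idealTwo]
  congr 1
  ext Φ
  constructor
  · rintro ⟨_, ⟨_, rfl, τ, rfl⟩, rfl⟩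
    exact ⟨_, rfl, _, hw τ⟩
  · rintro ⟨_, rfl, τ, rfl⟩
    refine ⟨_, ⟨c, rfl, pull (L.symm : W →L[ℝ] V) τ, rfl⟩, ?_⟩
    rw [hw]
    congr 1
    exact ext₁ fun v => by rw [pull_apply₁, pull_apply₁]; simp

/-- Two ideals generated by a 1-form and two 2-forms correspond under a linear isomorphism if their
generators do so up to scaling, modulo the 1-forms. -/
theorem ideal_eq_map {L : V ≃L[ℝ] W} {c : W [⋀^Fin 1]→L[ℝ] ℝ} {A B : W [⋀^Fin 2]→L[ℝ] ℝ}
    {θ : V [⋀^Fin 1]→L[ℝ] ℝ} {Θ Ψ : V [⋀^Fin 2]→L[ℝ] ℝ} {r : ℝ} (hr : r ≠ 0)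
    (hc : ∀ v, c ![L v] = r * θ ![v]) {a b s t : ℝ} (hdet : s * b - t * a ≠ 0)
    (h : ∀ v w, θ ![v] = 0 → θ ![w] = 0 → Θ ![v, w] = a * A ![L v, L w] + b * B ![L v, L w] ∧
      Ψ ![v, w] = s * A ![L v, L w] + t * B ![L v, L w]) :
    Submodule.span ℝ {θ} = (Submodule.span ℝ {c}).map (pull (L : V →L[ℝ] W)) ∧
    Submodule.span ℝ {Θ, Ψ} ⊔ idealTwo {θ} =
      (Submodule.span ℝ {A, B} ⊔ idealTwo {c}).map (pull (L : V →L[ℝ] W)) := by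
  have hc' : pull (L : V →L[ℝ] W) c = r • θ := ext₁ fun v => by
    rw [pull_apply₁]
    exact hc v
  have hI : idealTwo {pull (L : V →L[ℝ] W) c} = idealTwo {θ} := by
    apply le_antisymm
    · refine Submodule.span_le.2 ?_
      rintro _ ⟨_, rfl, τ, rfl⟩
      refine mem_idealTwo_singleton fun v w hv hw => ?_
      rw [hc', wedge_apply]
      change r * θ ![v] * τ ![w] - r * θ ![w] * τ ![v] = 0
      rw [hv, hw]
      ring
    · refine Submodule.span_le.2 ?_
      rintro _ ⟨σ, hσ, τ, rfl⟩
      rw [mem_singleton_iff.1 hσ]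
      refine mem_idealTwo_singleton fun v w hv hw => ?_
      rw [hc'] at hv hw
      have hv' : θ ![v] = 0 := (mul_eq_zero.1 hv).resolve_left hr
      have hw' : θ ![w] = 0 := (mul_eq_zero.1 hw).resolve_left hr
      change θ ![v] * τ ![w] - θ ![w] * τ ![v] = 0
      rw [hv', hw']
      ring
  refine ⟨?_, ?_⟩
  · rw [Submodule.map_span, image_singleton, hc', Submodule.span_singleton_smul_eq hr.isUnit]
  · rw [Submodule.map_sup, map_idealTwo, hI, Submodule.map_span, image_pair]
    set A' := pull (L : V →L[ℝ] W) A with hA'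
    set B' := pull (L : V →L[ℝ] W) B with hB'
    have hA : A' ∈ Submodule.span ℝ {A', B'} ⊔ idealTwo {θ} :=
      Submodule.mem_sup_left (Submodule.subset_span (Or.inl rfl))
    have hB : B' ∈ Submodule.span ℝ {A', B'} ⊔ idealTwo {θ} :=
      Submodule.mem_sup_left (Submodule.subset_span (Or.inr rfl))
    have hΘ : Θ ∈ Submodule.span ℝ {Θ, Ψ} ⊔ idealTwo {θ} :=
      Submodule.mem_sup_left (Submodule.subset_span (Or.inl rfl))
    have hΨ : Ψ ∈ Submodule.span ℝ {Θ, Ψ} ⊔ idealTwo {θ} :=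
      Submodule.mem_sup_left (Submodule.subset_span (Or.inr rfl))
    have h1 : Θ - (a • A' + b • B') ∈ idealTwo {θ} := by
      refine mem_idealTwo_singleton fun v w hv hw => ?_
      change Θ ![v, w] - (a * A' ![v, w] + b * B' ![v, w]) = 0
      rw [hA', hB', pull_apply₂, pull_apply₂, (h v w hv hw).1]
      exact sub_self _
    have h2 : Ψ - (s • A' + t • B') ∈ idealTwo {θ} := by
      refine mem_idealTwo_singleton fun v w hv hw => ?_
      change Ψ ![v, w] - (s * A' ![v, w] + t * B' ![v, w]) = 0
      rw [hA', hB', pull_apply₂, pull_apply₂, (h v w hv hw).2]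
      exact sub_self _
    apply le_antisymm
    · refine sup_le (Submodule.span_le.2 ?_) le_sup_right
      rintro _ (rfl | rfl)
      · have h3 := Submodule.add_mem _ (Submodule.mem_sup_right h1)
          (Submodule.add_mem _ (Submodule.smul_mem _ a hA) (Submodule.smul_mem _ b hB))
        rwa [sub_add_cancel] at h3
      · have h3 := Submodule.add_mem _ (Submodule.mem_sup_right h2)
          (Submodule.add_mem _ (Submodule.smul_mem _ s hA) (Submodule.smul_mem _ t hB))
        rwa [sub_add_cancel] at h3
    · refine sup_le (Submodule.span_le.2 ?_) le_sup_right
      -- Cramer's rule: the two congruences are solved for `A'` and `B'` after multiplication by the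
      -- determinant.
      have key : ∀ X : V [⋀^Fin 2]→L[ℝ] ℝ, (s * b - t * a) • X ∈
          Submodule.span ℝ {Θ, Ψ} ⊔ idealTwo {θ} →
          X ∈ Submodule.span ℝ {Θ, Ψ} ⊔ idealTwo {θ} := fun X hX =>
        (Submodule.smul_mem_iff _ hdet).1 hX
      rintro _ (rfl | rfl)
      · refine key _ ?_
        have h3 := Submodule.sub_mem _
          (Submodule.sub_mem _ (Submodule.smul_mem _ b hΨ) (Submodule.smul_mem _ t hΘ))
          (Submodule.mem_sup_right (Submodule.sub_mem _ (Submodule.smul_mem _ b h2)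
            (Submodule.smul_mem _ t h1)))
        have h4 : (s * b - t * a) • A' = b • Ψ - t • Θ -
            (b • (Ψ - (s • A' + t • B')) - t • (Θ - (a • A' + b • B'))) := by
          module
        rw [h4]
        exact h3
      · refine key _ ?_
        have h3 := Submodule.sub_mem _
          (Submodule.sub_mem _ (Submodule.smul_mem _ s hΘ) (Submodule.smul_mem _ a hΨ))
          (Submodule.mem_sup_right (Submodule.sub_mem _ (Submodule.smul_mem _ s h1)
            (Submodule.smul_mem _ a h2)))
        have h4 : (s * b - t * a) • B' = s • Θ - a • Ψ -
            (s • (Θ - (a • A' + b • B')) - a • (Ψ - (s • A' + t • B'))) := by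
          module
        rw [h4]
        exact h3

end Ideals

end Backlund

/-! ### From adapted to characteristic coframings -/

namespace Backlund

open Set Filter

section Adapted

variable {V W : Type*} [NormedAddCommGroup V] [NormedSpace ℝ V] [NormedAddCommGroup W]
  [NormedSpace ℝ W]

/-- The exterior derivatives of proportional 1-forms are proportional on the kernel. -/
theorem exists_ed_eq_mul {α γ : V → V →L[ℝ] ℝ} {y : V} (hα : DifferentiableAt ℝ α y)
    (hγ : DifferentiableAt ℝ γ y) (h : ∀ᶠ z in 𝓝 y, ∃ l : ℝ, α z = l • γ z) (hy : α y ≠ 0) :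
    ∃ r : ℝ, r ≠ 0 ∧ ∀ v w, γ y v = 0 → γ y w = 0 → ed γ y v w = r * ed α y v w := by
  obtain ⟨l, hl⟩ := h.self_of_nhds
  have hl0 : l ≠ 0 := by
    rintro rfl
    rw [zero_smul] at hl
    exact hy hl
  obtain ⟨e, he⟩ : ∃ e, γ y e ≠ 0 := by
    by_contra! h'
    refine hy ?_
    ext v
    rw [hl]
    simp [h' v]
  -- The factor is only known to exist pointwise. Evaluation on a fixed `e` exhibits it as a
  -- differentiable function, so the product rule applies, and its extra term vanishes on the kernel
  -- of `γ`.
  have hf : DifferentiableAt ℝ (fun z => α z e / γ z e) y :=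
    (hα.clm_apply (differentiableAt_const e)).fun_mul
      ((hγ.clm_apply (differentiableAt_const e)).fun_inv he)
  have h1 : α =ᶠ[𝓝 y] fun z => (α z e / γ z e) • γ z := by
    have hc : ContinuousAt (fun z => γ z e) y :=
      (hγ.clm_apply (differentiableAt_const e)).continuousAt
    filter_upwards [h, hc.eventually_ne he] with z hz hze
    obtain ⟨l', hl'⟩ := hz
    rw [hl']
    change l' • γ z = (l' * γ z e / γ z e) • γ z
    rw [mul_div_cancel_right₀ _ hze]
  have h2 : α y e / γ y e = l := by
    rw [hl]
    exact mul_div_cancel_right₀ _ he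
  refine ⟨l⁻¹, inv_ne_zero hl0, fun v w hv hw => ?_⟩
  rw [ed_congr h1, ed_smul hf hγ, h2]
  simp only [wdg, hv, hw]
  field_simp
  ring

/-- A hyperbolic pencil of 2-forms spanned by two forms that are diagonal in a common frame contains
two independent forms. -/
theorem independent_of_hyperbolic {a c s t l₁ m₁ l₂ m₂ : ℝ} (ha : a ≠ 0)
    (hdet : l₁ * m₂ - l₂ * m₁ ≠ 0) (h₁ : (l₁ * a + m₁ * s) * (l₁ * c + m₁ * t) = 0)
    (h₂ : (l₂ * a + m₂ * s) * (l₂ * c + m₂ * t) = 0) (hc : c ≠ 0) : s * c - t * a ≠ 0 := by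
  intro h
  -- If (a, c) and (s, t) were proportional, the two linear factors would vanish together, and the
  -- quadratic equation would have a single root.
  have key : ∀ l m : ℝ, (l * a + m * s) * (l * c + m * t) = 0 → l * a + m * s = 0 := by
    intro l m hlm
    rcases mul_eq_zero.1 hlm with h' | h'
    · exact h'
    · have h3 : c * (l * a + m * s) = a * (l * c + m * t) := by linear_combination m * h
      rw [h', mul_zero] at h3
      exact (mul_eq_zero.1 h3).resolve_left hc
  have h3 : (l₁ * m₂ - l₂ * m₁) * a = 0 := by
    linear_combination m₂ * key l₁ m₁ h₁ - m₁ * key l₂ m₂ h₂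
  exact (mul_ne_zero hdet ha) h3

/-- The form `α` is only proportional to the pulled-back contact form, so kernels agree and the
structure equation is rescaled. The determinant condition comes from hyperbolicity: on four vectors
whose mixed pairings vanish, the wedge square of `G` is twice the product of the two remaining
values. This is why `hhyp` is phrased in that way. -/
theorem IsCharacteristicCoframing.of_adapted {N : Set V} {U : Set W} {p : V → W}
    {θ : W → W →L[ℝ] ℝ} {Ψ : W → W →L[ℝ] W →L[ℝ] ℝ} {α α' β : V → V →L[ℝ] ℝ}
    {κ : Fin 4 → V → V →L[ℝ] ℝ} (hN : IsOpen N) (hU : IsOpen U) (hp : ContDiffOn ℝ ∞ p N)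
    (hNU : MapsTo p N U) (hθ : ContDiffOn ℝ ∞ θ U) (hΨ : ∀ m ∈ U, DifferentiableAt ℝ Ψ m)
    (hβ : ContDiffOn ℝ ∞ β N) (hκ : ∀ i, ContDiffOn ℝ ∞ (κ i) N)
    (hα : ContDiffOn ℝ ∞ α N) (hαp : ∀ y ∈ N, ∃ l : ℝ, α y = l • pb p θ y)
    (hα0 : ∀ y ∈ N, α y ≠ 0) (hαβ : ∀ y ∈ N, ∃ l : ℝ, α' y = l • β y)
    (hα'0 : ∀ y ∈ N, α' y ≠ 0)
    (hframe : ∀ y ∈ N, ∃ e : Fin 4 → V, (∀ j, α y (e j) = 0 ∧ α' y (e j) = 0) ∧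
      ∀ i j, κ i y (e j) = if i = j then 1 else 0)
    (hco : ∀ y ∈ N, ∀ v, α y v = 0 → α' y v = 0 → (∀ i, κ i y v = 0) → v = 0)
    (hsurj : ∀ y ∈ N, Function.Surjective (fderiv ℝ p y))
    (hed : ∀ y ∈ N, ∃ a c : ℝ, a ≠ 0 ∧ c ≠ 0 ∧ ∀ v w, α y v = 0 → α y w = 0 →
      ed α y v w = a * wdg (κ 0 y) (κ 1 y) v w + c * wdg (κ 2 y) (κ 3 y) v w)
    (hΨκ : ∀ y ∈ N, ∃ s t : ℝ, ∀ v w, α y v = 0 → α y w = 0 → α' y v = 0 → α' y w = 0 →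
      Ψ (p y) (fderiv ℝ p y v) (fderiv ℝ p y w) =
        s * wdg (κ 0 y) (κ 1 y) v w + t * wdg (κ 2 y) (κ 3 y) v w)
    (hhyp : ∀ m ∈ U, ∃ l₁ m₁ l₂ m₂ : ℝ, l₁ * m₂ - l₂ * m₁ ≠ 0 ∧
      ∀ l r, (l = l₁ ∧ r = m₁ ∨ l = l₂ ∧ r = m₂) → ∀ G : W → W → ℝ,
        (∀ x y, G x y = l * ed θ m x y + r * Ψ m x y) → ∀ X : Fin 4 → W, (∀ i, θ m (X i) = 0) →
        G (X 0) (X 2) = 0 → G (X 0) (X 3) = 0 → G (X 1) (X 2) = 0 → G (X 1) (X 3) = 0 →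
        G (X 0) (X 1) * G (X 2) (X 3) = 0) :
    IsCharacteristicCoframing N U p θ Ψ β κ := by
  have hker : ∀ {α γ : V → V →L[ℝ] ℝ} {y : V}, (∃ l : ℝ, α y = l • γ y) → α y ≠ 0 →
      ∀ v, γ y v = 0 ↔ α y v = 0 := by
    rintro α γ y ⟨l, hl⟩ h0 v
    have hl0 : l ≠ 0 := by
      rintro rfl
      rw [zero_smul] at hl
      exact h0 hl
    rw [hl]
    change _ ↔ l * γ y v = 0
    simp [hl0]
  refine ⟨hN, hU, hp, hNU, hθ, hΨ, hβ, hκ, fun y hy v h1 h2 h3 => ?_, hsurj, fun y hy => ?_⟩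
  · exact hco y hy v ((hker (hαp y hy) (hα0 y hy) v).1 h1)
      ((hker (hαβ y hy) (hα'0 y hy) v).1 h2) h3
  have hk := hker (hαp y hy) (hα0 y hy)
  have hk' := hker (hαβ y hy) (hα'0 y hy)
  have hpy : ContDiffAt ℝ ∞ p y := hp.contDiffAt (hN.mem_nhds hy)
  have hθy : DifferentiableAt ℝ θ (p y) := ContDiffOn.differentiableAt_of_isOpen hθ hU (hNU hy)
  obtain ⟨r, hr, hr'⟩ := exists_ed_eq_mul (ContDiffOn.differentiableAt_of_isOpen hα hN hy)
    (ContDiffOn.differentiableAt_of_isOpen (contDiffOn_pb hN hp hθ hNU) hN hy)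
    (by filter_upwards [hN.mem_nhds hy] with z hz using hαp z hz) (hα0 y hy)
  obtain ⟨a, c, ha, hc, hac⟩ := hed y hy
  obtain ⟨s, t, hst⟩ := hΨκ y hy
  have hst' : ∀ v w, α y v = 0 → α y w = 0 → ed (pb p θ) y v w =
      r * a * wdg (κ 0 y) (κ 1 y) v w + r * c * wdg (κ 2 y) (κ 3 y) v w := by
    intro v w hv hw
    rw [hr' v w ((hk v).2 hv) ((hk w).2 hw), hac v w hv hw]
    ring
  refine ⟨r * a, r * c, s, t, mul_ne_zero hr ha, mul_ne_zero hr hc, ?_, ?_, ?_⟩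
  · obtain ⟨l₁, m₁, l₂, m₂, hdet, hsq⟩ := hhyp (p y) (hNU hy)
    obtain ⟨e, he, heκ⟩ := hframe y hy
    have key : ∀ l m, (l = l₁ ∧ m = m₁ ∨ l = l₂ ∧ m = m₂) →
        (l * (r * a) + m * s) * (l * (r * c) + m * t) = 0 := by
      intro l m hlm
      have hG : ∀ i j, l * ed θ (p y) (fderiv ℝ p y (e i)) (fderiv ℝ p y (e j)) +
          m * Ψ (p y) (fderiv ℝ p y (e i)) (fderiv ℝ p y (e j)) =
          (l * (r * a) + m * s) * wdg (κ 0 y) (κ 1 y) (e i) (e j) +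
            (l * (r * c) + m * t) * wdg (κ 2 y) (κ 3 y) (e i) (e j) := by
        intro i j
        rw [← ed_pb hpy hθy, hst' _ _ (he i).1 (he j).1,
          hst _ _ (he i).1 (he j).1 (he i).2 (he j).2]
        ring
      have h := hsq l m hlm (fun x x' => l * ed θ (p y) x x' + m * Ψ (p y) x x')
        (fun _ _ => rfl) (fun i => fderiv ℝ p y (e i)) (fun i => (hk _).2 (he i).1)
      simp only [hG, wdg, heκ] at h
      simpa using h
    exact independent_of_hyperbolic (mul_ne_zero hr ha) hdet (key _ _ (Or.inl ⟨rfl, rfl⟩))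
      (key _ _ (Or.inr ⟨rfl, rfl⟩)) (mul_ne_zero hr hc)
  · exact fun v w hv hw => hst' v w ((hk v).1 hv) ((hk w).1 hw)
  · exact fun v w hv hw hv' hw' =>
      hst v w ((hk v).1 hv) ((hk w).1 hw) ((hk' v).1 hv') ((hk' w).1 hw')

end Adapted

end Backlund

/-! ### Coframings and submersions in charts -/

namespace Backlund

open Set Filter

/-- By dimension the covectors span the dual, so `v` is also orthogonal to itself. -/
theorem eq_zero_of_linearIndependent {n : ℕ} {a : Fin n → E n [⋀^Fin 1]→L[ℝ] ℝ}
    (ha : LinearIndependent ℝ a) {v : E n} (hv : ∀ i, a i ![v] = 0) : v = 0 := by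
  let e : E n ≃ₗ[ℝ] (E n [⋀^Fin 1]→L[ℝ] ℝ) :=
    (InnerProductSpace.toDual ℝ (E n)).toLinearEquiv.trans
      (one : (E n [⋀^Fin 1]→L[ℝ] ℝ) ≃L[ℝ] (E n →L[ℝ] ℝ)).symm.toLinearEquiv
  have hfin : FiniteDimensional ℝ (E n [⋀^Fin 1]→L[ℝ] ℝ) := e.finiteDimensional
  have hrank : Fintype.card (Fin n) = Module.finrank ℝ (E n [⋀^Fin 1]→L[ℝ] ℝ) := by
    rw [← e.finrank_eq, finrank_euclideanSpace]
  have hspan := ha.span_eq_top_of_card_eq_finrank' hrank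
  have h1 : ∀ φ : E n [⋀^Fin 1]→L[ℝ] ℝ, φ ![v] = 0 := by
    intro φ
    have h2 : φ ∈ Submodule.span ℝ (range a) := hspan ▸ Submodule.mem_top
    induction h2 using Submodule.span_induction with
    | mem x h => obtain ⟨i, rfl⟩ := h; exact hv i
    | zero => rfl
    | add x y _ _ hx hy =>
      change x ![v] + y ![v] = 0
      rw [hx, hy, add_zero]
    | smul c x _ hx =>
      change c * x ![v] = 0
      rw [hx, mul_zero]
  have h3 := h1 (one.symm (InnerProductSpace.toDual ℝ (E n) v))
  rw [one_symm_apply] at h3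
  exact inner_self_eq_zero.1 h3

section Charts

variable {n l : ℕ} {M : Type*} [TopologicalSpace M] [ChartedSpace (E n) M]
  {M' : Type*} [TopologicalSpace M'] [ChartedSpace (E l) M']

theorem coeff_of_mem_tangentSpace {b : M} {A C Φ : TangentSpace (𝓡 n) b [⋀^Fin 2]→L[ℝ] ℝ}
    {S : Set (TangentSpace (𝓡 n) b [⋀^Fin 1]→L[ℝ] ℝ)}
    (h : Φ ∈ Submodule.span ℝ {A, C} ⊔ idealTwo S) :
    ∃ s t : ℝ, ∀ v w : E n, (∀ σ ∈ S, σ ![v] = 0) → (∀ σ ∈ S, σ ![w] = 0) →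
      Φ ![v, w] = s * A ![v, w] + t * C ![v, w] :=
  exists_coeff_of_mem (V := E n) h

theorem eq_zero_of_mem_idealTwo {b : M} {Φ : TangentSpace (𝓡 n) b [⋀^Fin 2]→L[ℝ] ℝ}
    {σ : TangentSpace (𝓡 n) b [⋀^Fin 1]→L[ℝ] ℝ} (h : Φ ∈ idealTwo {σ}) {v w : E n}
    (hv : σ ![v] = 0) (hw : σ ![w] = 0) : Φ ![v, w] = 0 :=
  idealTwo_le_vanishing (V := E n) (S := {σ}) (by rintro _ rfl; exact hv)
    (by rintro _ rfl; exact hw) h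

theorem wedge_eq_wdg_flatOne (α β : Form n 1 M) (b₀ : M) (y v w : E n) :
    (wedge (α ((extChartAt (𝓡 n) b₀).symm y)) (β ((extChartAt (𝓡 n) b₀).symm y)))
      ![dpar b₀ y v, dpar b₀ y w] = wdg (flatOne α b₀ y) (flatOne β b₀ y) v w := by
  rw [wdg, flatOne_apply, flatOne_apply, flatOne_apply, flatOne_apply]
  rfl

variable [IsManifold (𝓡 n) ∞ M] [IsManifold (𝓡 l) ∞ M']

theorem dpar_injective {x₀ : M} {y : E n} (hy : y ∈ (extChartAt (𝓡 n) x₀).target) :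
    Function.Injective (dpar x₀ y) := by
  have hs : (extChartAt (𝓡 n) x₀).symm y ∈ (chartAt (E n) x₀).source := by
    rw [← extChartAt_source (𝓡 n)]
    exact (extChartAt (𝓡 n) x₀).map_target hy
  have h5 := mfderiv_comp y
    ((contMDiffAt_extChartAt' (n := ∞) (I := 𝓡 n) hs).mdifferentiableAt (by simp))
    ((contMDiffAt_par x₀ hy).mdifferentiableAt (by simp))
  have h6 : (extChartAt (𝓡 n) x₀ ∘ (extChartAt (𝓡 n) x₀).symm : E n → E n) =ᶠ[𝓝 y] id := by
    filter_upwards [(isOpen_extChartAt_target x₀).mem_nhds hy] with z hz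
    exact (extChartAt (𝓡 n) x₀).right_inv hz
  rw [h6.mfderiv_eq, mfderiv_id] at h5
  have h7 : ∀ v : E n, v = (mfderiv (𝓡 n) 𝓘(ℝ, E n) (extChartAt (𝓡 n) x₀)
      ((extChartAt (𝓡 n) x₀).symm y) : E n →L[ℝ] E n) (dpar x₀ y v) :=
    fun v => DFunLike.congr_fun h5 v
  exact (Function.LeftInverse.injective fun v => (h7 v).symm)

theorem dpar_surjective {x₀ : M} {y : E n} (hy : y ∈ (extChartAt (𝓡 n) x₀).target) :
    Function.Surjective (dpar x₀ y) :=
  LinearMap.injective_iff_surjective (f := (dpar x₀ y : E n →ₗ[ℝ] E n)).1 (dpar_injective hy)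

variable {f : M → M'} (hf : ContMDiff (𝓡 n) (𝓡 l) ∞ f) {x₀ : M} {x₁ : M'} {y : E n}
  (hy : y ∈ (extChartAt (𝓡 n) x₀).target)
  (hx₁ : f ((extChartAt (𝓡 n) x₀).symm y) ∈ (extChartAt (𝓡 l) x₁).source)

include hf hy hx₁

theorem pb_flatOne (θ : Form l 1 M') (v : E n) :
    pb (coordMap f x₀ x₁) (flatOne θ x₁) y v =
      formAt θ (f ((extChartAt (𝓡 n) x₀).symm y))
        ![tangent f ((extChartAt (𝓡 n) x₀).symm y) (dpar x₀ y v)] := by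
  rw [pb_apply, flatOne_apply, dpar_coordMap hy hf.contMDiffAt hx₁]
  have h : (extChartAt (𝓡 l) x₁).symm (coordMap f x₀ x₁ y : E l) =
    f ((extChartAt (𝓡 n) x₀).symm y) := (extChartAt (𝓡 l) x₁).left_inv hx₁
  rw [h]

theorem pb_flatTwo (Ψ : Form l 2 M') (v w : E n) :
    flatTwo Ψ x₁ (coordMap f x₀ x₁ y : E l) (fderiv ℝ (coordMap f x₀ x₁) y v)
        (fderiv ℝ (coordMap f x₀ x₁) y w) =
      formAt Ψ (f ((extChartAt (𝓡 n) x₀).symm y))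
        ![tangent f ((extChartAt (𝓡 n) x₀).symm y) (dpar x₀ y v),
          tangent f ((extChartAt (𝓡 n) x₀).symm y) (dpar x₀ y w)] := by
  rw [flatTwo_apply, dpar_coordMap hy hf.contMDiffAt hx₁, dpar_coordMap hy hf.contMDiffAt hx₁]
  have h : (extChartAt (𝓡 l) x₁).symm (coordMap f x₀ x₁ y : E l) =
    f ((extChartAt (𝓡 n) x₀).symm y) := (extChartAt (𝓡 l) x₁).left_inv hx₁
  rw [h]

theorem surjective_fderiv_coordMap
    (hs : Function.Surjective (mfderiv (𝓡 n) (𝓡 l) f ((extChartAt (𝓡 n) x₀).symm y))) :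
    Function.Surjective (fderiv ℝ (coordMap f x₀ x₁ : E n → E l) y) := by
  intro w
  obtain ⟨u, hu⟩ := hs (dpar x₁ (coordMap f x₀ x₁ y : E l) w)
  obtain ⟨v, hv⟩ := dpar_surjective hy u
  refine ⟨v, ?_⟩
  have ht : (coordMap f x₀ x₁ y : E l) ∈ (extChartAt (𝓡 l) x₁).target :=
    (extChartAt (𝓡 l) x₁).map_source hx₁
  apply dpar_injective ht
  rw [dpar_coordMap hy hf.contMDiffAt hx₁, hv]
  exact hu

end Charts

end Backlund

/-! ### Local generators in charts -/

namespace Backlund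

open Set Filter

section Generators

variable {M : Type*} [TopologicalSpace M] [ChartedSpace (E 5) M]
  {B : Type*} [TopologicalSpace B] [ChartedSpace (E 6) B]

/-- The part of a chart target lying over `U`. -/
def chartPreimage {n : ℕ} {M : Type*} [TopologicalSpace M] [ChartedSpace (E n) M] (m₀ : M)
    (U : Set M) : Set (E n) :=
  (extChartAt (𝓡 n) m₀).target ∩ (extChartAt (𝓡 n) m₀).symm ⁻¹' U

theorem isOpen_chartPreimage {n : ℕ} {M : Type*} [TopologicalSpace M] [ChartedSpace (E n) M]
    (m₀ : M) {U : Set M} (hU : IsOpen U) : IsOpen (chartPreimage (n := n) m₀ U) :=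
  (continuousOn_extChartAt_symm m₀).isOpen_inter_preimage (isOpen_extChartAt_target m₀) hU

variable [IsManifold (𝓡 5) ∞ M] [IsManifold (𝓡 6) ∞ B]

/-- Brings hyperbolicity into the form used by `IsCharacteristicCoframing.of_adapted`; only the
product of the two unmixed values survives in the wedge square. -/
theorem IsHyperbolicGenerator.exists_roots {I : FormIdeal 5 M} {U : Set M} {θ : Form 5 1 M}
    {Ψ : Form 5 2 M} (h : IsHyperbolicGenerator I U θ Ψ) {m₀ : M} {m : E 5}
    (hm : m ∈ chartPreimage m₀ U) :
    ∃ l₁ m₁ l₂ m₂ : ℝ, l₁ * m₂ - l₂ * m₁ ≠ 0 ∧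
      ∀ l r, (l = l₁ ∧ r = m₁ ∨ l = l₂ ∧ r = m₂) → ∀ G : E 5 → E 5 → ℝ,
        (∀ x y, G x y = l * ed (flatOne θ m₀) m x y + r * flatTwo Ψ m₀ m x y) →
        ∀ X : Fin 4 → E 5, (∀ i, flatOne θ m₀ m (X i) = 0) →
        G (X 0) (X 2) = 0 → G (X 0) (X 3) = 0 → G (X 1) (X 2) = 0 → G (X 1) (X 3) = 0 →
        G (X 0) (X 1) * G (X 2) (X 3) = 0 := by
  obtain ⟨l₁, m₁, l₂, m₂, hdet, h₁, h₂⟩ := h.hyperbolic _ hm.2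
  have key : ∀ l r, SqZeroMod (θ ((extChartAt (𝓡 5) m₀).symm m))
      (l • d θ ((extChartAt (𝓡 5) m₀).symm m) + r • Ψ ((extChartAt (𝓡 5) m₀).symm m)) →
      ∀ G : E 5 → E 5 → ℝ,
        (∀ x y, G x y = l * ed (flatOne θ m₀) m x y + r * flatTwo Ψ m₀ m x y) →
        ∀ X : Fin 4 → E 5, (∀ i, flatOne θ m₀ m (X i) = 0) →
        G (X 0) (X 2) = 0 → G (X 0) (X 3) = 0 → G (X 1) (X 2) = 0 → G (X 1) (X 3) = 0 →
        G (X 0) (X 1) * G (X 2) (X 3) = 0 := by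
    intro l r hsq G hG X hX h02 h03 h12 h13
    have h4 := hsq (fun i => dpar m₀ m (X i)) (fun i => by
      rw [← hX i, flatOne_apply]
      rfl)
    have hval : ∀ i j, (l • d θ ((extChartAt (𝓡 5) m₀).symm m) +
        r • Ψ ((extChartAt (𝓡 5) m₀).symm m)) ![dpar m₀ m (X i), dpar m₀ m (X j)] =
        G (X i) (X j) := by
      intro i j
      rw [hG, ← formAt_d h.smooth_θ hm.1 hm.2, flatTwo_apply]
      rfl
    simp only [wedge₂] at h4
    erw [hval 0 1, hval 2 3, hval 0 2, hval 1 3, hval 0 3, hval 1 2] at h4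
    rw [h02, h03, h12, h13] at h4
    linarith
  refine ⟨l₁, m₁, l₂, m₂, hdet, ?_⟩
  rintro l r (⟨rfl, rfl⟩ | ⟨rfl, rfl⟩)
  · exact key _ _ h₁
  · exact key _ _ h₂

theorem IsHyperbolicGenerator.exists_eq_smul_pb {I : FormIdeal 5 M} {U : Set M} {θ : Form 5 1 M}
    {Ψ : Form 5 2 M} (h : IsHyperbolicGenerator I U θ Ψ) {π : B → M}
    (hπ : ContMDiff (𝓡 6) (𝓡 5) ∞ π) {b₀ : B} {m₀ : M} {y : E 6}
    (hy : y ∈ (extChartAt (𝓡 6) b₀).target)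
    (hU : π ((extChartAt (𝓡 6) b₀).symm y) ∈ U)
    (hm₀ : π ((extChartAt (𝓡 6) b₀).symm y) ∈ (extChartAt (𝓡 5) m₀).source) {η : Form 6 1 B}
    (hη : Submodule.span ℝ {η ((extChartAt (𝓡 6) b₀).symm y)} =
      (I.deg1 (π ((extChartAt (𝓡 6) b₀).symm y))).map
        (pullAt π ((extChartAt (𝓡 6) b₀).symm y))) :
    ∃ l : ℝ, flatOne η b₀ y = l • pb (coordMap π b₀ m₀) (flatOne θ m₀) y := by
  set b := (extChartAt (𝓡 6) b₀).symm y with hb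
  have h1 : η b ∈ (I.deg1 (π b)).map (pullAt π b) := hη ▸ Submodule.mem_span_singleton_self _
  obtain ⟨τ, hτ, hτ'⟩ := Submodule.mem_map.1 h1
  rw [h.deg1_eq _ hU] at hτ
  obtain ⟨l, rfl⟩ := Submodule.mem_span_singleton.1 hτ
  refine ⟨l, ?_⟩
  ext v
  change _ = l * pb (coordMap π b₀ m₀) (flatOne θ m₀) y v
  rw [pb_flatOne hπ hy hm₀, flatOne_apply, ← pull_apply₁ (tangent π _)]
  exact (DFunLike.congr_fun hτ' ![dpar b₀ y v]).symm

theorem exists_coeff_pullAt {π : B → M}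
    (hπ : ContMDiff (𝓡 6) (𝓡 5) ∞ π) {b₀ : B} {m₀ : M} {y : E 6}
    (hy : y ∈ (extChartAt (𝓡 6) b₀).target)
    (hm₀ : π ((extChartAt (𝓡 6) b₀).symm y) ∈ (extChartAt (𝓡 5) m₀).source)
    {η : Fin 6 → Form 6 1 B} {Ψ : Form 5 2 M}
    (hΨ : pullAt π ((extChartAt (𝓡 6) b₀).symm y) (Ψ (π ((extChartAt (𝓡 6) b₀).symm y))) ∈
      Submodule.span ℝ {wedge (η 2 ((extChartAt (𝓡 6) b₀).symm y))
          (η 3 ((extChartAt (𝓡 6) b₀).symm y)), wedge (η 4 ((extChartAt (𝓡 6) b₀).symm y))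
          (η 5 ((extChartAt (𝓡 6) b₀).symm y))}
        ⊔ idealTwo {η 0 ((extChartAt (𝓡 6) b₀).symm y), η 1 ((extChartAt (𝓡 6) b₀).symm y)}) :
    ∃ s t : ℝ, ∀ v w, flatOne (η 0) b₀ y v = 0 → flatOne (η 0) b₀ y w = 0 →
      flatOne (η 1) b₀ y v = 0 → flatOne (η 1) b₀ y w = 0 →
      flatTwo Ψ m₀ (coordMap π b₀ m₀ y : E 5) (fderiv ℝ (coordMap π b₀ m₀) y v)
        (fderiv ℝ (coordMap π b₀ m₀) y w) =
      s * wdg (flatOne (η 2) b₀ y) (flatOne (η 3) b₀ y) v w +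
        t * wdg (flatOne (η 4) b₀ y) (flatOne (η 5) b₀ y) v w := by
  obtain ⟨s, t, hst⟩ := coeff_of_mem_tangentSpace hΨ
  refine ⟨s, t, fun v w h0v h0w h1v h1w => ?_⟩
  rw [flatOne_apply] at h0v h0w h1v h1w
  have h := hst (dpar b₀ y v) (dpar b₀ y w)
    (by rintro _ (rfl | rfl); exacts [h0v, h1v]) (by rintro _ (rfl | rfl); exacts [h0w, h1w])
  rw [wedge_eq_wdg_flatOne, wedge_eq_wdg_flatOne] at h
  rw [pb_flatTwo hπ hy hm₀, ← h, ← pull_apply₂]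
  rfl

end Generators

end Backlund

/-! ### Zero-adapted coframings in charts -/

namespace Backlund

open Set Filter

section Coframing

variable {M₁ M₂ B : Type*} [TopologicalSpace M₁] [ChartedSpace (E 5) M₁]
  [TopologicalSpace M₂] [ChartedSpace (E 5) M₂]
  [TopologicalSpace B] [ChartedSpace (E 6) B] [IsManifold (𝓡 6) ∞ B]
  {I₁ : FormIdeal 5 M₁} {I₂ : FormIdeal 5 M₂} {π₁ : B → M₁} {π₂ : B → M₂} {W : Set B}
  {η : Fin 6 → Form 6 1 B}

theorem IsZeroAdapted.eq_zero (hη : IsZeroAdapted I₁ I₂ π₁ π₂ W η) {b₀ : B} {y : E 6}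
    (hy : y ∈ chartPreimage b₀ W) {v : E 6} (hv : ∀ i, flatOne (η i) b₀ y v = 0) : v = 0 := by
  apply dpar_injective hy.1
  rw [map_zero]
  refine eq_zero_of_linearIndependent (hη.coframing _ hy.2) fun i => ?_
  have h := hv i
  rw [flatOne_apply] at h
  exact h

theorem IsZeroAdapted.contDiffOn (hη : IsZeroAdapted I₁ I₂ π₁ π₂ W η) (b₀ : B) (i : Fin 6) :
    ContDiffOn ℝ ∞ (flatOne (η i) b₀) (chartPreimage b₀ W) := fun _ hy =>
  (contDiffAt_flatOne (hη.smooth i) hy.1 hy.2).contDiffWithinAt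

theorem IsZeroAdapted.exists_dualFrame (hη : IsZeroAdapted I₁ I₂ π₁ π₂ W η) (b₀ : B) :
    ∃ e : Fin 6 → E 6 → E 6, ∀ y ∈ chartPreimage b₀ W, ∀ i j,
      flatOne (η i) b₀ y (e j y) = if i = j then 1 else 0 := by
  obtain ⟨e, -, he⟩ := Backlund.exists_dualFrame (n := 6) (finrank_euclideanSpace_fin)
    (fun i => hη.contDiffOn b₀ i) (fun y hy v hv => hη.eq_zero hy hv)
  exact ⟨e, he⟩

theorem IsZeroAdapted.torsion_chart (hη : IsZeroAdapted I₁ I₂ π₁ π₂ W η) {b₀ : B} {y : E 6}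
    (hy : y ∈ chartPreimage b₀ W) : ∃ A₁ A₂ : ℝ, A₁ ≠ 0 ∧ A₂ ≠ 0 ∧ A₁ * A₂ ≠ 1 ∧
      (∀ v w, flatOne (η 0) b₀ y v = 0 → flatOne (η 0) b₀ y w = 0 →
        ed (flatOne (η 0) b₀) y v w = A₁ * wdg (flatOne (η 2) b₀ y) (flatOne (η 3) b₀ y) v w +
          1 * wdg (flatOne (η 4) b₀ y) (flatOne (η 5) b₀ y) v w) ∧
      (∀ v w, flatOne (η 1) b₀ y v = 0 → flatOne (η 1) b₀ y w = 0 →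
        ed (flatOne (η 1) b₀) y v w = 1 * wdg (flatOne (η 2) b₀ y) (flatOne (η 3) b₀ y) v w +
          A₂ * wdg (flatOne (η 4) b₀ y) (flatOne (η 5) b₀ y) v w) := by
  obtain ⟨A₁, A₂, hA₁, hA₂, hA, h₁, h₂⟩ := hη.torsion _ hy.2
  refine ⟨A₁, A₂, hA₁, hA₂, hA, fun v w hv hw => ?_, fun v w hv hw => ?_⟩
  · rw [flatOne_apply] at hv hw
    have h := eq_zero_of_mem_idealTwo h₁ hv hw
    rw [← formAt_d (hη.smooth 0) hy.1 hy.2, ← wedge_eq_wdg_flatOne, ← wedge_eq_wdg_flatOne,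
      one_mul]
    exact sub_eq_zero.1 h
  · rw [flatOne_apply] at hv hw
    have h := eq_zero_of_mem_idealTwo h₂ hv hw
    rw [← formAt_d (hη.smooth 1) hy.1 hy.2, ← wedge_eq_wdg_flatOne, ← wedge_eq_wdg_flatOne,
      one_mul]
    exact sub_eq_zero.1 h

/-- The common kernel of the two contact forms and one pair is the plane of two dual frame vectors.
A 2-form on it has a single coefficient, here one of the C's. -/
theorem IsZeroAdapted.ed_eq_zero (hη : IsZeroAdapted I₁ I₂ π₁ π₂ W η)
    (hC : ∀ b ∈ W, ∀ e, IsDualFrame η b e → ∀ i, torsionC η b e i = 0) {b₀ : B} {y : E 6}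
    (hy : y ∈ chartPreimage b₀ W) {v w : E 6} (h0v : flatOne (η 0) b₀ y v = 0)
    (h0w : flatOne (η 0) b₀ y w = 0) (h1v : flatOne (η 1) b₀ y v = 0)
    (h1w : flatOne (η 1) b₀ y w = 0) :
    (∀ i : Fin 6, (i = 2 ∨ i = 3) → flatOne (η 2) b₀ y v = 0 → flatOne (η 2) b₀ y w = 0 →
      flatOne (η 3) b₀ y v = 0 → flatOne (η 3) b₀ y w = 0 → ed (flatOne (η i) b₀) y v w = 0) ∧
    (∀ i : Fin 6, (i = 4 ∨ i = 5) → flatOne (η 4) b₀ y v = 0 → flatOne (η 4) b₀ y w = 0 →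
      flatOne (η 5) b₀ y v = 0 → flatOne (η 5) b₀ y w = 0 → ed (flatOne (η i) b₀) y v w = 0) := by
  obtain ⟨e, he⟩ := hη.exists_dualFrame b₀
  have hdual : IsDualFrame η ((extChartAt (𝓡 6) b₀).symm y) (fun j => dpar b₀ y (e j y)) := by
    intro i j
    have h := he y hy i j
    rw [flatOne_apply] at h
    exact h
  have hsum := eq_sum_dualFrame (fun v hv => hη.eq_zero hy hv) (he y hy)
  have hval : ∀ i j k, ed (flatOne (η i) b₀) y (e j y) (e k y) =
      d (η i) ((extChartAt (𝓡 6) b₀).symm y) ![dpar b₀ y (e j y), dpar b₀ y (e k y)] := by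
    intro i j k
    rw [← formAt_d (hη.smooth i) hy.1 hy.2]
    rfl
  have hzero : ∀ {A : E 6 →L[ℝ] E 6 →L[ℝ] ℝ} (_ : ∀ v w, A v w = -A w v) {a b : E 6}
      (_ : A a b = 0) (c₁ c₂ d₁ d₂ : ℝ), A (c₁ • a + c₂ • b) (d₁ • a + d₂ • b) = 0 := by
    intro A hA a b hab c₁ c₂ d₁ d₂
    have ha : A a a = 0 := by linarith [hA a a]
    have hb : A b b = 0 := by linarith [hA b b]
    have hba : A b a = 0 := by rw [hA, hab, neg_zero]
    simp [ha, hb, hba, hab]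
  have hcc := hC _ hy.2 _ hdual
  constructor
  · intro i hi h2v h2w h3v h3w
    have hv := hsum v
    have hw := hsum w
    simp only [Fin.sum_univ_six, h0v, h1v, h2v, h3v, zero_smul, zero_add] at hv
    simp only [Fin.sum_univ_six, h0w, h1w, h2w, h3w, zero_smul, zero_add] at hw
    rw [hv, hw]
    refine hzero (ed_swap _ _) ?_ _ _ _ _
    rw [hval]
    rcases hi with rfl | rfl
    · exact hcc 0
    · exact hcc 1
  · intro i hi h2v h2w h3v h3w
    have hv := hsum v
    have hw := hsum w
    simp only [Fin.sum_univ_six, h0v, h1v, h2v, h3v, zero_smul, zero_add, add_zero] at hv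
    simp only [Fin.sum_univ_six, h0w, h1w, h2w, h3w, zero_smul, zero_add, add_zero] at hw
    rw [hv, hw]
    refine hzero (ed_swap _ _) ?_ _ _ _ _
    rw [hval]
    rcases hi with rfl | rfl
    · exact hcc 2
    · exact hcc 3

end Coframing

end Backlund

/-! ### The transformation in charts -/

namespace Backlund

open Set Filter

/-- A transformation without torsion is, in charts, a transformation of wave equations. -/
theorem exists_waveTransformation_chart {M₁ M₂ B : Type*} [TopologicalSpace M₁]
    [ChartedSpace (E 5) M₁] [IsManifold (𝓡 5) ∞ M₁] [TopologicalSpace M₂] [ChartedSpace (E 5) M₂]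
    [IsManifold (𝓡 5) ∞ M₂] [TopologicalSpace B] [ChartedSpace (E 6) B] [IsManifold (𝓡 6) ∞ B]
    {I₁ : FormIdeal 5 M₁} {I₂ : FormIdeal 5 M₂} {π₁ : B → M₁} {π₂ : B → M₂} {W : Set B}
    {η : Fin 6 → Form 6 1 B} (hB : IsBacklund I₁ I₂ π₁ π₂) (hW : IsOpen W)
    (hη : IsZeroAdapted I₁ I₂ π₁ π₂ W η)
    (hC : ∀ b ∈ W, ∀ e, IsDualFrame η b e → ∀ i, torsionC η b e i = 0)
    {U₁ : Set M₁} {U₂ : Set M₂} {θ₁ : Form 5 1 M₁} {Ψ₁ : Form 5 2 M₁} {θ₂ : Form 5 1 M₂}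
    {Ψ₂ : Form 5 2 M₂} (hU₁ : IsOpen U₁) (hU₂ : IsOpen U₂)
    (h₁ : IsHyperbolicGenerator I₁ U₁ θ₁ Ψ₁) (h₂ : IsHyperbolicGenerator I₂ U₂ θ₂ Ψ₂) {b₀ : B}
    (hb₀ : b₀ ∈ W) (hb₁ : π₁ b₀ ∈ U₁) (hb₂ : π₂ b₀ ∈ U₂) :
    ∃ (f g : OpenPartialHomeomorph (ℝ × ℝ) (ℝ × ℝ)) (φ₁ φ₂ : OpenPartialHomeomorph (E 5) (E 5))
      (N' : Set (E 6)), ContDiffOn ℝ ∞ f f.source ∧ ContDiffOn ℝ ∞ f.symm f.target ∧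
      ContDiffOn ℝ ∞ g g.source ∧ ContDiffOn ℝ ∞ g.symm g.target ∧
      (∀ v ∈ f.source, ∀ w ∈ g.source,
        0 ≠ (fderiv ℝ f v).det ∧ (fderiv ℝ f v).det ≠ (fderiv ℝ g w).det ∧
          (fderiv ℝ g w).det ≠ 0) ∧
      IsOpen N' ∧ extChartAt (𝓡 6) b₀ b₀ ∈ N' ∧
      N' ⊆ chartPreimage b₀ (π₁ ⁻¹' (extChartAt (𝓡 5) (π₁ b₀)).source ∩
        π₂ ⁻¹' (extChartAt (𝓡 5) (π₂ b₀)).source) ∧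
      extChartAt (𝓡 5) (π₁ b₀) (π₁ b₀) ∈ φ₁.source ∧
      extChartAt (𝓡 5) (π₂ b₀) (π₂ b₀) ∈ φ₂.source ∧
      φ₁.source ⊆ chartPreimage (π₁ b₀) U₁ ∧ φ₂.source ⊆ chartPreimage (π₂ b₀) U₂ ∧
      IsWaveModel (flatOne θ₁ (π₁ b₀)) (flatTwo Ψ₁ (π₁ b₀)) φ₁ ∧
      IsWaveModel (flatOne θ₂ (π₂ b₀)) (flatTwo Ψ₂ (π₂ b₀)) φ₂ ∧
      ∀ m₁ ∈ φ₁.source, ∀ m₂ ∈ φ₂.source,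
        (∃ y ∈ N', coordMap π₁ b₀ (π₁ b₀) y = m₁ ∧ coordMap π₂ b₀ (π₂ b₀) y = m₂) ↔
          (φ₁ m₁, φ₂ m₂) ∈ waveTransformation f g := by
  set N : Set (E 6) := chartPreimage b₀ (W ∩ (π₁ ⁻¹' (U₁ ∩ (extChartAt (𝓡 5) (π₁ b₀)).source) ∩
    π₂ ⁻¹' (U₂ ∩ (extChartAt (𝓡 5) (π₂ b₀)).source))) with hNdef
  have hN : IsOpen N := isOpen_chartPreimage b₀ <| hW.inter <|
    ((hU₁.inter (isOpen_extChartAt_source _)).preimage hB.smooth₁.continuous).inter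
      ((hU₂.inter (isOpen_extChartAt_source _)).preimage hB.smooth₂.continuous)
  have hNW : N ⊆ chartPreimage b₀ W := fun y hy => ⟨hy.1, hy.2.1⟩
  set κ : Fin 4 → E 6 → E 6 →L[ℝ] ℝ := fun i => flatOne (η ((![2, 3, 4, 5] : Fin 4 → Fin 6) i)) b₀
    with hκdef
  obtain ⟨e, he⟩ := hη.exists_dualFrame b₀
  have hp₁ : ContDiffOn ℝ ∞ (coordMap π₁ b₀ (π₁ b₀) : E 6 → E 5) N := fun y hy =>
    (contDiffAt_coordMap hy.1 hB.smooth₁.contMDiffAt hy.2.2.1.2).contDiffWithinAt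
  have hp₂ : ContDiffOn ℝ ∞ (coordMap π₂ b₀ (π₂ b₀) : E 6 → E 5) N := fun y hy =>
    (contDiffAt_coordMap hy.1 hB.smooth₂.contMDiffAt hy.2.2.2.2).contDiffWithinAt
  have hNU₁ : MapsTo (coordMap π₁ b₀ (π₁ b₀) : E 6 → E 5) N (chartPreimage (π₁ b₀) U₁) := by
    refine fun y hy => ⟨(extChartAt (𝓡 5) (π₁ b₀)).map_source hy.2.2.1.2, ?_⟩
    change (extChartAt (𝓡 5) (π₁ b₀)).symm (extChartAt (𝓡 5) (π₁ b₀) _) ∈ U₁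
    rw [(extChartAt (𝓡 5) (π₁ b₀)).left_inv hy.2.2.1.2]
    exact hy.2.2.1.1
  have hNU₂ : MapsTo (coordMap π₂ b₀ (π₂ b₀) : E 6 → E 5) N (chartPreimage (π₂ b₀) U₂) := by
    refine fun y hy => ⟨(extChartAt (𝓡 5) (π₂ b₀)).map_source hy.2.2.2.2, ?_⟩
    change (extChartAt (𝓡 5) (π₂ b₀)).symm (extChartAt (𝓡 5) (π₂ b₀) _) ∈ U₂
    rw [(extChartAt (𝓡 5) (π₂ b₀)).left_inv hy.2.2.2.2]
    exact hy.2.2.2.1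
  have hθ₁ : ContDiffOn ℝ ∞ (flatOne θ₁ (π₁ b₀)) (chartPreimage (π₁ b₀) U₁) := fun y hy =>
    (contDiffAt_flatOne h₁.smooth_θ hy.1 hy.2).contDiffWithinAt
  have hθ₂ : ContDiffOn ℝ ∞ (flatOne θ₂ (π₂ b₀)) (chartPreimage (π₂ b₀) U₂) := fun y hy =>
    (contDiffAt_flatOne h₂.smooth_θ hy.1 hy.2).contDiffWithinAt
  have hα : ∀ i, ContDiffOn ℝ ∞ (flatOne (η i) b₀) N := fun i => (hη.contDiffOn b₀ i).mono hNW
  have hαp₁ : ∀ y ∈ N, ∃ l : ℝ, flatOne (η 0) b₀ y =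
      l • pb (coordMap π₁ b₀ (π₁ b₀)) (flatOne θ₁ (π₁ b₀)) y := fun y hy =>
    h₁.exists_eq_smul_pb hB.smooth₁ hy.1 hy.2.2.1.1 hy.2.2.1.2 (hη.contact₁ _ hy.2.1)
  have hαp₂ : ∀ y ∈ N, ∃ l : ℝ, flatOne (η 1) b₀ y =
      l • pb (coordMap π₂ b₀ (π₂ b₀)) (flatOne θ₂ (π₂ b₀)) y := fun y hy =>
    h₂.exists_eq_smul_pb hB.smooth₂ hy.1 hy.2.2.2.1 hy.2.2.2.2 (hη.contact₂ _ hy.2.1)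
  have hne : ∀ i, ∀ y ∈ N, flatOne (η i) b₀ y ≠ 0 := by
    intro i y hy h
    have h' := he y (hNW hy) i i
    rw [h, if_pos rfl] at h'
    exact zero_ne_one h'
  have hco : ∀ y ∈ N, ∀ v, flatOne (η 0) b₀ y v = 0 → flatOne (η 1) b₀ y v = 0 →
      (∀ i, κ i y v = 0) → v = 0 := by
    intro y hy v h0 h1 hi
    refine hη.eq_zero (hNW hy) fun i => ?_
    fin_cases i
    exacts [h0, h1, hi 0, hi 1, hi 2, hi 3]
  have hframe : ∀ y ∈ N, ∃ e' : Fin 4 → E 6, (∀ j, flatOne (η 0) b₀ y (e' j) = 0 ∧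
      flatOne (η 1) b₀ y (e' j) = 0) ∧ ∀ i j, κ i y (e' j) = if i = j then 1 else 0 := by
    intro y hy
    refine ⟨fun j => e ((![2, 3, 4, 5] : Fin 4 → Fin 6) j) y, fun j => ⟨?_, ?_⟩, fun i j => ?_⟩
    · rw [he y (hNW hy)]
      fin_cases j <;> rfl
    · rw [he y (hNW hy)]
      fin_cases j <;> rfl
    · rw [hκdef]
      simp only
      rw [he y (hNW hy)]
      fin_cases i <;> fin_cases j <;> rfl
  have hΨ₁ : ∀ y ∈ N, ∃ s t : ℝ, ∀ v w, flatOne (η 0) b₀ y v = 0 → flatOne (η 0) b₀ y w = 0 →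
      flatOne (η 1) b₀ y v = 0 → flatOne (η 1) b₀ y w = 0 → _ := fun y hy =>
    exists_coeff_pullAt (Ψ := Ψ₁) (η := η) hB.smooth₁ hy.1 hy.2.2.1.2 (by
      rw [← hη.ideal _ hy.2.1]
      refine Submodule.mem_sup_left (Submodule.mem_sup_left (Submodule.mem_map_of_mem ?_))
      rw [h₁.deg2_eq _ hy.2.2.1.1]
      exact Submodule.mem_sup_left (Submodule.subset_span (Or.inr rfl)))
  have hΨ₂ : ∀ y ∈ N, ∃ s t : ℝ, ∀ v w, flatOne (η 0) b₀ y v = 0 → flatOne (η 0) b₀ y w = 0 →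
      flatOne (η 1) b₀ y v = 0 → flatOne (η 1) b₀ y w = 0 → _ := fun y hy =>
    exists_coeff_pullAt (Ψ := Ψ₂) (η := η) hB.smooth₂ hy.1 hy.2.2.2.2 (by
      rw [← hη.ideal _ hy.2.1]
      refine Submodule.mem_sup_left (Submodule.mem_sup_right (Submodule.mem_map_of_mem ?_))
      rw [h₂.deg2_eq _ hy.2.2.2.1]
      exact Submodule.mem_sup_left (Submodule.subset_span (Or.inr rfl)))
  have hK₁ : IsCharacteristicCoframing N (chartPreimage (π₁ b₀) U₁) (coordMap π₁ b₀ (π₁ b₀))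
      (flatOne θ₁ (π₁ b₀)) (flatTwo Ψ₁ (π₁ b₀))
      (pb (coordMap π₂ b₀ (π₂ b₀)) (flatOne θ₂ (π₂ b₀))) κ := by
    refine IsCharacteristicCoframing.of_adapted hN (isOpen_chartPreimage _ hU₁) hp₁ hNU₁ hθ₁
      (fun m hm => differentiableAt_flatTwo h₁.smooth_Ψ hm.1 hm.2)
      (contDiffOn_pb hN hp₂ hθ₂ hNU₂) (fun i => hα _) (hα 0) hαp₁ (hne 0) hαp₂ (hne 1) hframe hco
      (fun y hy => surjective_fderiv_coordMap hB.smooth₁ hy.1 hy.2.2.1.2 (hB.submersion₁ _))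
      (fun y hy => ?_) hΨ₁ (fun m hm => h₁.exists_roots hm)
    obtain ⟨A₁, A₂, hA₁, -, -, h, -⟩ := hη.torsion_chart (hNW hy)
    exact ⟨A₁, 1, hA₁, one_ne_zero, h⟩
  have hK₂ : IsCharacteristicCoframing N (chartPreimage (π₂ b₀) U₂) (coordMap π₂ b₀ (π₂ b₀))
      (flatOne θ₂ (π₂ b₀)) (flatTwo Ψ₂ (π₂ b₀))
      (pb (coordMap π₁ b₀ (π₁ b₀)) (flatOne θ₁ (π₁ b₀))) κ := by
    refine IsCharacteristicCoframing.of_adapted hN (isOpen_chartPreimage _ hU₂) hp₂ hNU₂ hθ₂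
      (fun m hm => differentiableAt_flatTwo h₂.smooth_Ψ hm.1 hm.2)
      (contDiffOn_pb hN hp₁ hθ₁ hNU₁) (fun i => hα _) (hα 1) hαp₂ (hne 1) hαp₁ (hne 0)
      (fun y hy => (hframe y hy).imp fun e' h => ⟨fun j => (h.1 j).symm, h.2⟩)
      (fun y hy v h0 h1 => hco y hy v h1 h0)
      (fun y hy => surjective_fderiv_coordMap hB.smooth₂ hy.1 hy.2.2.2.2 (hB.submersion₂ _))
      (fun y hy => ?_) (fun y hy => ?_) (fun m hm => h₂.exists_roots hm)
    · obtain ⟨A₁, A₂, -, hA₂, -, -, h⟩ := hη.torsion_chart (hNW hy)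
      exact ⟨1, A₂, one_ne_zero, hA₂, h⟩
    · obtain ⟨s, t, h⟩ := hΨ₂ y hy
      exact ⟨s, t, fun v w h1v h1w h0v h0w => h v w h0v h0w h1v h1w⟩
  have hker : ∀ {α γ : E 6 → E 6 →L[ℝ] ℝ} {y : E 6} {v : E 6}, (∃ l : ℝ, α y = l • γ y) →
      γ y v = 0 → α y v = 0 := by
    rintro α γ y v ⟨l, hl⟩ hv
    rw [hl]
    change l * γ y v = 0
    rw [hv, mul_zero]
  have hy₀ : extChartAt (𝓡 6) b₀ b₀ ∈ N := by
    refine ⟨mem_extChartAt_target b₀, ?_⟩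
    rw [mem_preimage, extChartAt_to_inv]
    exact ⟨hb₀, ⟨hb₁, mem_extChartAt_source _⟩, ⟨hb₂, mem_extChartAt_source _⟩⟩
  obtain ⟨f, g, φ₁, φ₂, N', hf, hf', hg, hg', hdet, hN', hyN', hNN', hφ₁, hφ₂, hs₁, hs₂, hw₁, hw₂,
    hiff⟩ := exists_waveTransformation (finrank_euclideanSpace_fin) hK₁ hK₂
      (by
        intro i hi y hy v w h1 h2 h3 h4 h5 h6 h7 h8
        refine (hη.ed_eq_zero hC (hNW hy) (hker (hαp₁ y hy) h1) (hker (hαp₁ y hy) h2)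
          (hker (hαp₂ y hy) h3) (hker (hαp₂ y hy) h4)).1 _ ?_ h5 h6 h7 h8
        rcases hi with rfl | rfl
        exacts [Or.inl rfl, Or.inr rfl])
      (by
        intro i hi y hy v w h1 h2 h3 h4 h5 h6 h7 h8
        refine (hη.ed_eq_zero hC (hNW hy) (hker (hαp₁ y hy) h1) (hker (hαp₁ y hy) h2)
          (hker (hαp₂ y hy) h3) (hker (hαp₂ y hy) h4)).2 _ ?_ h5 h6 h7 h8
        rcases hi with rfl | rfl
        exacts [Or.inl rfl, Or.inr rfl]) hy₀
      (by
        -- The factors `r₁`, `r₂` pass from the coframing to the pulled-back contact forms. Testing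
        -- dθ₂ = s dθ₁ on the frame vectors dual to each pair gives r₂ = s r₁ A₁ and r₂ A₂ = s r₁,
        -- hence A₁ A₂ = 1.
        intro s
        by_contra! hcon
        obtain ⟨A₁, A₂, hA₁, hA₂, hA, ht₁, ht₂⟩ := hη.torsion_chart (hNW hy₀)
        obtain ⟨r₁, hr₁, hr₁'⟩ := exists_ed_eq_mul
          (ContDiffOn.differentiableAt_of_isOpen (hα 0) hN hy₀)
          (ContDiffOn.differentiableAt_of_isOpen (contDiffOn_pb hN hp₁ hθ₁ hNU₁) hN hy₀)
          (by filter_upwards [hN.mem_nhds hy₀] with z hz using hαp₁ z hz) (hne 0 _ hy₀)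
        obtain ⟨r₂, hr₂, hr₂'⟩ := exists_ed_eq_mul
          (ContDiffOn.differentiableAt_of_isOpen (hα 1) hN hy₀)
          (ContDiffOn.differentiableAt_of_isOpen (contDiffOn_pb hN hp₂ hθ₂ hNU₂) hN hy₀)
          (by filter_upwards [hN.mem_nhds hy₀] with z hz using hαp₂ z hz) (hne 1 _ hy₀)
        obtain ⟨e', he', heκ⟩ := hframe _ hy₀
        have hcoef : ∀ {α γ : E 6 → E 6 →L[ℝ] ℝ} {y : E 6} {v : E 6}, (∃ l : ℝ, α y = l • γ y) →
            α y ≠ 0 → α y v = 0 → γ y v = 0 := by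
          rintro α γ y v ⟨l, hl⟩ h0 hv
          have hl0 : l ≠ 0 := by
            rintro rfl
            rw [zero_smul] at hl
            exact h0 hl
          rw [hl] at hv
          exact (mul_eq_zero.1 hv).resolve_left hl0
        have hk₁ := fun j => hcoef (hαp₁ _ hy₀) (hne 0 _ hy₀) (he' j).1
        have hk₂ := fun j => hcoef (hαp₂ _ hy₀) (hne 1 _ hy₀) (he' j).2
        have hv := fun i j => hcon (e' i) (e' j) (hk₁ i) (hk₁ j) (hk₂ i) (hk₂ j)
        set y₀ := extChartAt (𝓡 6) b₀ b₀ with hy₀def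
        have hv' : ∀ i j, r₂ * (1 * wdg (κ 0 y₀) (κ 1 y₀) (e' i) (e' j) +
            A₂ * wdg (κ 2 y₀) (κ 3 y₀) (e' i) (e' j)) =
            s * (r₁ * (A₁ * wdg (κ 0 y₀) (κ 1 y₀) (e' i) (e' j) +
              1 * wdg (κ 2 y₀) (κ 3 y₀) (e' i) (e' j))) := by
          intro i j
          have h := hv i j
          rw [hr₁' _ _ (hk₁ i) (hk₁ j), hr₂' _ _ (hk₂ i) (hk₂ j), ht₁ _ _ (he' i).1 (he' j).1,
            ht₂ _ _ (he' i).2 (he' j).2] at h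
          exact h
        have h01 := hv' 0 1
        have h23 := hv' 2 3
        simp only [wdg, heκ] at h01 h23
        simp at h01 h23
        apply hA
        have h5 : r₂ * (A₁ * A₂ - 1) = 0 := by
          rw [mul_sub, mul_one]
          linear_combination A₁ * h23 - h01
        linarith [(mul_eq_zero.1 h5).resolve_left hr₂])
  refine ⟨f, g, φ₁, φ₂, N', hf, hf', hg, hg', hdet, hN', hyN', fun y hy => ?_, ?_, ?_, hs₁, hs₂,
    hw₁, hw₂, hiff⟩
  · have h := hNN' hy
    exact ⟨h.1, h.2.2.1.2, h.2.2.2.2⟩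
  · rw [coordMap, extChartAt_to_inv] at hφ₁
    exact hφ₁
  · rw [coordMap, extChartAt_to_inv] at hφ₂
    exact hφ₂

end Backlund

/-! ### Wave coordinates on the manifolds -/

namespace Backlund

open Set Filter

section WaveCoordinates

variable {M : Type*} [TopologicalSpace M] [ChartedSpace (E 5) M]

/-- Composition of the preferred chart at `m₀` with a change of coordinates, on an open set. -/
noncomputable def chartTrans (m₀ : M) (φ : OpenPartialHomeomorph (E 5) (E 5)) {O : Set M}
    (hO : IsOpen O) : OpenPartialHomeomorph M (E 5) :=
  ((chartAt (E 5) m₀).trans φ).restrOpen O hO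

variable {m₀ : M} {φ : OpenPartialHomeomorph (E 5) (E 5)} {O : Set M} {hO : IsOpen O}

theorem mem_chartTrans_source {m : M} : m ∈ (chartTrans m₀ φ hO).source ↔
    (m ∈ (extChartAt (𝓡 5) m₀).source ∧ extChartAt (𝓡 5) m₀ m ∈ φ.source) ∧ m ∈ O := by
  simp [chartTrans]

theorem chartTrans_apply (m : M) : chartTrans m₀ φ hO m = φ (extChartAt (𝓡 5) m₀ m) := by
  simp [chartTrans]

variable [IsManifold (𝓡 5) ∞ M]

theorem contMDiffOn_chartTrans (hφ : ContDiffOn ℝ ∞ φ φ.source) :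
    ContMDiffOn (𝓡 5) (𝓡 5) ∞ (chartTrans m₀ φ hO) (chartTrans m₀ φ hO).source := by
  have h : ContMDiffOn (𝓡 5) (𝓡 5) ∞ (φ ∘ chartAt (E 5) m₀) (chartTrans m₀ φ hO).source :=
    (contMDiffOn_iff_contDiffOn.2 hφ).comp
      ((contMDiffOn_chart (I := 𝓡 5) (x := m₀)).mono fun m hm => by
        have := (mem_chartTrans_source.1 hm).1.1
        rwa [extChartAt_source] at this)
      fun m hm => (mem_chartTrans_source.1 hm).1.2
  exact h

theorem contMDiffOn_chartTrans_symm (hφ : ContDiffOn ℝ ∞ φ.symm φ.target) :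
    ContMDiffOn (𝓡 5) (𝓡 5) ∞ (chartTrans m₀ φ hO).symm (chartTrans m₀ φ hO).target := by
  have h : ContMDiffOn (𝓡 5) (𝓡 5) ∞ ((chartAt (E 5) m₀).symm ∘ φ.symm)
      ((chartAt (E 5) m₀).trans φ).target :=
    (contMDiffOn_chart_symm (I := 𝓡 5) (x := m₀)).comp
      ((contMDiffOn_iff_contDiffOn.2 hφ).mono fun m hm => by
        rw [OpenPartialHomeomorph.trans_target] at hm
        exact hm.1)
      fun m hm => by
        rw [OpenPartialHomeomorph.trans_target] at hm
        exact hm.2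
  exact h.mono fun m hm => hm.1

theorem tangent_chartTrans (hφ : ContDiffOn ℝ ∞ φ φ.source) {m : M}
    (hm : m ∈ (chartTrans m₀ φ hO).source) (v : E 5) :
    tangent (chartTrans m₀ φ hO) m (dpar m₀ (extChartAt (𝓡 5) m₀ m) v) =
      fderiv ℝ φ (extChartAt (𝓡 5) m₀ m) v := by
  obtain ⟨⟨h1, h2⟩, -⟩ := mem_chartTrans_source.1 hm
  set y := extChartAt (𝓡 5) m₀ m with hy
  have hyt : y ∈ (extChartAt (𝓡 5) m₀).target := (extChartAt (𝓡 5) m₀).map_source h1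
  have hym : (extChartAt (𝓡 5) m₀).symm y = m := (extChartAt (𝓡 5) m₀).left_inv h1
  have hd : MDifferentiableAt (𝓡 5) (𝓡 5) (chartTrans m₀ φ hO)
      ((extChartAt (𝓡 5) m₀).symm y) := by
    rw [hym]
    exact ((contMDiffOn_chartTrans hφ).contMDiffAt
      ((chartTrans m₀ φ hO).open_source.mem_nhds hm)).mdifferentiableAt (by simp)
  have h5 := mfderiv_comp y hd ((contMDiffAt_par m₀ hyt).mdifferentiableAt (by simp))
  have h6 : (chartTrans m₀ φ hO ∘ (extChartAt (𝓡 5) m₀).symm : E 5 → E 5) =ᶠ[𝓝 y] φ := by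
    filter_upwards [(isOpen_extChartAt_target m₀).mem_nhds hyt] with z hz
    change chartTrans m₀ φ hO ((extChartAt (𝓡 5) m₀).symm z) = φ z
    rw [chartTrans_apply, (extChartAt (𝓡 5) m₀).right_inv hz]
  rw [h6.mfderiv_eq, mfderiv_eq_fderiv] at h5
  have h7 := DFunLike.congr_fun h5 v
  have h8 : tangent (chartTrans m₀ φ hO) ((extChartAt (𝓡 5) m₀).symm y) (dpar m₀ y v) =
    fderiv ℝ φ y v := h7.symm
  rwa [hym] at h8

theorem IsHyperbolicGenerator.ideal_eq_map {I : FormIdeal 5 M} {U : Set M} {θ : Form 5 1 M}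
    {Ψ : Form 5 2 M} (h : IsHyperbolicGenerator I U θ Ψ) (hU : φ.source ⊆ chartPreimage m₀ U)
    (hw : IsWaveModel (flatOne θ m₀) (flatTwo Ψ m₀) φ) {m : M}
    (hm : m ∈ (chartTrans m₀ φ hO).source) :
    I.deg1 m = (waveIdeal.deg1 (chartTrans m₀ φ hO m)).map
      (pull (mfderiv (𝓡 5) (𝓡 5) (chartTrans m₀ φ hO) m)) ∧
    I.deg2 m = (waveIdeal.deg2 (chartTrans m₀ φ hO m)).map
      (pull (mfderiv (𝓡 5) (𝓡 5) (chartTrans m₀ φ hO) m)) := by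
  obtain ⟨⟨h1, h2⟩, -⟩ := mem_chartTrans_source.1 hm
  have htan := tangent_chartTrans hw.smooth hm
  set y := extChartAt (𝓡 5) m₀ m with hy
  have hyt : y ∈ (extChartAt (𝓡 5) m₀).target := (extChartAt (𝓡 5) m₀).map_source h1
  have hym : (extChartAt (𝓡 5) m₀).symm y = m := (extChartAt (𝓡 5) m₀).left_inv h1
  have hyU : (extChartAt (𝓡 5) m₀).symm y ∈ U := (hU h2).2
  have hmU : m ∈ U := hym ▸ hyU
  obtain ⟨L, hL⟩ := exists_equiv_of_injective (V := E 5) (W := E 5) rfl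
    (L := tangent (chartTrans m₀ φ hO) m) (by
      intro v hv
      obtain ⟨u, rfl⟩ := dpar_surjective hyt v
      rw [htan] at hv
      rw [fderiv_ne_zero_of_localDiffeo hw.smooth hw.smooth_symm h2 hv, map_zero])
  have hLv : ∀ u, L (dpar m₀ y u) = fderiv ℝ φ y u := fun u => by
    rw [← htan, ← hL]
    rfl
  have hθ : ∀ u, flatOne θ m₀ y u = formAt θ m ![dpar m₀ y u] := fun u => by
    rw [flatOne_apply, hym]
  obtain ⟨r, hr, hrx⟩ := hw.contact y h2
  obtain ⟨a, c, s, t, hdet, hxy⟩ := hw.two_forms y h2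
  -- The coefficients change sign because `area` on the (x, p) and (y, q) components is dx∧dp and
  -- dy∧dq, whereas the generators are dp∧dx and dq∧dy.
  have key := Backlund.ideal_eq_map (L := L) (c := waveContact (φ y))
    (A := wedge (dcoord 3) (dcoord 0)) (B := wedge (dcoord 4) (dcoord 1)) (θ := formAt θ m)
    (Θ := formAt (d θ) m) (Ψ := formAt Ψ m) hr (a := -a) (b := -c) (s := -s) (t := -t) (by
      intro v
      obtain ⟨u, rfl⟩ := dpar_surjective hyt v
      rw [hLv, hrx, hθ]) (by
      intro h'
      exact hdet (by linarith)) (by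
      intro v w hv hw'
      obtain ⟨u, rfl⟩ := dpar_surjective hyt v
      obtain ⟨u', rfl⟩ := dpar_surjective hyt w
      rw [← hθ] at hv hw'
      obtain ⟨e1, e2⟩ := hxy u u' hv hw'
      rw [← formAt_d h.smooth_θ hyt hyU, hym] at e1
      rw [flatTwo_apply, hym] at e2
      rw [e1, e2, hLv, hLv, wedge_dcoord_apply, wedge_dcoord_apply]
      simp only [area, xp, yq]
      constructor <;> ring)
  rw [hL] at key
  rw [h.deg1_eq m hmU, h.deg2_eq m hmU, chartTrans_apply]
  exact key

end WaveCoordinates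

end Backlund

/-! ### The theorem -/

theorem theorem3p1
    {M₁ : Type*} [TopologicalSpace M₁] [ChartedSpace (EuclideanSpace ℝ (Fin 5)) M₁]
    [IsManifold (𝓡 5) ∞ M₁]
    {M₂ : Type*} [TopologicalSpace M₂] [ChartedSpace (EuclideanSpace ℝ (Fin 5)) M₂]
    [IsManifold (𝓡 5) ∞ M₂]
    {B : Type*} [TopologicalSpace B] [ChartedSpace (EuclideanSpace ℝ (Fin 6)) B]
    [IsManifold (𝓡 6) ∞ B]
    (I₁ : Backlund.FormIdeal 5 M₁) (I₂ : Backlund.FormIdeal 5 M₂)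
    (hI₁ : Backlund.IsHyperbolicMongeAmpere I₁) (hI₂ : Backlund.IsHyperbolicMongeAmpere I₂)
    (π₁ : B → M₁) (π₂ : B → M₂) (hB : Backlund.IsBacklund I₁ I₂ π₁ π₂)
    (hC : Backlund.TorsionCVanishes I₁ I₂ π₁ π₂) (b₀ : B) :
    ∃ f g : OpenPartialHomeomorph (ℝ × ℝ) (ℝ × ℝ),
      ContDiffOn ℝ ∞ f f.source ∧ ContDiffOn ℝ ∞ f.symm f.target ∧
      ContDiffOn ℝ ∞ g g.source ∧ ContDiffOn ℝ ∞ g.symm g.target ∧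
      (∀ v ∈ f.source, ∀ w ∈ g.source,
        0 ≠ (fderiv ℝ f v).det ∧ (fderiv ℝ f v).det ≠ (fderiv ℝ g w).det ∧
          (fderiv ℝ g w).det ≠ 0) ∧
      Backlund.ContactEquivalentNear I₁ I₂ π₁ π₂ b₀
        Backlund.waveIdeal Backlund.waveIdeal (Backlund.waveTransformation f g) ∧
      Backlund.SolvedByQuadrature f g ∧ Backlund.SolvedByQuadrature f.symm g.symm := by
  obtain ⟨W, hW, hbW, η, hη, hT⟩ := hC b₀
  obtain ⟨U₁, hU₁, hb₁, θ₁, Ψ₁, h₁⟩ := hI₁ (π₁ b₀)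
  obtain ⟨U₂, hU₂, hb₂, θ₂, Ψ₂, h₂⟩ := hI₂ (π₂ b₀)
  obtain ⟨f, g, φ₁, φ₂, N', hf, hf', hg, hg', hdet, hN', hyN', hNN', hφ₁, hφ₂, hs₁, hs₂, hw₁, hw₂,
    hiff⟩ := Backlund.exists_waveTransformation_chart hB hW hη hT hU₁ hU₂ h₁ h₂ hbW hb₁ hb₂
  have hS : IsOpen ((extChartAt (𝓡 6) b₀).source ∩ extChartAt (𝓡 6) b₀ ⁻¹' N') :=
    (continuousOn_extChartAt b₀).isOpen_inter_preimage (isOpen_extChartAt_source b₀) hN'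
  -- `B` has the topology induced from the product, so near the base point no other sheet of `B`
  -- enters the neighbourhood. Shrinking to a product of open sets restricts the two charts
  -- separately.
  obtain ⟨O, hO, hOS⟩ := hB.embedding.isOpen_iff.1 hS
  have hbO : (π₁ b₀, π₂ b₀) ∈ O := by
    have h : b₀ ∈ (extChartAt (𝓡 6) b₀).source ∩ extChartAt (𝓡 6) b₀ ⁻¹' N' :=
      ⟨mem_extChartAt_source b₀, hyN'⟩
    rw [← hOS] at h
    exact h
  obtain ⟨O₁, O₂, hO₁, hO₂, hbO₁, hbO₂, hOO⟩ := isOpen_prod_iff.1 hO _ _ hbO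
  refine ⟨f, g, hf, hf', hg, hg', hdet, ⟨Backlund.chartTrans (π₁ b₀) φ₁ hO₁,
    Backlund.chartTrans (π₂ b₀) φ₂ hO₂,
    Backlund.mem_chartTrans_source.2 ⟨⟨mem_extChartAt_source _, hφ₁⟩, hbO₁⟩,
    Backlund.mem_chartTrans_source.2 ⟨⟨mem_extChartAt_source _, hφ₂⟩, hbO₂⟩,
    Backlund.contMDiffOn_chartTrans hw₁.smooth, Backlund.contMDiffOn_chartTrans_symm hw₁.smooth_symm,
    Backlund.contMDiffOn_chartTrans hw₂.smooth, Backlund.contMDiffOn_chartTrans_symm hw₂.smooth_symm,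
    fun m hm => h₁.ideal_eq_map hs₁ hw₁ hm, fun m hm => h₂.ideal_eq_map hs₂ hw₂ hm,
    fun m₁ hm₁ m₂ hm₂ => ?_⟩, Backlund.solvedByQuadrature hf hf' hg hg', ?_⟩
  · obtain ⟨⟨hc₁, hd₁⟩, ho₁⟩ := Backlund.mem_chartTrans_source.1 hm₁
    obtain ⟨⟨hc₂, hd₂⟩, ho₂⟩ := Backlund.mem_chartTrans_source.1 hm₂
    rw [Backlund.chartTrans_apply, Backlund.chartTrans_apply, ← hiff _ hd₁ _ hd₂]
    constructor
    · rintro ⟨b, rfl, rfl⟩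
      have hb : b ∈ (extChartAt (𝓡 6) b₀).source ∩ extChartAt (𝓡 6) b₀ ⁻¹' N' := by
        rw [← hOS]
        exact hOO ⟨ho₁, ho₂⟩
      refine ⟨extChartAt (𝓡 6) b₀ b, hb.2, ?_, ?_⟩
      · rw [Backlund.coordMap, (extChartAt (𝓡 6) b₀).left_inv hb.1]
      · rw [Backlund.coordMap, (extChartAt (𝓡 6) b₀).left_inv hb.1]
    · rintro ⟨y, hy, hy₁, hy₂⟩
      have h := (hNN' hy).2
      exact ⟨(extChartAt (𝓡 6) b₀).symm y, (extChartAt (𝓡 5) (π₁ b₀)).injOn h.1 hc₁ hy₁,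
        (extChartAt (𝓡 5) (π₂ b₀)).injOn h.2 hc₂ hy₂⟩
  · exact Backlund.solvedByQuadrature (f := f.symm) (g := g.symm) hf' (by simpa using hf) hg'
      (by simpa using hg)
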